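/- **Conventions.** Groups are compact Hausdorff topological groups and subgroups are closed. Consider the category of pairs $(X,G)$ of a space $X$ with a continuous action of a group $G$; a morphism $(Y,H)\to(X,G)$ is a continuous homomorphism $\varphi\colon H\to G$ with a continuous $\varphi$-equivariant map $Y\to X$. $H^3_G(X;\mathbb Z)=H^3(X\times_G EG;\mathbb Z)$ is Borel cohomology (singular cohomology of the Borel construction). **Twists.** A *model of equivariant twists* is a presheaf (pseudofunctor) of monoidal groupoids $(X,G)\mapsto \mathrm{Twist}_G(X)$ on this category, together with: (1) a natural monoidal map $P\mapsto[P]\in H^3_G(X;\mathbb Z)$ classifying isomorphism classes; (2) a natural monoidal Borel construction $\mathrm{Twist}_G(X)\to\mathrm{Twist}(X\times_G EG)$, $P\mapsto P\times_G EG$, compatible with the classes in (1); (3) restriction to subgroups (part of the functoriality); (4) for $H\subseteq G$ and an $H$-space $X$, restriction along $X\to G\times_H X$ is an equivalence $\mathrm{Twist}_G(G\times_H X)\to\mathrm{Twist}_H(X)$; (5) for $X=U\cup V$ with $U,V$ open and $G$-invariant, twists $P_U,P_V$ and an isomorphism $P_U|_{U\cap V}\cong P_V|_{U\cap V}$ glue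 to a twist on $X$, unique up to isomorphism; and, as the identification needed for the Poincaré bundle condition, a natural isomorphism, taking compositions to sums, between the group of automorphisms of the trivial twist on a non-equivariant space $Y$ and $H^2(Y;\mathbb Z)$. **Theories.** A *twisted equivariant cohomology theory* consists of contravariant functors $(X,G,P)\mapsto h^n_G(X,P)$, $n\in\mathbb Z$, from triples (space, group, twist $P\in\mathrm{Twist}_G(X)$) to abelian groups such that: (1) (homotopy) if $f,g\colon Y\to X$ are equivariantly homotopic then for each $P$ there is an isomorphism $f^*P\cong g^*P$ whose induced map $h^n(Y,f^*P)\cong h^n(Y,g^*P)$ carries $f^*$ to $g^*$; (2) (push-forward) for each $G$-equivariant principal $S^1$-bundle $\pi\colon E\to X$ there are homomorphisms $\pi_!\colon h^n_G(E,\pi^*P)\to h^{n-1}_G(X,P)$, natural with respect to pullbacks along maps of spaces, group homomorphisms and morphisms of twists, and for $\mathrm{pr}_X\colon X\times S^1\to X$ the sequence $0\to h^n_G(X,P)\xrightarrow{\mathrm{pr}_X^*}h^n_G(X\times S^1,\mathrm{pr}_X^*P)\xrightarrow{(\mathrm{pr}_X)_!}h^{n-1}_G(X,P)\to0$ is (split)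 exact; (3) (induction) for $H\subseteq G$ and an $H$-space $X$, restriction along $X\to G\times_H X$ is an isomorphism $h^n_G(G\times_HX,P)\cong h^n_H(X,P|_X)$; (4) (Mayer–Vietoris) for $X=U\cup V$ with $U,V$ open and $G$-invariant there is a long exact sequence $\cdots\to h^{n-1}_G(U\cap V,P)\to h^n_G(X,P)\to h^n_G(U,P)\oplus h^n_G(V,P)\to h^n_G(U\cap V,P)\to\cdots$, natural with respect to pullbacks and, up to a sign depending only on the degree, with respect to push-forward. **T-duality.** A *pair* $(E,P)$ over a $G$-space $X$ is a $G$-equivariant principal $S^1$-bundle $E\to X$ with $P\in\mathrm{Twist}_G(E)$. A *$G$-equivariant T-duality triple* $((E,P),(\hat E,\hat P),u)$ over $X$ consists of two pairs and an isomorphism $u\colon p^*P\cong\hat p^*\hat P$ over $E\times_X\hat E$, where $p,\hat p$ are the projections to $E$ and $\hat E$, such that after applying $-\times_GEG$ to the whole diagram the Poincaré bundle condition holds over every point $b$ of $X\times_GEG$: for suitable trivializations of the twists $P\times_GEG$ and $\hat P\times_GEG$ on the fibers of $E\times_GEG$ and $\hat E\times_GEG$ over $b$, the automorphism of the trivial twist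 on the product $S^1\times S^1$ of these fibers induced by $u$ corresponds to the standard symplectic class in $H^2(S^1\times S^1;\mathbb Z)$. Its *T-duality transformation* is $$T=\hat p_!\circ u^*\circ p^*\colon h^n_G(E,P)\to h^n_G(E\times_X\hat E,p^*P)\to h^n_G(E\times_X\hat E,\hat p^*\hat P)\to h^{n-1}_G(\hat E,\hat P).$$ The theory is *$G$-T-admissible* if for each closed subgroup $H\subseteq G$, $T$ is an isomorphism in all degrees for every $H$-equivariant T-duality triple over the one-point space. **Theorem.** Let $G$ be a compact Hausdorff group and $h$ a twisted equivariant cohomology theory that is $G$-T-admissible. Then for every finite $G$-CW-complex $X$, every $G$-equivariant T-duality triple $((E,P),(\hat E,\hat P),u)$ over $X$ and every $n\in\mathbb Z$, the T-duality transformation $T\colon h^n_G(E,P)\to h^{n-1}_G(\hat E,\hat P)$ is an isomorphism. -/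

import Mathlib

namespace TDuality

open CategoryTheory

noncomputable section

/-! ## Spaces with group action -/

/-- A topological space with a continuous (left) action of a compact Hausdorff group. -/
structure GSpace : Type 1 where
  grp : Type
  space : Type
  [group : Group grp]
  [topGrp : TopologicalSpace grp]
  [isTopGrp : IsTopologicalGroup grp]
  [compactGrp : CompactSpace grp]
  [t2Grp : T2Space grp]
  [top : TopologicalSpace space]
  [action : MulAction grp space]
  [contAction : ContinuousSMul grp space]

namespace GSpace

attribute [instance] group topGrp isTopGrp compactGrp t2Grp top action contAction

/-- A morphism `(H, Y) ⟶ (G, X)`: a continuous homomorphism `φ : H → G` and a continuous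
`φ`-equivariant map `Y → X`. -/
@[ext]
structure Hom (Y X : GSpace) where
  φ : Y.grp →ₜ* X.grp
  f : C(Y.space, X.space)
  equivariant : ∀ (g : Y.grp) (y : Y.space), f (g • y) = φ g • f y

instance : Category GSpace where
  Hom := Hom
  id X := ⟨ContinuousMonoidHom.id _, ContinuousMap.id _, fun _ _ => rfl⟩
  comp a b := ⟨b.φ.comp a.φ, b.f.comp a.f, fun g x => by
    change b.f (a.f (g • x)) = b.φ (a.φ g) • b.f (a.f x)
    rw [a.equivariant, b.equivariant]⟩

/-- The `G`-space `X` as an object of the category of spaces with group action. -/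
abbrev of (G X : Type) [Group G] [TopologicalSpace G] [IsTopologicalGroup G] [CompactSpace G]
    [T2Space G] [TopologicalSpace X] [MulAction G X] [ContinuousSMul G X] : GSpace :=
  { grp := G, space := X }

/-- A space without group action, that is, with an action of the trivial group. -/
def triv (Y : Type) [TopologicalSpace Y] : GSpace where
  grp := PUnit
  space := Y
  action :=
    { smul := fun _ y => y
      one_smul := fun _ => rfl
      mul_smul := fun _ _ _ => rfl }
  contAction := ⟨continuous_snd⟩

/-- A continuous map, as a map of spaces with trivial group. -/
def trivMap {Y Z : Type} [TopologicalSpace Y] [TopologicalSpace Z] (f : C(Y, Z)) :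
    triv Y ⟶ triv Z where
  φ := ContinuousMonoidHom.id _
  f := f
  equivariant := fun _ _ => rfl

/-- The one-point space with the trivial action of a closed subgroup `H` of `G`. -/
def point {G : Type} [Group G] [TopologicalSpace G] [IsTopologicalGroup G] [CompactSpace G]
    [T2Space G] (H : Subgroup G) (hH : IsClosed (H : Set G)) : GSpace where
  grp := H
  space := PUnit
  compactGrp := isCompact_iff_compactSpace.mp hH.isCompact
  action :=
    { smul := fun _ y => y
      one_smul := fun _ => rfl
      mul_smul := fun _ _ _ => rfl }
  contAction := ⟨continuous_snd⟩

/-- An invariant subspace of a `G`-space. -/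
abbrev sub (X : GSpace) (U : SubMulAction X.grp X.space) : GSpace :=
  { grp := X.grp, space := U }

/-- The inclusion of an invariant subspace. -/
def incl (X : GSpace) (U : SubMulAction X.grp X.space) : X.sub U ⟶ X where
  φ := ContinuousMonoidHom.id _
  f := ⟨Subtype.val, continuous_subtype_val⟩
  equivariant := fun _ _ => rfl

/-- The inclusion between two invariant subspaces. -/
def inclOfLE (X : GSpace) {U V : SubMulAction X.grp X.space} (h : U ≤ V) : X.sub U ⟶ X.sub V where
  φ := ContinuousMonoidHom.id _
  f := ⟨fun x => ⟨x.1, h x.2⟩, by fun_prop⟩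
  equivariant := fun _ _ => rfl

/-- The preimage of an invariant subspace under an equivariant map. -/
def preimage {Y X : GSpace} (f : Y ⟶ X) (U : SubMulAction X.grp X.space) :
    SubMulAction Y.grp Y.space where
  carrier := f.f ⁻¹' (U : Set X.space)
  smul_mem' g y hy := by
    change f.f (g • y) ∈ U
    rw [f.equivariant]
    exact U.smul_mem _ hy

/-- Two equivariant maps, with the same underlying group homomorphism, are equivariantly
homotopic. -/
def Homotopic {Y X : GSpace} (f g : Y ⟶ X) : Prop :=
  f.φ = g.φ ∧ ∃ F : ContinuousMap.Homotopy f.f g.f,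
    ∀ (t : unitInterval) (k : Y.grp) (y : Y.space), F (t, k • y) = f.φ k • F (t, y)

section Induction

variable {G : Type} [Group G] [TopologicalSpace G] [IsTopologicalGroup G] [CompactSpace G]
  [T2Space G] (H : Subgroup G) (hH : IsClosed (H : Set G))
  (X : Type) [TopologicalSpace X] [MulAction H X] [ContinuousSMul H X]

/-- The relation `(g, x) ∼ (g h⁻¹, h x)` on `G × X`. -/
def indSetoid : Setoid (G × X) where
  r p q := ∃ h : H, q = (p.1 * (h : G)⁻¹, h • p.2)
  iseqv :=
    { refl := fun p => ⟨1, by simp⟩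
      symm := by
        rintro p q ⟨h, rfl⟩
        exact ⟨h⁻¹, by simp⟩
      trans := by
        rintro p q r ⟨h, rfl⟩ ⟨k, rfl⟩
        exact ⟨k * h, by simp [mul_assoc, mul_smul]⟩ }

/-- The space `G ×_H X`. -/
def IndSpace : Type := Quotient (indSetoid H X)

instance : TopologicalSpace (IndSpace H X) := inferInstanceAs (TopologicalSpace (Quotient _))

lemma isOpenQuotientMap_ind : IsOpenQuotientMap (Quotient.mk (indSetoid H X)) where
  surjective := Quotient.mk_surjective
  continuous := continuous_quotient_mk'
  isOpenMap := by
    intro W hW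
    change IsOpen (Quotient.mk (indSetoid H X) ⁻¹' _)
    have : Quotient.mk (indSetoid H X) ⁻¹' (Quotient.mk (indSetoid H X) '' W) =
        ⋃ h : H, (fun p : G × X => ((p.1 * (h : G)⁻¹, h • p.2) : G × X)) ⁻¹' W := by
      ext p
      simp only [Set.mem_preimage, Set.mem_image, Set.mem_iUnion]
      constructor
      · rintro ⟨q, hq, e⟩
        obtain ⟨h, e⟩ := Quotient.exact e.symm
        exact ⟨h, e ▸ hq⟩
      · rintro ⟨h, hh⟩
        exact ⟨_, hh, (Quotient.sound (s := indSetoid H X) ⟨h, rfl⟩).symm⟩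
    rw [this]
    exact isOpen_iUnion fun h => hW.preimage (by fun_prop)

instance : MulAction G (IndSpace H X) where
  smul g := Quotient.map (fun p : G × X => ((g * p.1, p.2) : G × X)) (by
    rintro p q ⟨h, rfl⟩
    exact ⟨h, by simp [mul_assoc]⟩)
  one_smul := by
    rintro ⟨p⟩
    exact congrArg (Quotient.mk (indSetoid H X)) (by simp)
  mul_smul := by
    rintro g k ⟨p⟩
    exact congrArg (Quotient.mk (indSetoid H X)) (by simp [mul_assoc])

instance : ContinuousSMul G (IndSpace H X) where
  continuous_smul := by
    have hq := (IsOpenQuotientMap.id (X := G)).prodMap (isOpenQuotientMap_ind H X)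
    refine hq.isQuotientMap.continuous_iff.mpr ?_
    exact (isOpenQuotientMap_ind H X).continuous.comp
      (f := fun p : G × (G × X) => ((p.1 * p.2.1, p.2.2) : G × X)) (by fun_prop)

/-- The `G`-space `G ×_H X` induced from an `H`-space `X`. -/
abbrev ind : GSpace := of G (IndSpace H X)

/-- An `H`-space, for a closed subgroup `H` of `G`. -/
abbrev ofClosed : GSpace :=
  { grp := H
    space := X
    compactGrp := isCompact_iff_compactSpace.mp hH.isCompact }

/-- The canonical `H`-map `X → G ×_H X`, `x ↦ [1, x]`, covering the inclusion `H → G`. -/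
def toInd : ofClosed H hH X ⟶ ind H X where
  φ := ⟨H.subtype, continuous_subtype_val⟩
  f := ⟨fun x => Quotient.mk (indSetoid H X) (1, x),
    (isOpenQuotientMap_ind H X).continuous.comp (by fun_prop)⟩
  equivariant := fun (h : H) (x : X) =>
    (Quotient.sound (s := indSetoid H X) (a := ((h : G) * 1, x)) (b := (1, h • x))
      ⟨h, Prod.ext (by simp) rfl⟩).symm

end Induction

end GSpace

/-! ## Equivariant circle bundles -/

/-- A `G`-equivariant principal `S¹`-bundle over the `G`-space `X`: a locally trivial principal
bundle for the group `Circle` on whose total space `G` acts by bundle automorphisms covering the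
action on `X`. -/
structure CircleBundle (X : GSpace) where
  total : Type
  [top : TopologicalSpace total]
  [action : MulAction X.grp total]
  [contAction : ContinuousSMul X.grp total]
  [circleAction : MulAction Circle total]
  [contCircle : ContinuousSMul Circle total]
  [commutes : SMulCommClass X.grp Circle total]
  proj : C(total, X.space)
  proj_smul : ∀ (g : X.grp) (v : total), proj (g • v) = g • proj v
  proj_circle : ∀ (z : Circle) (v : total), proj (z • v) = proj v
  locally_trivial : ∀ x : X.space, ∃ U : Set X.space, IsOpen U ∧ x ∈ U ∧
    ∃ e : {v : total // proj v ∈ U} ≃ₜ U × Circle,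
      (∀ v, ((e v).1 : X.space) = proj v.1) ∧
      ∀ (z : Circle) (v : {v : total // proj v ∈ U}),
        (e ⟨z • v.1, (proj_circle z v.1).symm ▸ v.2⟩).2 = z * (e v).2

namespace CircleBundle

attribute [instance] top action contAction circleAction contCircle commutes

/-- The total space, as a `G`-space. -/
abbrev toGSpace {X : GSpace} (E : CircleBundle X) : GSpace :=
  { grp := X.grp, space := E.total }

/-- The bundle projection. -/
def π {X : GSpace} (E : CircleBundle X) : E.toGSpace ⟶ X where
  φ := ContinuousMonoidHom.id _
  f := E.proj
  equivariant := E.proj_smul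

/-- A morphism `m : E' → E` of equivariant circle bundles covering `f : Y → X`. -/
def IsBundleMap {X Y : GSpace} (f : Y ⟶ X) (E' : CircleBundle Y) (E : CircleBundle X)
    (m : E'.toGSpace ⟶ E.toGSpace) : Prop :=
  m ≫ E.π = E'.π ≫ f ∧ ∀ (z : Circle) (v : E'.total), m.f (z • v) = z • m.f v

section Pullback

variable {X Y : GSpace} (f : Y ⟶ X) (E : CircleBundle X)

/-- The fiber product `Y ×_X E`. -/
def PullbackTotal : Type := {p : Y.space × E.total // f.f p.1 = E.proj p.2}

instance : TopologicalSpace (PullbackTotal f E) :=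
  inferInstanceAs (TopologicalSpace {p : Y.space × E.total // f.f p.1 = E.proj p.2})

instance pullbackAction : MulAction Y.grp (PullbackTotal f E) where
  smul g p := ⟨(g • p.1.1, f.φ g • p.1.2), by
    rw [f.equivariant, p.2, E.proj_smul]⟩
  one_smul p := Subtype.ext (Prod.ext (one_smul _ _) (by
    change f.φ 1 • p.1.2 = p.1.2
    rw [map_one, one_smul]))
  mul_smul g h p := Subtype.ext (Prod.ext (mul_smul _ _ _) (by
    change f.φ (g * h) • p.1.2 = f.φ g • f.φ h • p.1.2
    rw [map_mul, mul_smul]))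

instance pullbackCircleAction : MulAction Circle (PullbackTotal f E) where
  smul z p := ⟨(p.1.1, z • p.1.2), by rw [E.proj_circle, p.2]⟩
  one_smul p := Subtype.ext (Prod.ext rfl (one_smul _ _))
  mul_smul g h p := Subtype.ext (Prod.ext rfl (mul_smul _ _ _))

instance pullbackContAction : ContinuousSMul Y.grp (PullbackTotal f E) where
  continuous_smul := by
    refine Continuous.subtype_mk (f := fun p : Y.grp × PullbackTotal f E =>
      ((p.1 • p.2.1.1, f.φ p.1 • p.2.1.2) : Y.space × E.total)) ?_ _
    have h1 : Continuous fun p : Y.grp × PullbackTotal f E => p.2.1 :=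
      continuous_subtype_val.comp continuous_snd
    have h2 : Continuous f.φ := f.φ.continuous_toFun
    exact (continuous_fst.smul h1.fst).prodMk ((h2.comp continuous_fst).smul h1.snd)

instance pullbackContCircle : ContinuousSMul Circle (PullbackTotal f E) where
  continuous_smul := by
    refine Continuous.subtype_mk (f := fun p : Circle × PullbackTotal f E =>
      ((p.2.1.1, p.1 • p.2.1.2) : Y.space × E.total)) ?_ _
    have h1 : Continuous fun p : Circle × PullbackTotal f E => p.2.1 :=
      continuous_subtype_val.comp continuous_snd
    exact h1.fst.prodMk (continuous_fst.smul h1.snd)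

instance pullbackCommutes : SMulCommClass Y.grp Circle (PullbackTotal f E) where
  smul_comm g z p := Subtype.ext (Prod.ext rfl (smul_comm (f.φ g) z p.1.2))

/-- The pullback `f^* E = Y ×_X E` of an equivariant circle bundle. -/
def pullback : CircleBundle Y where
  total := PullbackTotal f E
  action := pullbackAction f E
  contAction := pullbackContAction f E
  circleAction := pullbackCircleAction f E
  contCircle := pullbackContCircle f E
  commutes := pullbackCommutes f E
  proj := ⟨fun p => p.1.1, continuous_fst.comp continuous_subtype_val⟩
  proj_smul _ _ := rfl
  proj_circle _ _ := rfl
  locally_trivial y := by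
    obtain ⟨U, hU, hy, e, he, hz⟩ := E.locally_trivial (f.f y)
    refine ⟨f.f ⁻¹' U, hU.preimage f.f.continuous, hy, ?_, ?_⟩
    · refine
        { toFun := fun p => (⟨p.1.1.1, p.2⟩, (e ⟨p.1.1.2, by rw [← p.1.2]; exact p.2⟩).2)
          invFun := fun q => ⟨⟨(q.1.1, (e.symm (⟨f.f q.1.1, q.1.2⟩, q.2)).1), by
            rw [← he, e.apply_symm_apply]⟩, q.1.2⟩
          left_inv := ?_
          right_inv := ?_
          continuous_toFun := ?_
          continuous_invFun := ?_ }
      · rintro ⟨⟨⟨a, b⟩, hab⟩, ha⟩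
        refine Subtype.ext (Subtype.ext (Prod.ext rfl ?_))
        have hb : E.proj b ∈ U := by rw [← hab]; exact ha
        have : ((⟨f.f a, ha⟩, (e ⟨b, hb⟩).2) : U × Circle) = e ⟨b, hb⟩ :=
          Prod.ext (Subtype.ext (by rw [he]; exact hab)) rfl
        change (e.symm (⟨f.f a, ha⟩, (e ⟨b, hb⟩).2)).1 = b
        rw [this, e.symm_apply_apply]
      · rintro ⟨⟨a, ha⟩, c⟩
        refine Prod.ext rfl ?_
        change (e (e.symm (⟨f.f a, ha⟩, c))).2 = c
        rw [e.apply_symm_apply]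
      · have h1 : Continuous fun p : {p : PullbackTotal f E // p.1.1 ∈ f.f ⁻¹' U} => p.1.1 :=
          continuous_subtype_val.comp continuous_subtype_val
        exact (h1.fst.subtype_mk _).prodMk
          (continuous_snd.comp (e.continuous.comp (h1.snd.subtype_mk _)))
      · have h1 : Continuous fun q : (f.f ⁻¹' U) × Circle => (q.1 : Y.space) :=
          continuous_subtype_val.comp continuous_fst
        have h2 : Continuous fun q : (f.f ⁻¹' U) × Circle =>
            (e.symm (⟨f.f q.1.1, q.1.2⟩, q.2)).1 :=
          continuous_subtype_val.comp (e.symm.continuous.comp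
            (((f.f.continuous.comp h1).subtype_mk _).prodMk continuous_snd))
        exact ((h1.prodMk h2).subtype_mk _).subtype_mk _
    · refine ⟨fun _ => rfl, fun z v => ?_⟩
      exact hz z ⟨v.1.1.2, by rw [← v.1.2]; exact v.2⟩

/-- The canonical map `f^* E → E`. -/
def pullbackMap : (E.pullback f).toGSpace ⟶ E.toGSpace where
  φ := f.φ
  f := ⟨fun p : PullbackTotal f E => p.1.2, continuous_snd.comp continuous_subtype_val⟩
  equivariant _ _ := rfl

end Pullback

/-- The action of `G` on `X × S¹` that is trivial on the factor `S¹`. -/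
abbrev productAction (X : GSpace) : MulAction X.grp (X.space × Circle) where
  smul g p := (g • p.1, p.2)
  one_smul _ := Prod.ext (one_smul _ _) rfl
  mul_smul _ _ _ := Prod.ext (mul_smul _ _ _) rfl

/-- The action of `S¹` on `X × S¹` by multiplication on the factor `S¹`. -/
abbrev productCircleAction (X : GSpace) : MulAction Circle (X.space × Circle) where
  smul z p := (p.1, z * p.2)
  one_smul _ := Prod.ext rfl (one_mul _)
  mul_smul _ _ _ := Prod.ext rfl (mul_assoc _ _ _)

/-- The trivial circle bundle `X × S¹`, with `G` acting trivially on `S¹`. -/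
def product (X : GSpace) : CircleBundle X where
  total := X.space × Circle
  action := productAction X
  circleAction := productCircleAction X
  contAction :=
    letI := productAction X
    ⟨((continuous_fst.smul (continuous_fst.comp continuous_snd)).prodMk
      (continuous_snd.comp continuous_snd))⟩
  contCircle :=
    letI := productCircleAction X
    ⟨((continuous_fst.comp continuous_snd).prodMk
      (continuous_fst.mul (continuous_snd.comp continuous_snd)))⟩
  commutes :=
    letI := productAction X
    letI := productCircleAction X
    ⟨fun _ _ _ => rfl⟩
  proj := ⟨Prod.fst, continuous_fst⟩
  proj_smul _ _ := rfl
  proj_circle _ _ := rfl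
  locally_trivial _ := ⟨Set.univ, isOpen_univ, Set.mem_univ _,
    { toFun := fun v => (⟨v.1.1, v.2⟩, v.1.2)
      invFun := fun q => ⟨(q.1.1, q.2), q.1.2⟩
      left_inv := fun _ => rfl
      right_inv := fun _ => rfl
      continuous_toFun := by fun_prop
      continuous_invFun := by fun_prop }, fun _ => rfl, fun _ _ => rfl⟩

end CircleBundle

/-! ## The Borel construction -/

/-- Milnor's model of `EG`, the infinite join of copies of `G`: points are formal sums
`∑ tᵢ gᵢ` with finitely many nonzero weights `tᵢ ≥ 0` of total `1`, where the entry `gᵢ ∈ G` is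
present exactly when `tᵢ ≠ 0`. -/
@[ext]
structure EG (G : Type) where
  weight : ℕ →₀ ℝ
  entry : ℕ → Option G
  nonneg : ∀ i, 0 ≤ weight i
  total : (weight.sum fun _ t => t) = 1
  isSome_iff : ∀ i, (entry i).isSome ↔ weight i ≠ 0

namespace EG

/-- The coarsest topology for which the weights `tᵢ` are continuous and the entries `gᵢ` are
continuous `G`-valued functions on the open sets `{tᵢ ≠ 0}`. -/
instance (G : Type) [TopologicalSpace G] : TopologicalSpace (EG G) :=
  TopologicalSpace.generateFrom
    ({s | ∃ (i : ℕ) (O : Set ℝ), IsOpen O ∧ s = {x | x.weight i ∈ O}} ∪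
     {s | ∃ (i : ℕ) (W : Set G), IsOpen W ∧ s = {x | ∃ a ∈ x.entry i, a ∈ W}})

/-- The functoriality of `EG` in (not necessarily multiplicative) maps. -/
def mapFun {G H : Type} (φ : G → H) (x : EG G) : EG H where
  weight := x.weight
  entry i := (x.entry i).map φ
  nonneg := x.nonneg
  total := x.total
  isSome_iff i := by rw [Option.isSome_map]; exact x.isSome_iff i

lemma continuous_mapFun {G H : Type} [TopologicalSpace G] [TopologicalSpace H] {φ : G → H}
    (hφ : Continuous φ) : Continuous (mapFun φ) := by
  refine continuous_generateFrom_iff.mpr ?_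
  rintro s (⟨i, O, hO, rfl⟩ | ⟨i, W, hW, rfl⟩)
  · exact TopologicalSpace.isOpen_generateFrom_of_mem (Or.inl ⟨i, O, hO, rfl⟩)
  · refine TopologicalSpace.isOpen_generateFrom_of_mem (Or.inr ⟨i, φ ⁻¹' W, hW.preimage hφ, ?_⟩)
    ext x
    simp [mapFun]

/-- `G` acts on `EG` by left translation of the entries. -/
instance (G : Type) [Group G] : MulAction G (EG G) where
  smul g := mapFun (g * ·)
  one_smul x := EG.ext rfl (funext fun i => by
    change (x.entry i).map (1 * ·) = x.entry i
    simp)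
  mul_smul g h x := EG.ext rfl (funext fun i => by
    change (x.entry i).map (g * h * ·) = ((x.entry i).map (h * ·)).map (g * ·)
    simp [Option.map_map, Function.comp_def, mul_assoc])

end EG

/-- The Borel construction `X ×_G EG`, the quotient of `X × EG` by the diagonal action. -/
def Borel (X : GSpace) : Type := MulAction.orbitRel.Quotient X.grp (X.space × EG X.grp)

instance (X : GSpace) : TopologicalSpace (Borel X) :=
  inferInstanceAs (TopologicalSpace (Quotient (MulAction.orbitRel X.grp (X.space × EG X.grp))))

namespace Borel

/-- The class `[x, e]` in `X ×_G EG`. -/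
def mk {X : GSpace} (x : X.space) (e : EG X.grp) : Borel X :=
  Quotient.mk (MulAction.orbitRel X.grp (X.space × EG X.grp)) (x, e)

lemma continuous_mk (X : GSpace) : Continuous fun p : X.space × EG X.grp => mk p.1 p.2 :=
  continuous_quotient_mk'

/-- The map of Borel constructions induced by a map of spaces with group action. -/
def map {Y X : GSpace} (f : Y ⟶ X) : C(Borel Y, Borel X) where
  toFun := Quotient.map (fun p : Y.space × EG Y.grp => ((f.f p.1, EG.mapFun f.φ p.2) :
      X.space × EG X.grp)) (by
    rintro _ q ⟨g, rfl⟩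
    refine ⟨f.φ g, Prod.ext (f.equivariant g q.1).symm (EG.ext rfl (funext fun i => ?_))⟩
    change ((q.2.entry i).map f.φ).map (f.φ g * ·) = ((q.2.entry i).map (g * ·)).map f.φ
    simp [Option.map_map, Function.comp_def])
  continuous_toFun := by
    have h2 : Continuous f.φ := f.φ.continuous_toFun
    exact Continuous.quotient_map' ((f.f.continuous.comp continuous_fst).prodMk
      ((EG.continuous_mapFun h2).comp continuous_snd)) _

/-- The projection `Y ×_1 E1 → Y` for a space `Y` with trivial group. -/
def trivProj (Y : Type) [TopologicalSpace Y] : C(Borel (GSpace.triv Y), Y) where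
  toFun := Quotient.lift (fun p : Y × EG PUnit => p.1) (by
    rintro _ q ⟨g, rfl⟩
    rfl)
  continuous_toFun := Continuous.quotient_lift
    (f := fun p : (GSpace.triv Y).space × EG (GSpace.triv Y).grp => p.1) continuous_fst _

end Borel

/-- The Borel construction as an endofunctor of the category of spaces with group action, with
values in spaces with trivial group. -/
def borelFunctor : GSpace ⥤ GSpace where
  obj X := GSpace.triv (Borel X)
  map f := GSpace.trivMap (Borel.map f)
  map_id X := by
    refine GSpace.Hom.ext rfl (ContinuousMap.ext ?_)
    rintro ⟨x, e⟩
    refine congrArg (Quotient.mk _) (Prod.ext rfl (EG.ext rfl (funext fun i => ?_)))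
    exact congrFun Option.map_id _
  map_comp f g := by
    refine GSpace.Hom.ext rfl (ContinuousMap.ext ?_)
    rintro ⟨x, e⟩
    refine congrArg (Quotient.mk _) (Prod.ext rfl (EG.ext rfl (funext fun i => ?_)))
    exact (Option.map_map g.φ f.φ (e.entry i)).symm

/-! ## Singular cohomology -/

/-- Singular simplices. -/
abbrev Simplex (X : Type) [TopologicalSpace X] (n : ℕ) : Type := C(stdSimplex ℝ (Fin (n + 1)), X)

/-- The `i`-th face of a singular simplex. -/
def Simplex.face {X : Type} [TopologicalSpace X] {n : ℕ} (σ : Simplex X (n + 1)) (i : Fin (n + 2)) :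
    Simplex X n :=
  σ.comp ⟨stdSimplex.map i.succAbove, stdSimplex.continuous_map _⟩

/-- Integral singular cochains. -/
abbrev Cochain (X : Type) [TopologicalSpace X] (n : ℕ) : Type := Simplex X n → ℤ

/-- The singular coboundary. -/
def coboundary (X : Type) [TopologicalSpace X] (n : ℕ) : Cochain X n →+ Cochain X (n + 1) where
  toFun c σ := ∑ i : Fin (n + 2), (-1) ^ (i : ℕ) * c (σ.face i)
  map_zero' := by ext; simp
  map_add' c d := by ext; simp [mul_add, Finset.sum_add_distrib]

/-- Cocycles of degree `n`. -/
def cocycles (X : Type) [TopologicalSpace X] (n : ℕ) : AddSubgroup (Cochain X n) :=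
  (coboundary X n).ker

/-- Coboundaries of degree `n`. -/
def coboundaries (X : Type) [TopologicalSpace X] : (n : ℕ) → AddSubgroup (Cochain X n)
  | 0 => ⊥
  | n + 1 => (coboundary X n).range

/-- The singular cohomology group `Hⁿ(X; ℤ)`. -/
def Cohomology (X : Type) [TopologicalSpace X] (n : ℕ) : Type :=
  cocycles X n ⧸ (coboundaries X n).addSubgroupOf (cocycles X n)

instance (X : Type) [TopologicalSpace X] (n : ℕ) : AddCommGroup (Cohomology X n) :=
  inferInstanceAs (AddCommGroup (cocycles X n ⧸ (coboundaries X n).addSubgroupOf (cocycles X n)))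

namespace Cohomology

/-- The cohomology class of a cocycle. -/
def mk {X : Type} [TopologicalSpace X] {n : ℕ} (z : cocycles X n) : Cohomology X n :=
  QuotientAddGroup.mk z

section Map

variable {X Y : Type} [TopologicalSpace X] [TopologicalSpace Y] (f : C(X, Y))

/-- Pullback of cochains. -/
def cochainMap (n : ℕ) : Cochain Y n →+ Cochain X n where
  toFun c σ := c (f.comp σ)
  map_zero' := rfl
  map_add' _ _ := rfl

lemma coboundary_cochainMap (n : ℕ) (c : Cochain Y n) :
    coboundary X n (cochainMap f n c) = cochainMap f (n + 1) (coboundary Y n c) := rfl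

/-- Pullback of cocycles. -/
def cocyclesMap (n : ℕ) : cocycles Y n →+ cocycles X n :=
  ((cochainMap f n).comp (cocycles Y n).subtype).codRestrict (cocycles X n) fun z => by
    change coboundary X n (cochainMap f n z.1) = 0
    rw [coboundary_cochainMap, show coboundary Y n z.1 = 0 from z.2, map_zero]

/-- Pullback in singular cohomology. -/
def map (n : ℕ) : Cohomology Y n →+ Cohomology X n :=
  QuotientAddGroup.map _ _ (cocyclesMap f n) (by
    rintro z hz
    change cochainMap f n z.1 ∈ coboundaries X n
    have hz : z.1 ∈ coboundaries Y n := hz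
    cases n with
    | zero =>
      have h0 : z.1 = 0 := hz
      rw [h0, map_zero]
      exact zero_mem _
    | succ m =>
      obtain ⟨b, hb⟩ := hz
      exact ⟨cochainMap f m b, by rw [coboundary_cochainMap, hb]⟩)

end Map

end Cohomology

/-- Borel equivariant cohomology `Hⁿ_G(X; ℤ) = Hⁿ(X ×_G EG; ℤ)`. -/
abbrev EquivCohomology (X : GSpace) (n : ℕ) : Type := Cohomology (Borel X) n

/-- The affine singular simplex in the torus `S¹ × S¹ = ℝ²/ℤ²` with vertices
`(0,0), (1,0), (1,1)`. -/
def torusSimplex₁ : Simplex (Circle × Circle) 2 where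
  toFun x := (Circle.exp (2 * Real.pi * (x 1 + x 2)), Circle.exp (2 * Real.pi * x 2))
  continuous_toFun := by
    have h : ∀ i : Fin 3, Continuous fun x : stdSimplex ℝ (Fin 3) => (x : Fin 3 → ℝ) i :=
      fun i => (continuous_apply i).comp continuous_subtype_val
    exact (Circle.exp.continuous.comp (continuous_const.mul ((h 1).add (h 2)))).prodMk
      (Circle.exp.continuous.comp (continuous_const.mul (h 2)))

/-- The affine singular simplex in the torus `S¹ × S¹ = ℝ²/ℤ²` with vertices
`(0,0), (0,1), (1,1)`. -/
def torusSimplex₂ : Simplex (Circle × Circle) 2 where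
  toFun x := (Circle.exp (2 * Real.pi * x 2), Circle.exp (2 * Real.pi * (x 1 + x 2)))
  continuous_toFun := by
    have h : ∀ i : Fin 3, Continuous fun x : stdSimplex ℝ (Fin 3) => (x : Fin 3 → ℝ) i :=
      fun i => (continuous_apply i).comp continuous_subtype_val
    exact (Circle.exp.continuous.comp (continuous_const.mul (h 2))).prodMk
      (Circle.exp.continuous.comp (continuous_const.mul ((h 1).add (h 2))))

/-- The standard symplectic class of `H²(S¹ × S¹; ℤ) ≅ ℤ`: the class (the cross product of the
two standard generators) that takes the value `1` on the fundamental cycle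
`torusSimplex₁ - torusSimplex₂`. -/
def IsSymplecticClass (c : Cohomology (Circle × Circle) 2) : Prop :=
  ∃ z : cocycles (Circle × Circle) 2, Cohomology.mk z = c ∧
    z.1 torusSimplex₁ - z.1 torusSimplex₂ = 1

/-! ## Models of equivariant twists -/

open Opposite Pseudofunctor MonoidalCategory

universe v u w

/-- A presheaf of monoidal groupoids on the category of spaces with group action: a
pseudofunctor whose values are monoidal groupoids, whose pullback functors are monoidal, and whose
coherence isomorphisms are monoidal. -/
structure TwistPresheaf where
  F : Pseudofunctor (LocallyDiscrete GSpaceᵒᵖ) Cat.{v, u}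
  [groupoid : ∀ X, IsGroupoid (F.obj X)]
  [monoidal : ∀ X, MonoidalCategory (F.obj X)]
  [pullMonoidal : ∀ {X Y : LocallyDiscrete GSpaceᵒᵖ} (f : X ⟶ Y), (F.map f).toFunctor.Monoidal]
  mapId_monoidal : ∀ X : LocallyDiscrete GSpaceᵒᵖ,
    NatTrans.IsMonoidal (F₁ := (F.map (𝟙 X)).toFunctor) (F₂ := 𝟭 (F.obj X))
      (F.mapId X).hom.toNatTrans
  mapComp_monoidal : ∀ {X Y Z : LocallyDiscrete GSpaceᵒᵖ} (f : X ⟶ Y) (g : Y ⟶ Z),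
    NatTrans.IsMonoidal (F₁ := (F.map (f ≫ g)).toFunctor)
      (F₂ := (F.map f).toFunctor ⋙ (F.map g).toFunctor) (F.mapComp f g).hom.toNatTrans

namespace TwistPresheaf

attribute [instance] groupoid monoidal pullMonoidal

variable (𝓣 : TwistPresheaf.{v, u})

/-- The groupoid of `G`-equivariant twists on the `G`-space `X`. -/
abbrev Tw (X : GSpace) : Type u := 𝓣.F.obj ⟨op X⟩

/-- Pullback of twists. -/
abbrev pull {Y X : GSpace} (f : Y ⟶ X) : 𝓣.Tw X ⥤ 𝓣.Tw Y := (𝓣.F.map f.op.toLoc).toFunctor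

/-- The category of triples `(X, G, P)`: spaces with group action and equivariant twist. A
morphism `(Y, H, Q) ⟶ (X, G, P)` is a morphism `f : (Y, H) ⟶ (X, G)` with a morphism of twists
`Q ⟶ f^* P`. -/
abbrev Total : Type (max 1 u) := CoGrothendieck 𝓣.F

variable {𝓣}

/-- The triple `(X, G, P)`. -/
abbrev tri (X : GSpace) (P : 𝓣.Tw X) : 𝓣.Total := ⟨X, P⟩

/-- The canonical morphism `(Y, f^* P) ⟶ (X, P)`. -/
abbrev lift {Y X : GSpace} (f : Y ⟶ X) (P : 𝓣.Tw X) : tri Y ((𝓣.pull f).obj P) ⟶ tri X P :=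
  CoGrothendieck.cartesianLift (F := 𝓣.F) P f

/-- A morphism of twists on `X`, as a morphism of triples covering the identity of `X`. -/
abbrev vert {X : GSpace} {P Q : 𝓣.Tw X} (a : P ⟶ Q) : tri X P ⟶ tri X Q :=
  (CoGrothendieck.ι 𝓣.F X).map a

/-- For `k = f ≫ g`, the canonical morphism `(Z, k^* P) ⟶ (Y, g^* P)` covering `f`. -/
def comparison {Z Y X : GSpace} (f : Z ⟶ Y) (g : Y ⟶ X) (k : Z ⟶ X) (e : k = f ≫ g)
    (P : 𝓣.Tw X) : tri Z ((𝓣.pull k).obj P) ⟶ tri Y ((𝓣.pull g).obj P) :=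
  ⟨f, eqToHom (by subst e; rfl) ≫ (𝓣.F.mapComp g.op.toLoc f.op.toLoc).hom.toNatTrans.app P⟩

lemma comparison_lift {Z Y X : GSpace} (f : Z ⟶ Y) (g : Y ⟶ X) (k : Z ⟶ X) (e : k = f ≫ g)
    (P : 𝓣.Tw X) : comparison f g k e P ≫ lift g P = lift k P := by
  subst e
  refine CoGrothendieck.Hom.ext _ _ rfl ?_
  simp [comparison, ← Cat.Hom₂.comp_app]
  exact (Category.id_comp _).symm

/-- The canonical morphism `(Y, 1) ⟶ (X, 1)` between trivial twists covering `f`. -/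
def unitHom {Y X : GSpace} (f : Y ⟶ X) : tri Y (𝟙_ (𝓣.Tw Y)) ⟶ tri X (𝟙_ (𝓣.Tw X)) :=
  ⟨f, Functor.LaxMonoidal.ε (𝓣.pull f)⟩

/-- Pullback of automorphisms of the trivial twist. -/
def pullAut {Y X : GSpace} (f : Y ⟶ X) (a : Aut (𝟙_ (𝓣.Tw X))) : Aut (𝟙_ (𝓣.Tw Y)) :=
  Functor.Monoidal.εIso (𝓣.pull f) ≪≫ (𝓣.pull f).mapIso a ≪≫
    (Functor.Monoidal.εIso (𝓣.pull f)).symm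

end TwistPresheaf

open TwistPresheaf

/-- The presheaf of twists on Borel constructions, `(X, G) ↦ Twist(X ×_G EG)`. -/
abbrev TwistPresheaf.onBorel (𝓣 : TwistPresheaf.{v, u}) :
    Pseudofunctor (LocallyDiscrete GSpaceᵒᵖ) Cat.{v, u} :=
  borelFunctor.op.toPseudofunctor.comp 𝓣.F

/-- The functor `Twist_G(X) → Twist(X ×_G EG)` of a natural transformation `β`. -/
abbrev TwistPresheaf.borelFun (𝓣 : TwistPresheaf.{v, u}) (β : StrongTrans 𝓣.F 𝓣.onBorel)
    (X : GSpace) : 𝓣.Tw X ⥤ 𝓣.Tw (borelFunctor.obj X) := (β.app ⟨op X⟩).toFunctor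

/-- The naturality isomorphisms `(f^* P) ×_H EH ≅ f^* (P ×_G EG)` of a natural
transformation `β`. -/
abbrev TwistPresheaf.borelNat (𝓣 : TwistPresheaf.{v, u}) (β : StrongTrans 𝓣.F 𝓣.onBorel)
    {Y X : GSpace} (f : Y ⟶ X) :
    𝓣.pull f ⋙ 𝓣.borelFun β Y ≅ 𝓣.borelFun β X ⋙ 𝓣.pull (borelFunctor.map f) :=
  Cat.Hom.toNatIso (β.naturality f.op.toLoc)

/-- A model of equivariant twists. Restriction of twists to subgroups is part of the functoriality
in spaces with group action. -/
structure TwistModel extends toPre : TwistPresheaf.{v, u} where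
  /-- The characteristic class `[P] ∈ H³_G(X; ℤ)`. -/
  cls : ∀ X : GSpace, toPre.Tw X → EquivCohomology X 3
  cls_eq_iff : ∀ (X : GSpace) (P Q : toPre.Tw X), cls X P = cls X Q ↔ Nonempty (P ≅ Q)
  cls_surjective : ∀ X : GSpace, Function.Surjective (cls X)
  cls_tensor : ∀ (X : GSpace) (P Q : toPre.Tw X), cls X (P ⊗ Q) = cls X P + cls X Q
  cls_unit : ∀ X : GSpace, cls X (𝟙_ (toPre.Tw X)) = 0
  cls_pull : ∀ {Y X : GSpace} (f : Y ⟶ X) (P : toPre.Tw X),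
    cls Y ((toPre.pull f).obj P) = Cohomology.map (Borel.map f) 3 (cls X P)
  /-- The identification of the automorphisms of the trivial twist on a (non-equivariant) space `Y`
  with `H²(Y; ℤ)`, taking compositions to sums. -/
  autCls : ∀ (Y : Type) [TopologicalSpace Y],
    Aut (𝟙_ (toPre.Tw (GSpace.triv Y))) ≃* Multiplicative (Cohomology Y 2)
  autCls_pull : ∀ {Y Z : Type} [TopologicalSpace Y] [TopologicalSpace Z] (f : C(Y, Z))
    (a : Aut (𝟙_ (toPre.Tw (GSpace.triv Z)))),
    (autCls Y (pullAut (GSpace.trivMap f) a)).toAdd = Cohomology.map f 2 (autCls Z a).toAdd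
  /-- The Borel construction `P ↦ P ×_G EG`, a natural transformation of presheaves of
  monoidal groupoids `Twist_G(X) → Twist(X ×_G EG)`. -/
  borel : StrongTrans F toPre.onBorel
  [borelMonoidal : ∀ X : GSpace, (toPre.borelFun borel X).Monoidal]
  borelNat_monoidal : ∀ {Y X : GSpace} (f : Y ⟶ X), NatTrans.IsMonoidal (toPre.borelNat borel f).hom
  /-- The class of `P ×_G EG` is that of `P`, where `H³(X ×_G EG)` is identified with the Borel
  cohomology of `X ×_G EG` for the trivial group by the projection `X_G ×_1 E1 → X_G`. -/
  cls_borel : ∀ (X : GSpace) (P : toPre.Tw X),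
    cls (borelFunctor.obj X) ((toPre.borelFun borel X).obj P) =
      Cohomology.map (Borel.trivProj (Borel X)) 3 (cls X P)
  /-- Induction: for a closed subgroup `H` of `G` and an `H`-space `X`, restriction along
  `X → G ×_H X` is an equivalence `Twist_G(G ×_H X) → Twist_H(X)`. -/
  induction : ∀ (G : Type) [Group G] [TopologicalSpace G] [IsTopologicalGroup G] [CompactSpace G]
    [T2Space G] (H : Subgroup G) (hH : IsClosed (H : Set G)) (X : Type) [TopologicalSpace X]
    [MulAction H X] [ContinuousSMul H X],
    (toPre.pull (GSpace.toInd H hH X)).IsEquivalence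
  /-- Gluing: let `X = U ∪ V` with `U`, `V` open and invariant, and let `u : P_U ≅ P_V` be an
  isomorphism of the restrictions to `U ∩ V`. Then there is a twist `P` on `X` with isomorphisms
  `P_U ≅ P|_U`, `P_V ≅ P|_V` (given as morphisms `mU`, `mV` of triples covering the inclusions)
  that are compatible with `u` over `U ∩ V`. -/
  gluing_exists : ∀ (X : GSpace) (U V : SubMulAction X.grp X.space),
    IsOpen (U : Set X.space) → IsOpen (V : Set X.space) → (U : Set X.space) ∪ V = Set.univ →
    ∀ (PU : toPre.Tw (X.sub U)) (PV : toPre.Tw (X.sub V))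
      (u : (toPre.pull (X.inclOfLE (inf_le_left : U ⊓ V ≤ U))).obj PU ≅
        (toPre.pull (X.inclOfLE (inf_le_right : U ⊓ V ≤ V))).obj PV),
      ∃ (P : toPre.Tw X) (mU : tri (X.sub U) PU ⟶ tri X P)
        (mV : tri (X.sub V) PV ⟶ tri X P),
        mU.base = X.incl U ∧ mV.base = X.incl V ∧
        lift (X.inclOfLE inf_le_left) PU ≫ mU =
          vert u.hom ≫ lift (X.inclOfLE inf_le_right) PV ≫ mV
  /-- The glued twist is unique up to isomorphism. -/
  gluing_unique : ∀ (X : GSpace) (U V : SubMulAction X.grp X.space),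
    IsOpen (U : Set X.space) → IsOpen (V : Set X.space) → (U : Set X.space) ∪ V = Set.univ →
    ∀ (PU : toPre.Tw (X.sub U)) (PV : toPre.Tw (X.sub V))
      (u : (toPre.pull (X.inclOfLE (inf_le_left : U ⊓ V ≤ U))).obj PU ≅
        (toPre.pull (X.inclOfLE (inf_le_right : U ⊓ V ≤ V))).obj PV)
      (P P' : toPre.Tw X)
      (mU : tri (X.sub U) PU ⟶ tri X P) (mV : tri (X.sub V) PV ⟶ tri X P)
      (mU' : tri (X.sub U) PU ⟶ tri X P') (mV' : tri (X.sub V) PV ⟶ tri X P'),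
      mU.base = X.incl U → mV.base = X.incl V → mU'.base = X.incl U → mV'.base = X.incl V →
      lift (X.inclOfLE inf_le_left) PU ≫ mU =
        vert u.hom ≫ lift (X.inclOfLE inf_le_right) PV ≫ mV →
      lift (X.inclOfLE inf_le_left) PU ≫ mU' =
        vert u.hom ≫ lift (X.inclOfLE inf_le_right) PV ≫ mV' →
      Nonempty (P ≅ P')

attribute [instance] TwistModel.borelMonoidal

/-! ## Twisted equivariant cohomology theories -/

/-- A twisted equivariant cohomology theory for the model `𝓣` of equivariant twists. The
push-forward is the one along equivariant principal circle bundles. -/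
structure TwistedTheory (𝓣 : TwistModel.{v, u}) where
  /-- The functors `(X, G, P) ↦ hⁿ_G(X, P)`. -/
  h : ℤ → 𝓣.Totalᵒᵖ ⥤ AddCommGrpCat.{w}
  /-- Homotopy invariance. -/
  homotopy : ∀ {Y X : GSpace} (f g : Y ⟶ X), GSpace.Homotopic f g → ∀ P : 𝓣.Tw X,
    ∃ a : (𝓣.pull f).obj P ≅ (𝓣.pull g).obj P, ∀ (n : ℤ) (x : (h n).obj (op (tri X P))),
      (h n).map (lift g P).op x = (h n).map (vert a.inv).op ((h n).map (lift f P).op x)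
  /-- Push-forward along a circle bundle `π : E → X`. -/
  push : ∀ {X : GSpace} (E : CircleBundle X) (P : 𝓣.Tw X) (n : ℤ),
    (h (n + 1)).obj (op (tri E.toGSpace ((𝓣.pull E.π).obj P))) ⟶ (h n).obj (op (tri X P))
  /-- Push-forward is natural with respect to pullbacks (along maps of spaces, group homomorphisms
  and morphisms of twists): for a bundle map `m : E' → E` over `f : Y → X` and a commutative
  square of triples covering it. -/
  push_natural : ∀ {Y X : GSpace} (f : Y ⟶ X) (E' : CircleBundle Y) (E : CircleBundle X)
    (m : E'.toGSpace ⟶ E.toGSpace), CircleBundle.IsBundleMap f E' E m →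
    ∀ (Q : 𝓣.Tw Y) (P : 𝓣.Tw X) (ψ : tri Y Q ⟶ tri X P)
      (Ψ : tri E'.toGSpace ((𝓣.pull E'.π).obj Q) ⟶ tri E.toGSpace ((𝓣.pull E.π).obj P)),
      ψ.base = f → Ψ.base = m → Ψ ≫ lift E.π P = lift E'.π Q ≫ ψ →
      ∀ (n : ℤ) (x : (h (n + 1)).obj (op (tri E.toGSpace ((𝓣.pull E.π).obj P)))),
        push E' Q n ((h (n + 1)).map Ψ.op x) = (h n).map ψ.op (push E P n x)
  /-- For products with the circle, push-forward implements the suspension isomorphism: the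
  sequence `0 → hⁿ(X, P) → hⁿ(X × S¹, pr^* P) → hⁿ⁻¹(X, P) → 0` is (split) exact. -/
  suspension_injective : ∀ (X : GSpace) (P : 𝓣.Tw X) (n : ℤ),
    Function.Injective ((h n).map (lift (CircleBundle.product X).π P).op)
  suspension_exact : ∀ (X : GSpace) (P : 𝓣.Tw X) (n : ℤ)
    (x : (h (n + 1)).obj (op (tri _ ((𝓣.pull (CircleBundle.product X).π).obj P)))),
    push (CircleBundle.product X) P n x = 0 ↔
      ∃ y, (h (n + 1)).map (lift (CircleBundle.product X).π P).op y = x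
  suspension_surjective : ∀ (X : GSpace) (P : 𝓣.Tw X) (n : ℤ),
    Function.Surjective (push (CircleBundle.product X) P n)
  /-- Induction: for a closed subgroup `H` of `G` and an `H`-space `X`, restriction along
  `X → G ×_H X` is an isomorphism `hⁿ_G(G ×_H X, P) → hⁿ_H(X, P|_X)`. -/
  induction : ∀ (G : Type) [Group G] [TopologicalSpace G] [IsTopologicalGroup G] [CompactSpace G]
    [T2Space G] (H : Subgroup G) (hH : IsClosed (H : Set G)) (X : Type) [TopologicalSpace X]
    [MulAction H X] [ContinuousSMul H X] (P : 𝓣.Tw (GSpace.ind H X)) (n : ℤ),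
    Function.Bijective ((h n).map (lift (GSpace.toInd H hH X) P).op)
  /-- The Mayer-Vietoris boundary map for `X = U ∪ V` with `U`, `V` open and invariant. -/
  δ : ∀ (X : GSpace) (P : 𝓣.Tw X) (U V : SubMulAction X.grp X.space),
    IsOpen (U : Set X.space) → IsOpen (V : Set X.space) → (U : Set X.space) ∪ V = Set.univ →
    ∀ n : ℤ, (h n).obj (op (tri (X.sub (U ⊓ V)) ((𝓣.pull (X.incl (U ⊓ V))).obj P))) ⟶
      (h (n + 1)).obj (op (tri X P))
  /-- Exactness at `hⁿ(U) ⊕ hⁿ(V)`. -/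
  exact_sum : ∀ (X : GSpace) (P : 𝓣.Tw X) (U V : SubMulAction X.grp X.space),
    IsOpen (U : Set X.space) → IsOpen (V : Set X.space) → (U : Set X.space) ∪ V = Set.univ →
    ∀ (n : ℤ) (a : (h n).obj (op (tri (X.sub U) ((𝓣.pull (X.incl U)).obj P))))
      (b : (h n).obj (op (tri (X.sub V) ((𝓣.pull (X.incl V)).obj P)))),
      (h n).map (comparison (X.inclOfLE inf_le_left) (X.incl U) (X.incl (U ⊓ V)) rfl P).op a -
        (h n).map (comparison (X.inclOfLE inf_le_right) (X.incl V) (X.incl (U ⊓ V)) rfl P).op b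
          = 0 ↔
      ∃ x, (h n).map (lift (X.incl U) P).op x = a ∧ (h n).map (lift (X.incl V) P).op x = b
  /-- Exactness at `hⁿ(U ∩ V)`. -/
  exact_inter : ∀ (X : GSpace) (P : 𝓣.Tw X) (U V : SubMulAction X.grp X.space)
    (hU : IsOpen (U : Set X.space)) (hV : IsOpen (V : Set X.space))
    (hUV : (U : Set X.space) ∪ V = Set.univ) (n : ℤ)
    (y : (h n).obj (op (tri (X.sub (U ⊓ V)) ((𝓣.pull (X.incl (U ⊓ V))).obj P)))),
      δ X P U V hU hV hUV n y = 0 ↔ ∃ a b,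
        (h n).map (comparison (X.inclOfLE inf_le_left) (X.incl U) (X.incl (U ⊓ V)) rfl P).op a -
        (h n).map (comparison (X.inclOfLE inf_le_right) (X.incl V) (X.incl (U ⊓ V)) rfl P).op b
          = y
  /-- Exactness at `hⁿ⁺¹(X)`. -/
  exact_total : ∀ (X : GSpace) (P : 𝓣.Tw X) (U V : SubMulAction X.grp X.space)
    (hU : IsOpen (U : Set X.space)) (hV : IsOpen (V : Set X.space))
    (hUV : (U : Set X.space) ∪ V = Set.univ) (n : ℤ) (x : (h (n + 1)).obj (op (tri X P))),
      ((h (n + 1)).map (lift (X.incl U) P).op x = 0 ∧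
        (h (n + 1)).map (lift (X.incl V) P).op x = 0) ↔ ∃ y, δ X P U V hU hV hUV n y = x
  /-- The boundary map is natural with respect to morphisms `ψ : (Y, Q) ⟶ (X, P)` with
  `ψ(U') ⊆ U` and `ψ(V') ⊆ V`; here `ψ'` is the restriction of `ψ` to `U' ∩ V'`. -/
  δ_natural : ∀ (Y X : GSpace) (Q : 𝓣.Tw Y) (P : 𝓣.Tw X) (ψ : tri Y Q ⟶ tri X P)
    (U' V' : SubMulAction Y.grp Y.space) (U V : SubMulAction X.grp X.space)
    (hU' : IsOpen (U' : Set Y.space)) (hV' : IsOpen (V' : Set Y.space))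
    (hUV' : (U' : Set Y.space) ∪ V' = Set.univ)
    (hU : IsOpen (U : Set X.space)) (hV : IsOpen (V : Set X.space))
    (hUV : (U : Set X.space) ∪ V = Set.univ),
    Set.MapsTo ψ.base.f U' U → Set.MapsTo ψ.base.f V' V →
    ∀ (ψ' : tri (Y.sub (U' ⊓ V')) ((𝓣.pull (Y.incl (U' ⊓ V'))).obj Q) ⟶
        tri (X.sub (U ⊓ V)) ((𝓣.pull (X.incl (U ⊓ V))).obj P)),
      ψ' ≫ lift (X.incl (U ⊓ V)) P = lift (Y.incl (U' ⊓ V')) Q ≫ ψ →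
      ∀ (n : ℤ) (y : (h n).obj (op (tri (X.sub (U ⊓ V)) ((𝓣.pull (X.incl (U ⊓ V))).obj P)))),
        δ Y Q U' V' hU' hV' hUV' n ((h n).map ψ'.op y) =
          (h (n + 1)).map ψ.op (δ X P U V hU hV hUV n y)
  /-- The Mayer-Vietoris sequence is also natural with respect to push-forward, up to the sign
  `sign n` (a matter of convention). Here `E` is a circle bundle over `X = U ∪ V`, and `κ` is the
  canonical identification of the two descriptions of the restriction of `π^* P` to
  `E|_{U ∩ V}`. -/
  sign : ℤ → ℤˣ
  δ_push : ∀ (X : GSpace) (P : 𝓣.Tw X) (E : CircleBundle X) (U V : SubMulAction X.grp X.space)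
    (hU : IsOpen (U : Set X.space)) (hV : IsOpen (V : Set X.space))
    (hUV : (U : Set X.space) ∪ V = Set.univ)
    (hU' : IsOpen (GSpace.preimage E.π U : Set E.total))
    (hV' : IsOpen (GSpace.preimage E.π V : Set E.total))
    (hUV' : (GSpace.preimage E.π U : Set E.total) ∪ GSpace.preimage E.π V = Set.univ)
    (κ : tri (E.pullback (X.incl (U ⊓ V))).toGSpace
        ((𝓣.pull (E.pullback (X.incl (U ⊓ V))).π).obj ((𝓣.pull (X.incl (U ⊓ V))).obj P)) ⟶
      tri (E.toGSpace.sub (GSpace.preimage E.π U ⊓ GSpace.preimage E.π V))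
        ((𝓣.pull (E.toGSpace.incl (GSpace.preimage E.π U ⊓ GSpace.preimage E.π V))).obj
          ((𝓣.pull E.π).obj P))),
    κ.base ≫ E.toGSpace.incl (GSpace.preimage E.π U ⊓ GSpace.preimage E.π V) =
      E.pullbackMap (X.incl (U ⊓ V)) →
    κ ≫ lift (E.toGSpace.incl (GSpace.preimage E.π U ⊓ GSpace.preimage E.π V)) _ ≫ lift E.π P =
      lift (E.pullback (X.incl (U ⊓ V))).π _ ≫ lift (X.incl (U ⊓ V)) P →
    ∀ (n : ℤ) (y : (h (n + 1)).obj (op (tri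
        (E.toGSpace.sub (GSpace.preimage E.π U ⊓ GSpace.preimage E.π V))
        ((𝓣.pull (E.toGSpace.incl (GSpace.preimage E.π U ⊓ GSpace.preimage E.π V))).obj
          ((𝓣.pull E.π).obj P))))),
      push E P (n + 1) (δ E.toGSpace ((𝓣.pull E.π).obj P) (GSpace.preimage E.π U)
          (GSpace.preimage E.π V) hU' hV' hUV' (n + 1) y) =
        (sign n : ℤ) • δ X P U V hU hV hUV n
          (push (E.pullback (X.incl (U ⊓ V))) ((𝓣.pull (X.incl (U ⊓ V))).obj P) n
            ((h (n + 1)).map κ.op y))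

/-! ## T-duality triples and the T-duality transformation -/

section Fiber

variable {X : GSpace} (E : CircleBundle X)

/-- The parametrization `s ↦ [s v, e]` by the circle of the fiber of `E ×_G EG → X ×_G EG` over
`[π v, e]`. -/
def fiberCircle (v : E.total) (e : EG X.grp) :
    GSpace.triv Circle ⟶ borelFunctor.obj E.toGSpace :=
  GSpace.trivMap ⟨fun s => Borel.mk (X := E.toGSpace) (s • v) e,
    (Borel.continuous_mk E.toGSpace).comp
      ((continuous_id.smul continuous_const).prodMk continuous_const)⟩

variable (Eh : CircleBundle X)

/-- The fiber product `E ×_X Ê`, as a circle bundle over `Ê`. -/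
abbrev corr : CircleBundle Eh.toGSpace := E.pullback Eh.π

/-- The projection `p : E ×_X Ê → E`. -/
abbrev corrFst : (corr E Eh).toGSpace ⟶ E.toGSpace := E.pullbackMap Eh.π

/-- The projection `p̂ : E ×_X Ê → Ê`. -/
abbrev corrSnd : (corr E Eh).toGSpace ⟶ Eh.toGSpace := (corr E Eh).π

/-- The point `(s v, t v̂)` of `E ×_X Ê`, where `π v = π̂ v̂`. -/
def torusPoint (v : E.total) (vh : Eh.total) (hv : E.proj v = Eh.proj vh) (q : Circle × Circle) :
    CircleBundle.PullbackTotal Eh.π E :=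
  ⟨(q.2 • vh, q.1 • v), by
    change Eh.proj (q.2 • vh) = E.proj (q.1 • v)
    rw [Eh.proj_circle, E.proj_circle, hv]⟩

lemma continuous_torusPoint (v : E.total) (vh : Eh.total) (hv : E.proj v = Eh.proj vh) :
    Continuous (torusPoint E Eh v vh hv) :=
  Continuous.subtype_mk
    ((continuous_snd.smul continuous_const).prodMk (continuous_fst.smul continuous_const)) _

/-- The parametrization `(s, t) ↦ [(s v, t v̂), e]` by the torus of the fiber of
`(E ×_X Ê) ×_G EG → X ×_G EG` over `[π v, e]`. -/
def fiberTorus (v : E.total) (vh : Eh.total) (hv : E.proj v = Eh.proj vh) (e : EG X.grp) :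
    GSpace.triv (Circle × Circle) ⟶ borelFunctor.obj (corr E Eh).toGSpace :=
  GSpace.trivMap ⟨fun q => Borel.mk (X := (corr E Eh).toGSpace) (torusPoint E Eh v vh hv q) e,
    (Borel.continuous_mk (corr E Eh).toGSpace).comp
      ((continuous_torusPoint E Eh v vh hv).prodMk continuous_const)⟩

end Fiber

/-- The Poincaré bundle condition on a fiber. Let `Q`, `Q̂` be twists on `A`, `Â`, let
`a : C → A` and `â : C → Â` be maps and `v : a^* Q ≅ â^* Q̂`. The circles `k : S¹ → A`,
`k̂ : S¹ → Â` and the torus `j : S¹ × S¹ → C` with `a j = k pr₁`, `â j = k̂ pr₂` parametrize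
fibers. The condition: there are trivializations `t`, `t̂` of `k^* Q` and `k̂^* Q̂` such that,
for the induced trivializations `s`, `ŝ` of `j^* a^* Q` and `j^* â^* Q̂`, the automorphism
`α = ŝ⁻¹ ∘ j^* v ∘ s` of the trivial twist on the torus corresponds to the standard symplectic
class. (A trivialization of `f^* Q` is given as a morphism of triples from the trivial twist to `Q`
covering `f`.) -/
def PoincareOnFiber (𝓣 : TwistModel.{v, u}) {A Ah C : GSpace} (a : C ⟶ A) (ah : C ⟶ Ah)
    (Q : 𝓣.Tw A) (Qh : 𝓣.Tw Ah) (v : (𝓣.pull a).obj Q ≅ (𝓣.pull ah).obj Qh)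
    (k : GSpace.triv Circle ⟶ A) (kh : GSpace.triv Circle ⟶ Ah)
    (j : GSpace.triv (Circle × Circle) ⟶ C) : Prop :=
  ∃ (t : tri (GSpace.triv Circle) (𝟙_ _) ⟶ tri A Q)
    (th : tri (GSpace.triv Circle) (𝟙_ _) ⟶ tri Ah Qh)
    (s : tri (GSpace.triv (Circle × Circle)) (𝟙_ _) ⟶ tri C ((𝓣.pull a).obj Q))
    (sh : tri (GSpace.triv (Circle × Circle)) (𝟙_ _) ⟶ tri C ((𝓣.pull ah).obj Qh))
    (α : Aut (𝟙_ (𝓣.Tw (GSpace.triv (Circle × Circle))))),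
    t.base = k ∧ th.base = kh ∧ s.base = j ∧ sh.base = j ∧
    s ≫ lift a Q = unitHom (GSpace.trivMap ContinuousMap.fst) ≫ t ∧
    sh ≫ lift ah Qh = unitHom (GSpace.trivMap ContinuousMap.snd) ≫ th ∧
    s ≫ vert v.hom = vert α.hom ≫ sh ∧
    IsSymplecticClass (𝓣.autCls (Circle × Circle) α).toAdd

/-- A `G`-equivariant pair `(E, P)` over `X`: an equivariant circle bundle with an equivariant
twist on its total space. -/
structure TPair (𝓣 : TwistModel.{v, u}) (X : GSpace) where
  E : CircleBundle X
  P : 𝓣.Tw E.toGSpace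

/-- A `G`-equivariant T-duality triple `((E, P), (Ê, P̂), u)` over `X`: two equivariant pairs and
an isomorphism `u : p^* P ≅ p̂^* P̂` of twists on `E ×_X Ê`, such that the non-equivariant triple
obtained by applying the Borel construction `- ×_G EG` to the whole diagram satisfies the Poincaré
bundle condition on the fiber over each point of `X ×_G EG`. -/
structure TTriple (𝓣 : TwistModel.{v, u}) (X : GSpace) where
  pair : TPair 𝓣 X
  dual : TPair 𝓣 X
  u : (𝓣.pull (corrFst pair.E dual.E)).obj pair.P ≅ (𝓣.pull (corrSnd pair.E dual.E)).obj dual.P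
  poincare : ∀ (v : pair.E.total) (vh : dual.E.total) (hv : pair.E.proj v = dual.E.proj vh)
    (e : EG X.grp),
    PoincareOnFiber 𝓣
      (borelFunctor.map (corrFst pair.E dual.E)) (borelFunctor.map (corrSnd pair.E dual.E))
      ((𝓣.borelFun 𝓣.borel _).obj pair.P) ((𝓣.borelFun 𝓣.borel _).obj dual.P)
      (((𝓣.borelNat 𝓣.borel (corrFst pair.E dual.E)).app pair.P).symm ≪≫
        (𝓣.borelFun 𝓣.borel _).mapIso u ≪≫
        (𝓣.borelNat 𝓣.borel (corrSnd pair.E dual.E)).app dual.P)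
      (fiberCircle pair.E v e) (fiberCircle dual.E vh e) (fiberTorus pair.E dual.E v vh hv e)

/-- The T-duality transformation
`T = p̂_! ∘ u^* ∘ p^* : hⁿ⁺¹_G(E, P) → hⁿ_G(Ê, P̂)`. -/
def TwistedTheory.transform {𝓣 : TwistModel.{v, u}} (h : TwistedTheory.{v, u, w} 𝓣) {X : GSpace}
    (D : TTriple 𝓣 X) (n : ℤ) :
    (h.h (n + 1)).obj (op (tri D.pair.E.toGSpace D.pair.P)) ⟶
      (h.h n).obj (op (tri D.dual.E.toGSpace D.dual.P)) :=
  (h.h (n + 1)).map (lift (corrFst D.pair.E D.dual.E) D.pair.P).op ≫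
    (h.h (n + 1)).map (vert D.u.inv).op ≫ h.push (corr D.pair.E D.dual.E) D.dual.P n

/-- The theory is `G`-T-admissible: for each closed subgroup `H` of `G`, the T-duality
transformation is an isomorphism, in all degrees, for all `H`-equivariant T-duality triples over
the one-point space. -/
def TwistedTheory.IsTAdmissible {𝓣 : TwistModel.{v, u}} (h : TwistedTheory.{v, u, w} 𝓣)
    (G : Type) [Group G] [TopologicalSpace G] [IsTopologicalGroup G] [CompactSpace G]
    [T2Space G] : Prop :=
  ∀ (H : Subgroup G) (hH : IsClosed (H : Set G)) (D : TTriple 𝓣 (GSpace.point H hH)) (n : ℤ),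
    IsIso (h.transform D n)

/-! ## Finite `G`-CW-complexes -/

/-- A finite `G`-CW-structure on a Hausdorff `G`-space `X`: finitely many equivariant cells
`G/Hᵢ × Dⁿ` with `Hᵢ ⊆ G` closed, given by equivariant characteristic maps that are jointly
bijective on the open cells and that map the boundary `G/Hᵢ × Sⁿ⁻¹` of each cell into the union of
the open cells of smaller dimension. -/
structure FiniteGCW (G X : Type) [Group G] [TopologicalSpace G] [TopologicalSpace X]
    [MulAction G X] where
  t2 : T2Space X
  ι : Type
  finite : Finite ι
  dim : ι → ℕ
  stab : ι → Subgroup G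
  stab_closed : ∀ i, IsClosed (stab i : Set G)
  char : ∀ i, C((G ⧸ stab i) × Metric.closedBall (0 : EuclideanSpace ℝ (Fin (dim i))) 1, X)
  char_smul : ∀ i (g : G) (q : G ⧸ stab i)
    (y : Metric.closedBall (0 : EuclideanSpace ℝ (Fin (dim i))) 1),
    char i (g • q, y) = g • char i (q, y)
  open_cells : ∀ x : X, ∃! c : (i : ι) × ((G ⧸ stab i) ×
    Metric.closedBall (0 : EuclideanSpace ℝ (Fin (dim i))) 1),
      ‖(c.2.2 : EuclideanSpace ℝ (Fin (dim c.1)))‖ < 1 ∧ char c.1 c.2 = x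
  boundary : ∀ i (q : G ⧸ stab i) (y : Metric.closedBall (0 : EuclideanSpace ℝ (Fin (dim i))) 1),
    ‖(y : EuclideanSpace ℝ (Fin (dim i)))‖ = 1 →
    ∃ j, dim j < dim i ∧ ∃ (q' : G ⧸ stab j)
      (y' : Metric.closedBall (0 : EuclideanSpace ℝ (Fin (dim j))) 1),
      ‖(y' : EuclideanSpace ℝ (Fin (dim j)))‖ < 1 ∧ char j (q', y') = char i (q, y)

end

end TDuality

/-! The proof is a Mayer–Vietoris induction over the cells. An invariant subset of the base is good
(`GoodOn`) if `T` is bijective in all degrees for the triple restricted to it. The following facts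
about good sets carry the argument.

Gluing: pullback and push-forward are natural, so `T` commutes with morphisms of triples
(`T_natural`) and, up to sign, with the Mayer–Vietoris boundary (`T_δ`). By the five lemma `U ∪ V`
is good if the open sets `U`, `V` and their intersection are (`goodOn_sup`). Orbits: a circle bundle
over an orbit is induced from its fiber over one point, so the induction axiom reduces to the
stabilizer acting on a point, where admissibility applies (`T_bijective_of_transitive`). Homotopy:
if `A` deforms equivariantly into `B ⊆ A`, then `A` is good exactly when `B` is
(`goodOn_iff_of_deformation`).

To attach a cell to `A` (`goodOn_top_of_topCell`), cover the space by the complement of a small cube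
in the cell, which deforms radially to `A`, and by the open cell, which contracts to an orbit. Their
intersection is an open disk without a cube, a finite union of convex open pieces cut out by half
spaces. Intersections of pieces are convex and contract to orbits, so induction on the number of
pieces applies and no induction over spheres is needed. `goodOn_cells` adds the cells in order of
dimension.

Two points need care. A deformation of the base must be lifted equivariantly to the circle bundles.
For this a Hermitian kernel on `E × E`, positive on the diagonal, is averaged over the group; its
phase is an equivariant parallel transport between nearby fibers (`exists_transport`), applied in
finitely many small steps. Further, the coherence isomorphisms of twists must be controlled. Twists
form groupoids, so every morphism of twisted spaces is cartesian: morphisms are obtained by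
factoring (`exists_fac`) and compared after composition (`fac_unique`). In the same way the Poincaré
condition is pulled back, so that the restriction of a triple is again a triple. -/

namespace TDuality

open CategoryTheory Opposite Pseudofunctor MonoidalCategory TwistPresheaf

universe v u w

noncomputable section

/-! ### Morphisms of twisted spaces are cartesian -/

namespace TwistPresheaf

variable {𝓣 : TwistPresheaf.{v, u}}

instance isIso_tw {X : GSpace} {P Q : 𝓣.Tw X} (a : P ⟶ Q) : IsIso a :=
  IsGroupoid.all_isIso a

/-- Twists form groupoids, so `ψ.fiber` is invertible and every morphism of `Total` is cartesian.
The fiber component of `θ` is the one forced by the equation. -/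
lemma exists_fac {A B C : 𝓣.Total} (ψ : B ⟶ C) (χ : A ⟶ C) (g : A.base ⟶ B.base)
    (e : g ≫ ψ.base = χ.base) : ∃ θ : A ⟶ B, θ.base = g ∧ θ ≫ ψ = χ := by
  have : IsIso ψ.fiber := isIso_tw (𝓣 := 𝓣) (X := B.base) ψ.fiber
  refine ⟨⟨g, χ.fiber ≫ eqToHom (by rw [← e]; rfl) ≫
    (𝓣.F.mapComp ψ.base.op.toLoc g.op.toLoc).hom.toNatTrans.app C.fiber ≫
      (𝓣.F.map g.op.toLoc).toFunctor.map (inv ψ.fiber)⟩, rfl, ?_⟩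
  refine CoGrothendieck.Hom.ext _ _ e ?_
  simp [← Cat.Hom₂.comp_app]

/-- The pullback of the invertible `ψ.fiber` can be cancelled. Together with `exists_fac` this
replaces calculations with coherence isomorphisms: equations between morphisms are checked on base
maps and after one composition. -/
lemma fac_unique {A B C : 𝓣.Total} (ψ : B ⟶ C) {θ θ' : A ⟶ B} (e : θ.base = θ'.base)
    (h : θ ≫ ψ = θ' ≫ ψ) : θ = θ' := by
  have : IsIso ψ.fiber := isIso_tw (𝓣 := 𝓣) (X := B.base) ψ.fiber
  obtain ⟨g, a⟩ := θ
  obtain ⟨g', a'⟩ := θ'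
  obtain rfl : g = g' := e
  obtain ⟨_, h⟩ := (CoGrothendieck.Hom.ext_iff _ _).mp h
  simp only [CoGrothendieck.categoryStruct_comp_fiber] at h
  have h' : a ≫ (𝓣.F.map g.op.toLoc).toFunctor.map ψ.fiber ≫
      (𝓣.F.mapComp ψ.base.op.toLoc g.op.toLoc).inv.toNatTrans.app C.fiber =
      a' ≫ (𝓣.F.map g.op.toLoc).toFunctor.map ψ.fiber ≫
      (𝓣.F.mapComp ψ.base.op.toLoc g.op.toLoc).inv.toNatTrans.app C.fiber :=
    h.trans (Category.comp_id _)
  have : IsIso ((𝓣.F.map g.op.toLoc).toFunctor.map ψ.fiber ≫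
      (𝓣.F.mapComp ψ.base.op.toLoc g.op.toLoc).inv.toNatTrans.app C.fiber) := isIso_tw _
  rw [(cancel_mono _).mp h']

lemma isIso_of_base {A B : 𝓣.Total} (ψ : A ⟶ B) (h : IsIso ψ.base) : IsIso ψ := by
  obtain ⟨θ, hθ, e⟩ := exists_fac ψ (𝟙 B) (inv ψ.base) (by simp)
  exact ⟨θ, fac_unique ψ (by simp [hθ]) (by simp [e]), e⟩

lemma exists_vert {X : GSpace} {P Q : 𝓣.Tw X} (θ : tri X P ⟶ tri X Q) (h : θ.base = 𝟙 X) :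
    ∃ a : P ≅ Q, vert a.hom = θ := by
  refine ⟨asIso (θ.fiber ≫ eqToHom (by rw [h]; rfl) ≫
    (𝓣.F.mapId ⟨op X⟩).hom.toNatTrans.app Q), ?_⟩
  refine CoGrothendieck.Hom.ext _ _ h.symm ?_
  simp [← Cat.Hom₂.comp_app]
  rfl

lemma mk_eq_vert_lift {Y X : GSpace} (f : Y ⟶ X) {Q : 𝓣.Tw Y} {P : 𝓣.Tw X}
    (a : Q ⟶ (𝓣.pull f).obj P) : (⟨f, a⟩ : tri Y Q ⟶ tri X P) = vert a ≫ lift f P := by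
  have h := CoGrothendieck.Hom.congr (Category.id_comp (lift f P))
  refine CoGrothendieck.Hom.ext _ _ (Category.id_comp f).symm ?_
  have h2 : (vert a ≫ lift f P).fiber = a ≫ (𝟙 _ ≫ lift f P).fiber := Category.assoc _ _ _
  rw [h2, h]
  simp only [Category.id_comp]
  exact ((Category.assoc _ _ _).trans
    ((congrArg (a ≫ ·) (eqToHom_trans _ _)).trans (Category.comp_id a))).symm

/-- The source bicategory is locally discrete, so its 2-morphisms are equalities. This matches the
coherence data of the two Grothendieck constructions in `borelBase`. -/
lemma map₂_app (F : Pseudofunctor (LocallyDiscrete GSpaceᵒᵖ) Cat.{v, u})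
    {X Y : LocallyDiscrete GSpaceᵒᵖ} {p q : X ⟶ Y} (e : p ⟶ q) (A : F.obj X) :
    (F.map₂ e).toNatTrans.app A = eqToHom (by rw [LocallyDiscrete.eq_of_hom e]) := by
  obtain rfl := LocallyDiscrete.eq_of_hom e
  obtain rfl : e = 𝟙 p := Subsingleton.elim _ _
  simp

end TwistPresheaf

/-! ### The Borel construction on twisted spaces -/

/-- The functor from twists on Borel constructions to all twisted spaces. -/
def borelBase (𝓣 : TwistPresheaf.{v, u}) : CoGrothendieck 𝓣.onBorel ⥤ 𝓣.Total where
  obj A := ⟨borelFunctor.obj A.base, A.fiber⟩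
  map f := ⟨borelFunctor.map f.base, f.fiber⟩
  map_id A := by
    refine CoGrothendieck.Hom.ext _ _ (by simp) ?_
    change (𝓣.F.mapId _).inv.toNatTrans.app A.fiber ≫ (𝓣.F.map₂ _).toNatTrans.app A.fiber = _
    exact congrArg (_ ≫ ·) (map₂_app 𝓣.F _ _)
  map_comp f g := by
    refine CoGrothendieck.Hom.ext _ _ (by simp) ?_
    change f.fiber ≫ _ ≫ (𝓣.F.mapComp _ _).inv.toNatTrans.app _ ≫ (𝓣.F.map₂ _).toNatTrans.app _ = _
    refine (congrArg (fun z => f.fiber ≫ _ ≫ (𝓣.F.mapComp _ _).inv.toNatTrans.app _ ≫ z)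
      (map₂_app 𝓣.F _ _)).trans ?_
    exact ((Category.assoc _ _ _).trans (congrArg (_ ≫ ·) (Category.assoc _ _ _))).symm

/-- The Borel construction as a functor on twisted spaces. -/
def borelTotal (𝓣 : TwistPresheaf.{v, u}) (β : StrongTrans 𝓣.F 𝓣.onBorel) : 𝓣.Total ⥤ 𝓣.Total :=
  CoGrothendieck.map (F := 𝓣.F) (G := 𝓣.onBorel) β ⋙ borelBase 𝓣

lemma borelTotal_map_vert (𝓣 : TwistPresheaf.{v, u}) (β : StrongTrans 𝓣.F 𝓣.onBorel)
    {X : GSpace} {P Q : 𝓣.Tw X} (a : P ⟶ Q) : (borelTotal 𝓣 β).map (vert a) =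
      vert ((𝓣.borelFun β X).map a) := by
  refine CoGrothendieck.Hom.ext _ _ (borelFunctor.map_id X) ?_
  have h := CoGrothendieck.Hom.congr ((borelTotal 𝓣 β).map_id (tri X Q))
  have h1 : ((borelTotal 𝓣 β).map (vert a)).fiber =
      (𝓣.borelFun β X).map a ≫ ((borelTotal 𝓣 β).map (𝟙 (tri X Q))).fiber :=
    (congrArg (· ≫ _) ((𝓣.borelFun β X).map_comp _ _)).trans (Category.assoc _ _ _)
  rw [h1, h]
  exact (Category.assoc _ _ _).symm

/-- The functor induced by `β` respects cartesian lifts up to the naturality isomorphism. This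
determines `borelNat` by a composite with a lift, the form in which Poincaré data are compared. -/
lemma borelTotal_map_lift (𝓣 : TwistPresheaf.{v, u}) (β : StrongTrans 𝓣.F 𝓣.onBorel)
    {Y X : GSpace} (f : Y ⟶ X) (P : 𝓣.Tw X) :
    vert ((𝓣.borelNat β f).hom.app P) ≫ lift (borelFunctor.map f) ((𝓣.borelFun β X).obj P) =
      (borelTotal 𝓣 β).map (lift f P) := by
  obtain ⟨a, ha⟩ : ∃ a, a = (𝓣.borelNat β f).hom.app P := ⟨_, rfl⟩
  have h1 : (borelTotal 𝓣 β).map (lift f P) = ⟨borelFunctor.map f, a⟩ := by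
    refine CoGrothendieck.Hom.ext _ _ rfl ?_
    change (𝓣.borelFun β Y).map (𝟙 _) ≫ _ = a ≫ 𝟙 _
    rw [CategoryTheory.Functor.map_id, ha]
    refine (Category.id_comp _).trans (Category.comp_id _).symm
  rw [h1, ← ha]
  exact (mk_eq_vert_lift _ a).symm

/-! ### Fiber products of circle bundles -/

namespace GSpace

@[ext]
lemma hom_ext {Y X : GSpace} {a b : Y ⟶ X} (hφ : a.φ = b.φ) (hf : a.f = b.f) : a = b :=
  Hom.ext hφ hf

lemma congr_f {Y X : GSpace} {a b : Y ⟶ X} (h : a = b) (y : Y.space) : a.f y = b.f y := by rw [h]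

lemma congr_φ {Y X : GSpace} {a b : Y ⟶ X} (h : a = b) (y : Y.grp) : a.φ y = b.φ y := by rw [h]

end GSpace

namespace CircleBundle

variable {X Y Z : GSpace} (f : Y ⟶ X) (E : CircleBundle X)

lemma isBundleMap_pullbackMap : IsBundleMap f (E.pullback f) E (E.pullbackMap f) := by
  refine ⟨GSpace.hom_ext rfl (ContinuousMap.ext fun p => ?_), fun _ _ => rfl⟩
  exact p.2.symm

/-- The map to `f^* E` given by maps to the base and to `E`. -/
def pullbackLift (k : Z ⟶ Y) (m : Z ⟶ E.toGSpace) (h : m ≫ E.π = k ≫ f) :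
    Z ⟶ (E.pullback f).toGSpace where
  φ := k.φ
  f := ⟨fun z => (⟨(k.f z, m.f z), (GSpace.congr_f h z).symm⟩ : PullbackTotal f E),
    (k.f.continuous.prodMk m.f.continuous).subtype_mk _⟩
  equivariant g z := by
    refine Subtype.ext (Prod.ext (k.equivariant g z) ?_)
    refine (m.equivariant g z).trans ?_
    exact congrArg (fun γ : X.grp => (γ • (m.f z : E.total) : E.total)) (GSpace.congr_φ h g)

lemma pullbackLift_π (k : Z ⟶ Y) (m : Z ⟶ E.toGSpace) (h : m ≫ E.π = k ≫ f) :
    E.pullbackLift f k m h ≫ (E.pullback f).π = k := rfl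

lemma pullbackLift_map (k : Z ⟶ Y) (m : Z ⟶ E.toGSpace) (h : m ≫ E.π = k ≫ f) :
    E.pullbackLift f k m h ≫ E.pullbackMap f = m :=
  GSpace.hom_ext (ContinuousMonoidHom.ext fun g => (GSpace.congr_φ h g).symm) rfl

variable {f E}

lemma pullback_hom_ext {a b : Z ⟶ (E.pullback f).toGSpace}
    (h1 : a ≫ (E.pullback f).π = b ≫ (E.pullback f).π)
    (h2 : a ≫ E.pullbackMap f = b ≫ E.pullbackMap f) : a = b :=
  GSpace.hom_ext (ContinuousMonoidHom.ext fun g => GSpace.congr_φ h1 g)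
    (ContinuousMap.ext fun z => Subtype.ext
      (Prod.ext (GSpace.congr_f h1 z) (GSpace.congr_f h2 z)))

end CircleBundle

/-! ### Morphisms of T-duality triples and naturality of `T` -/

open CircleBundle

variable {𝓣 : TwistModel.{v, u}}

/-- A morphism of T-duality triples. -/
structure TTriple.Hom {Y X : GSpace} (D' : TTriple 𝓣 Y) (D : TTriple 𝓣 X) where
  f : Y ⟶ X
  ε : tri D'.pair.E.toGSpace D'.pair.P ⟶ tri D.pair.E.toGSpace D.pair.P
  εh : tri D'.dual.E.toGSpace D'.dual.P ⟶ tri D.dual.E.toGSpace D.dual.P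
  hε : IsBundleMap f D'.pair.E D.pair.E ε.base
  hεh : IsBundleMap f D'.dual.E D.dual.E εh.base
  a : tri (corr D'.pair.E D'.dual.E).toGSpace ((𝓣.pull (corrFst _ _)).obj D'.pair.P) ⟶
    tri (corr D.pair.E D.dual.E).toGSpace ((𝓣.pull (corrFst _ _)).obj D.pair.P)
  b : tri (corr D'.pair.E D'.dual.E).toGSpace ((𝓣.pull (corrSnd _ _)).obj D'.dual.P) ⟶
    tri (corr D.pair.E D.dual.E).toGSpace ((𝓣.pull (corrSnd _ _)).obj D.dual.P)
  ha : a ≫ lift (corrFst _ _) D.pair.P = lift (corrFst _ _) D'.pair.P ≫ ε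
  hb : b ≫ lift (corrSnd _ _) D.dual.P = lift (corrSnd _ _) D'.dual.P ≫ εh
  comm : a ≫ vert D.u.hom = vert D'.u.hom ≫ b

lemma vert_base {X : GSpace} {P Q : 𝓣.Tw X} (a : P ⟶ Q) : (vert a).base = 𝟙 X := rfl

lemma vert_hom_inv {X : GSpace} {P Q : 𝓣.Tw X} (a : P ≅ Q) : vert a.hom ≫ vert a.inv = 𝟙 _ :=
  ((CoGrothendieck.ι 𝓣.F X).mapIso a).hom_inv_id

lemma vert_inv_hom {X : GSpace} {P Q : 𝓣.Tw X} (a : P ≅ Q) : vert a.inv ≫ vert a.hom = 𝟙 _ :=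
  ((CoGrothendieck.ι 𝓣.F X).mapIso a).inv_hom_id

namespace TTriple.Hom

variable {X Y : GSpace} {D' : TTriple 𝓣 Y} {D : TTriple 𝓣 X} (θ : D'.Hom D)

lemma base_eq : θ.a.base = θ.b.base := by
  simpa using congrArg CoGrothendieck.Hom.base θ.comm

/-- A point of `E ×_X Ê` is determined by its two projections. The square `hb` controls the one to
`Ê`, which the circle fixes, and `ha` the one to `E`, on which it acts; `base_eq` allows using both
for a single map. -/
lemma isBundleMap_b : IsBundleMap θ.εh.base (corr D'.pair.E D'.dual.E) (corr D.pair.E D.dual.E)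
    θ.b.base := by
  have h1 : θ.b.base ≫ corrSnd _ _ = corrSnd _ _ ≫ θ.εh.base :=
    congrArg CoGrothendieck.Hom.base θ.hb
  have h2 : θ.a.base ≫ corrFst _ _ = corrFst _ _ ≫ θ.ε.base :=
    congrArg CoGrothendieck.Hom.base θ.ha
  refine ⟨h1, fun z v => Subtype.ext (Prod.ext ?_ ?_)⟩
  · exact (GSpace.congr_f h1 _).trans (GSpace.congr_f h1 v).symm
  · rw [← θ.base_eq]
    refine (GSpace.congr_f h2 _).trans ((θ.hε.2 z _).trans ?_)
    exact congrArg (z • ·) (GSpace.congr_f h2 v).symm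

/-- The equation `comm` solved for inverses, since `T` involves `u.inv`. -/
lemma comm_inv : (vert D'.u.inv ≫ lift (corrFst _ _) D'.pair.P) ≫ θ.ε =
    θ.b ≫ vert D.u.inv ≫ lift (corrFst _ _) D.pair.P := by
  rw [Category.assoc, ← θ.ha, ← Category.assoc, ← Category.assoc]
  congr 1
  calc vert D'.u.inv ≫ θ.a = vert D'.u.inv ≫ (θ.a ≫ vert D.u.hom) ≫ vert D.u.inv := by
        rw [Category.assoc, vert_hom_inv, Category.comp_id]
    _ = θ.b ≫ vert D.u.inv := by
        rw [θ.comm, ← Category.assoc, ← Category.assoc, vert_inv_hom, Category.id_comp]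

end TTriple.Hom

namespace TwistedTheory

variable (h : TwistedTheory.{v, u, w} 𝓣)

/-- The map induced by a morphism of triples. -/
def res {A B : 𝓣.Total} (ψ : A ⟶ B) (n : ℤ) : (h.h n).obj (op B) →+ (h.h n).obj (op A) :=
  ((h.h n).map ψ.op).hom

lemma res_comp {A B C : 𝓣.Total} (ψ : A ⟶ B) (χ : B ⟶ C) (n : ℤ) (x : (h.h n).obj (op C)) :
    h.res (ψ ≫ χ) n x = h.res ψ n (h.res χ n x) := by
  simp [res]

lemma res_bijective {A B : 𝓣.Total} (ψ : A ⟶ B) [IsIso ψ] (n : ℤ) :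
    Function.Bijective (h.res ψ n) :=
  (ConcreteCategory.isIso_iff_bijective ((h.h n).map ψ.op)).mp inferInstance

/-- The T-duality transformation as an additive map. -/
def T {X : GSpace} (D : TTriple 𝓣 X) (n : ℤ) :
    (h.h (n + 1)).obj (op (tri D.pair.E.toGSpace D.pair.P)) →+
      (h.h n).obj (op (tri D.dual.E.toGSpace D.dual.P)) := (h.transform D n).hom

lemma isIso_transform_iff {X : GSpace} (D : TTriple 𝓣 X) (n : ℤ) :
    IsIso (h.transform D n) ↔ Function.Bijective (h.T D n) :=
  ConcreteCategory.isIso_iff_bijective _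

lemma T_apply {X : GSpace} (D : TTriple 𝓣 X) (n : ℤ)
    (x : (h.h (n + 1)).obj (op (tri D.pair.E.toGSpace D.pair.P))) :
    h.T D n x = h.push (corr D.pair.E D.dual.E) D.dual.P n
      (h.res (vert D.u.inv ≫ lift (corrFst D.pair.E D.dual.E) D.pair.P) (n + 1) x) := by
  rw [res_comp]
  rfl

/-- This is naturality of push-forward for the bundle map `θ.b.base` of correspondence spaces over
`θ.εh.base`; `comm_inv` matches the classes that are pushed forward. -/
lemma T_natural {Y X : GSpace} {D' : TTriple 𝓣 Y} {D : TTriple 𝓣 X} (θ : D'.Hom D) (n : ℤ)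
    (x : (h.h (n + 1)).obj (op (tri D.pair.E.toGSpace D.pair.P))) :
    h.T D' n (h.res θ.ε (n + 1) x) = h.res θ.εh n (h.T D n x) := by
  rw [T_apply, T_apply]
  refine Eq.trans ?_ (h.push_natural θ.εh.base _ _ θ.b.base θ.isBundleMap_b D'.dual.P D.dual.P
    θ.εh θ.b rfl rfl θ.hb n _)
  congr 1
  change _ = h.res θ.b (n + 1) _
  rw [← res_comp, ← res_comp, θ.comm_inv]

end TwistedTheory

/-! ### Pulling back the Poincaré condition -/

lemma vert_comp {X : GSpace} {P Q R : 𝓣.Tw X} (a : P ⟶ Q) (b : Q ⟶ R) :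
    vert (a ≫ b) = vert a ≫ vert b := (CoGrothendieck.ι 𝓣.F X).map_comp a b

lemma comp_base {A B C : 𝓣.Total} (a : A ⟶ B) (b : B ⟶ C) : (a ≫ b).base = a.base ≫ b.base := rfl

/-- Trivializations are morphisms into the twists, so they factor through the cartesian morphisms
`ψ`, `ψh`, `c`, `d`. The equations are checked after composing with these, and the automorphism `α`
remains the same, hence so does its class. -/
lemma PoincareOnFiber.of_hom {A Ah C A' Ah' C' : GSpace} {a : C ⟶ A} {ah : C ⟶ Ah}
    {Q : 𝓣.Tw A} {Qh : 𝓣.Tw Ah} {v : (𝓣.pull a).obj Q ≅ (𝓣.pull ah).obj Qh}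
    {k : GSpace.triv Circle ⟶ A} {kh : GSpace.triv Circle ⟶ Ah}
    {j : GSpace.triv (Circle × Circle) ⟶ C}
    {a' : C' ⟶ A'} {ah' : C' ⟶ Ah'}
    {Q' : 𝓣.Tw A'} {Qh' : 𝓣.Tw Ah'} {v' : (𝓣.pull a').obj Q' ≅ (𝓣.pull ah').obj Qh'}
    {k' : GSpace.triv Circle ⟶ A'} {kh' : GSpace.triv Circle ⟶ Ah'}
    {j' : GSpace.triv (Circle × Circle) ⟶ C'}
    (H : PoincareOnFiber 𝓣 a ah Q Qh v k kh j)
    (ψ : tri A' Q' ⟶ tri A Q) (ψh : tri Ah' Qh' ⟶ tri Ah Qh)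
    (c : tri C' ((𝓣.pull a').obj Q') ⟶ tri C ((𝓣.pull a).obj Q))
    (d : tri C' ((𝓣.pull ah').obj Qh') ⟶ tri C ((𝓣.pull ah).obj Qh))
    (hc : c ≫ lift a Q = lift a' Q' ≫ ψ) (hd : d ≫ lift ah Qh = lift ah' Qh' ≫ ψh)
    (hv : c ≫ vert v.hom = vert v'.hom ≫ d)
    (hk : k' ≫ ψ.base = k) (hkh : kh' ≫ ψh.base = kh) (hj : j' ≫ c.base = j)
    (hja : j' ≫ a' = GSpace.trivMap ContinuousMap.fst ≫ k')
    (hjah : j' ≫ ah' = GSpace.trivMap ContinuousMap.snd ≫ kh') :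
    PoincareOnFiber 𝓣 a' ah' Q' Qh' v' k' kh' j' := by
  obtain ⟨t, th, s, sh, α, ht, hth, hs, hsh, h1, h2, h3, h4⟩ := H
  have hcd : c.base = d.base := by simpa using congrArg CoGrothendieck.Hom.base hv
  obtain ⟨t', ht', et⟩ := exists_fac ψ t k' (hk.trans ht.symm)
  obtain ⟨th', hth', eth⟩ := exists_fac ψh th kh' (hkh.trans hth.symm)
  obtain ⟨s', hs', es⟩ := exists_fac c s j' (hj.trans hs.symm)
  obtain ⟨sh', hsh', esh⟩ := exists_fac d sh j' (by rw [← hcd, hj, hsh])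
  refine ⟨t', th', s', sh', α, ht', hth', hs', hsh', ?_, ?_, ?_, h4⟩
  · refine fac_unique ψ ?_ ?_
    · rw [comp_base, comp_base, hs', ht']
      exact hja
    · rw [Category.assoc, ← hc, ← Category.assoc, es, Category.assoc, et, h1]
  · refine fac_unique ψh ?_ ?_
    · rw [comp_base, comp_base, hsh', hth']
      exact hjah
    · rw [Category.assoc, ← hd, ← Category.assoc, esh, Category.assoc, eth, h2]
  · refine fac_unique d ?_ ?_
    · rw [comp_base, comp_base, hs', hsh']
      simp
    · rw [Category.assoc, ← hv, ← Category.assoc, es, Category.assoc, esh, h3]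

section Induced

variable {X Y : GSpace} (D : TTriple 𝓣 X) (f : Y ⟶ X) (pair dual : TPair 𝓣 Y)
  (ε : tri pair.E.toGSpace pair.P ⟶ tri D.pair.E.toGSpace D.pair.P)
  (εh : tri dual.E.toGSpace dual.P ⟶ tri D.dual.E.toGSpace D.dual.P)
  (hε : IsBundleMap f pair.E D.pair.E ε.base) (hεh : IsBundleMap f dual.E D.dual.E εh.base)

lemma corr_square (E Eh : CircleBundle X) : corrFst E Eh ≫ E.π = corrSnd E Eh ≫ Eh.π :=
  (isBundleMap_pullbackMap Eh.π E).1

include hε hεh in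
-- The bundle maps induce a map `m` of correspondence spaces, over which `a` and `b` are factored
-- through the cartesian lifts. Then `a ≫ vert D.u.hom` factors through `b` by a morphism over the
-- identity, and this is `u`.
lemma exists_inducedIso :
    ∃ (a : tri (corr pair.E dual.E).toGSpace ((𝓣.pull (corrFst _ _)).obj pair.P) ⟶
        tri (corr D.pair.E D.dual.E).toGSpace ((𝓣.pull (corrFst _ _)).obj D.pair.P))
      (b : tri (corr pair.E dual.E).toGSpace ((𝓣.pull (corrSnd _ _)).obj dual.P) ⟶
        tri (corr D.pair.E D.dual.E).toGSpace ((𝓣.pull (corrSnd _ _)).obj D.dual.P))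
      (u : (𝓣.pull (corrFst pair.E dual.E)).obj pair.P ≅
        (𝓣.pull (corrSnd pair.E dual.E)).obj dual.P),
      a ≫ lift (corrFst _ _) D.pair.P = lift (corrFst _ _) pair.P ≫ ε ∧
      b ≫ lift (corrSnd _ _) D.dual.P = lift (corrSnd _ _) dual.P ≫ εh ∧
      a ≫ vert D.u.hom = vert u.hom ≫ b := by
  have hm : (corrFst pair.E dual.E ≫ ε.base) ≫ D.pair.E.π =
      (corrSnd pair.E dual.E ≫ εh.base) ≫ D.dual.E.π := by
    rw [Category.assoc, Category.assoc, hε.1, hεh.1, ← Category.assoc, ← Category.assoc,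
      corr_square]
  let m := D.pair.E.pullbackLift D.dual.E.π _ _ hm
  obtain ⟨a, ha, ea⟩ := exists_fac (lift (corrFst D.pair.E D.dual.E) D.pair.P)
    (lift (corrFst _ _) pair.P ≫ ε) m (pullbackLift_map _ _ _ _ hm)
  obtain ⟨b, hb, eb⟩ := exists_fac (lift (corrSnd D.pair.E D.dual.E) D.dual.P)
    (lift (corrSnd _ _) dual.P ≫ εh) m (pullbackLift_π _ _ _ _ hm)
  obtain ⟨c, hc, ec⟩ := exists_fac b (a ≫ vert D.u.hom) (𝟙 _) (by
    rw [comp_base, hb, ha]; simp)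
  obtain ⟨u, rfl⟩ := exists_vert c hc
  exact ⟨a, b, u, ea, eb, ec.symm⟩

/-- The map between the pullbacks of the twists to the correspondence spaces, for the first
projections. -/
def inducedA := (exists_inducedIso D f pair dual ε εh hε hεh).choose

/-- The map between the pullbacks of the twists to the correspondence spaces, for the second
projections. -/
def inducedB := (exists_inducedIso D f pair dual ε εh hε hεh).choose_spec.choose

/-- The isomorphism of twists induced by the isomorphism of the triple `D`. -/
def inducedU := (exists_inducedIso D f pair dual ε εh hε hεh).choose_spec.choose_spec.choose

lemma induced_spec :
      inducedA D f pair dual ε εh hε hεh ≫ lift (corrFst _ _) D.pair.P =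
        lift (corrFst _ _) pair.P ≫ ε ∧
      inducedB D f pair dual ε εh hε hεh ≫ lift (corrSnd _ _) D.dual.P =
        lift (corrSnd _ _) dual.P ≫ εh ∧
      inducedA D f pair dual ε εh hε hεh ≫ vert D.u.hom =
        vert (inducedU D f pair dual ε εh hε hεh).hom ≫ inducedB D f pair dual ε εh hε hεh :=
  (exists_inducedIso D f pair dual ε εh hε hεh).choose_spec.choose_spec.choose_spec

lemma fiberCircle_comp {E' : CircleBundle Y} {E : CircleBundle X} {m : E'.toGSpace ⟶ E.toGSpace}
    (hm : IsBundleMap f E' E m) (v : E'.total) (e : EG Y.grp) :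
    fiberCircle E' v e ≫ borelFunctor.map m = fiberCircle E (m.f v) (EG.mapFun f.φ e) := by
  refine GSpace.hom_ext rfl (ContinuousMap.ext fun (s : Circle) => ?_)
  have hφ : (m.φ : Y.grp → X.grp) = f.φ := funext fun g => GSpace.congr_φ hm.1 g
  change Borel.mk (X := E.toGSpace) (m.f (s • v)) (EG.mapFun m.φ e) =
    Borel.mk (X := E.toGSpace) (s • (m.f v : E.total)) (EG.mapFun f.φ e)
  rw [hm.2]
  exact congrArg (fun φ => Borel.mk (X := E.toGSpace) (s • (m.f v : E.total)) (EG.mapFun φ e)) hφ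

lemma EG.mapFun_id {G : Type} (e : EG G) : EG.mapFun id e = e :=
  EG.ext rfl (funext fun _ => congrFun Option.map_id _)

lemma fiberTorus_fst (E Eh : CircleBundle X) (v : E.total) (vh : Eh.total)
    (hv : E.proj v = Eh.proj vh) (e : EG X.grp) :
    fiberTorus E Eh v vh hv e ≫ borelFunctor.map (corrFst E Eh) =
      GSpace.trivMap ContinuousMap.fst ≫ fiberCircle E v e :=
  GSpace.hom_ext rfl (ContinuousMap.ext fun (q : Circle × Circle) =>
    congrArg (Borel.mk (X := E.toGSpace) (q.1 • v)) (EG.mapFun_id e))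

lemma fiberTorus_snd (E Eh : CircleBundle X) (v : E.total) (vh : Eh.total)
    (hv : E.proj v = Eh.proj vh) (e : EG X.grp) :
    fiberTorus E Eh v vh hv e ≫ borelFunctor.map (corrSnd E Eh) =
      GSpace.trivMap ContinuousMap.snd ≫ fiberCircle Eh vh e :=
  GSpace.hom_ext rfl (ContinuousMap.ext fun (q : Circle × Circle) =>
    congrArg (Borel.mk (X := Eh.toGSpace) (q.2 • vh)) (EG.mapFun_id e))

/-- The Borel construction on twists. -/
abbrev bor {X : GSpace} (P : 𝓣.Tw X) : 𝓣.Tw (borelFunctor.obj X) :=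
  (𝓣.borelFun 𝓣.borel X).obj P

/-- The Borel construction on morphisms of triples. -/
def borMap {X Y : GSpace} {Q : 𝓣.Tw Y} {P : 𝓣.Tw X} (ψ : tri Y Q ⟶ tri X P) :
    tri (borelFunctor.obj Y) (bor Q) ⟶ tri (borelFunctor.obj X) (bor P) :=
  (borelTotal 𝓣.toPre 𝓣.borel).map ψ

lemma borMap_comp {X Y Z : GSpace} {R : 𝓣.Tw Z} {Q : 𝓣.Tw Y} {P : 𝓣.Tw X}
    (χ : tri Z R ⟶ tri Y Q) (ψ : tri Y Q ⟶ tri X P) :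
    borMap (χ ≫ ψ) = borMap χ ≫ borMap ψ :=
  (borelTotal 𝓣.toPre 𝓣.borel).map_comp χ ψ

/-- The Borel construction commutes with pullback. -/
def borNat {X Y : GSpace} (f : Y ⟶ X) (P : 𝓣.Tw X) :
    bor ((𝓣.pull f).obj P) ≅ (𝓣.pull (borelFunctor.map f)).obj (bor P) :=
  (𝓣.borelNat 𝓣.borel f).app P

lemma borNat_lift {X Y : GSpace} (f : Y ⟶ X) (P : 𝓣.Tw X) :
    vert (borNat f P).hom ≫ lift (borelFunctor.map f) (bor P) = borMap (lift f P) :=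
  borelTotal_map_lift 𝓣.toPre 𝓣.borel f P

/-- The isomorphism of twists on Borel constructions in the Poincaré condition. -/
abbrev borIso {C A Ah : GSpace} {a : C ⟶ A} {ah : C ⟶ Ah} {P : 𝓣.Tw A} {Ph : 𝓣.Tw Ah}
    (u : (𝓣.pull a).obj P ≅ (𝓣.pull ah).obj Ph) :
    (𝓣.pull (borelFunctor.map a)).obj (bor P) ≅ (𝓣.pull (borelFunctor.map ah)).obj (bor Ph) :=
  ((𝓣.borelNat 𝓣.borel a).app P).symm ≪≫ (𝓣.borelFun 𝓣.borel _).mapIso u ≪≫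
    (𝓣.borelNat 𝓣.borel ah).app Ph

lemma vert_borIso {C A Ah : GSpace} {a : C ⟶ A} {ah : C ⟶ Ah} {P : 𝓣.Tw A} {Ph : 𝓣.Tw Ah}
    (u : (𝓣.pull a).obj P ≅ (𝓣.pull ah).obj Ph) :
    vert (borIso u).hom = vert (borNat a P).inv ≫ borMap (vert u.hom) ≫
      vert (borNat ah Ph).hom := by
  have h : borMap (vert u.hom) = vert ((𝓣.borelFun 𝓣.borel _).map u.hom) :=
    borelTotal_map_vert 𝓣.toPre 𝓣.borel u.hom
  rw [h]
  exact (vert_comp _ _).trans (congrArg (_ ≫ ·) (vert_comp _ _))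

section Square

variable {C A Ah C' A' Ah' : GSpace} {a : C ⟶ A} {a' : C' ⟶ A'} {P : 𝓣.Tw A} {P' : 𝓣.Tw A'}
  {ah : C ⟶ Ah} {ah' : C' ⟶ Ah'} {Ph : 𝓣.Tw Ah} {Ph' : 𝓣.Tw Ah'}

/-- The Borel construction of a map between pulled back twists. -/
def borPull (c : tri C' ((𝓣.pull a').obj P') ⟶ tri C ((𝓣.pull a).obj P)) :
    tri (borelFunctor.obj C') ((𝓣.pull (borelFunctor.map a')).obj (bor P')) ⟶
      tri (borelFunctor.obj C) ((𝓣.pull (borelFunctor.map a)).obj (bor P)) :=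
  vert (borNat a' P').inv ≫ borMap c ≫ vert (borNat a P).hom

lemma borPull_base (c : tri C' ((𝓣.pull a').obj P') ⟶ tri C ((𝓣.pull a).obj P)) :
    (borPull c).base = borelFunctor.map c.base :=
  (Category.id_comp _).trans (Category.comp_id _)

lemma borPull_lift {c : tri C' ((𝓣.pull a').obj P') ⟶ tri C ((𝓣.pull a).obj P)}
    {ε : tri A' P' ⟶ tri A P} (h : c ≫ lift a P = lift a' P' ≫ ε) :
    borPull c ≫ lift (borelFunctor.map a) (bor P) =
      lift (borelFunctor.map a') (bor P') ≫ borMap ε := by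
  rw [borPull, Category.assoc, Category.assoc, borNat_lift, ← borMap_comp, h, borMap_comp,
    ← borNat_lift, Category.assoc, ← Category.assoc (vert (borNat a' P').inv), vert_inv_hom,
    Category.id_comp]

lemma borPull_borIso {c : tri C' ((𝓣.pull a').obj P') ⟶ tri C ((𝓣.pull a).obj P)}
    {d : tri C' ((𝓣.pull ah').obj Ph') ⟶ tri C ((𝓣.pull ah).obj Ph)}
    {u : (𝓣.pull a).obj P ≅ (𝓣.pull ah).obj Ph} {u' : (𝓣.pull a').obj P' ≅ (𝓣.pull ah').obj Ph'}
    (h : c ≫ vert u.hom = vert u'.hom ≫ d) :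
    borPull c ≫ vert (borIso u).hom = vert (borIso u').hom ≫ borPull d := by
  rw [vert_borIso, vert_borIso, borPull, borPull]
  have h1 : borMap c ≫ borMap (vert u.hom) = borMap (vert u'.hom) ≫ borMap d := by
    rw [← borMap_comp, h, borMap_comp]
  have h2 := vert_hom_inv (borNat a P)
  have h3 := vert_hom_inv (borNat ah' Ph')
  simp only [Category.assoc]
  rw [reassoc_of% h2, reassoc_of% h3, reassoc_of% h1]

end Square

/-- The triple with the given pairs induced by a triple. -/
def TTriple.induced : TTriple 𝓣 Y where
  pair := pair
  dual := dual
  u := inducedU D f pair dual ε εh hε hεh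
  poincare v vh hv e := by
    obtain ⟨ha, hb, hab⟩ := induced_spec D f pair dual ε εh hε hεh
    set a := inducedA D f pair dual ε εh hε hεh
    set b := inducedB D f pair dual ε εh hε hεh
    set u := inducedU D f pair dual ε εh hε hεh
    have hv' : D.pair.E.proj (ε.base.f v) = D.dual.E.proj (εh.base.f vh) :=
      (GSpace.congr_f hε.1 v).trans ((congrArg f.f hv).trans (GSpace.congr_f hεh.1 vh).symm)
    refine PoincareOnFiber.of_hom (D.poincare (ε.base.f v) (εh.base.f vh) hv' (EG.mapFun f.φ e))
      (borMap ε) (borMap εh) (borPull a) (borPull b) (borPull_lift ha) (borPull_lift hb)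
      (borPull_borIso hab) (fiberCircle_comp f hε v e) (fiberCircle_comp f hεh vh e) ?_
      (fiberTorus_fst _ _ v vh hv e) (fiberTorus_snd _ _ v vh hv e)
    -- The torus through `(v, vh)` must map to the torus through the image points. The two
    -- coordinates agree because the bundle maps commute with the circle action.
    · have hfst := congrArg CoGrothendieck.Hom.base ha
      have hsnd := congrArg CoGrothendieck.Hom.base hb
      have heq : a.base = b.base := by
        simpa using congrArg CoGrothendieck.Hom.base hab
      have hφ : (a.base.φ : Y.grp → X.grp) = f.φ := by
        rw [heq]
        exact funext fun g => (GSpace.congr_φ hsnd g).trans (GSpace.congr_φ hεh.1 g)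
      rw [borPull_base]
      refine GSpace.hom_ext rfl (ContinuousMap.ext fun (q : Circle × Circle) => ?_)
      change Borel.mk (X := (corr D.pair.E D.dual.E).toGSpace)
        (a.base.f (torusPoint pair.E dual.E v vh hv q)) (EG.mapFun a.base.φ e) =
        Borel.mk (X := (corr D.pair.E D.dual.E).toGSpace)
        (torusPoint D.pair.E D.dual.E (ε.base.f v) (εh.base.f vh) hv' q) (EG.mapFun f.φ e)
      rw [hφ]
      refine congrArg (fun z => Borel.mk (X := (corr D.pair.E D.dual.E).toGSpace) z _)
        (Subtype.ext (Prod.ext ?_ ?_))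
      · rw [heq]
        exact (GSpace.congr_f hsnd (torusPoint pair.E dual.E v vh hv q)).trans (hεh.2 q.2 vh)
      · exact (GSpace.congr_f hfst (torusPoint pair.E dual.E v vh hv q)).trans (hε.2 q.1 v)

/-- The morphism from the induced triple to the given one. -/
def TTriple.inducedHom : (D.induced f pair dual ε εh hε hεh).Hom D where
  f := f
  ε := ε
  εh := εh
  hε := hε
  hεh := hεh
  a := inducedA D f pair dual ε εh hε hεh
  b := inducedB D f pair dual ε εh hε hεh
  ha := (induced_spec D f pair dual ε εh hε hεh).1
  hb := (induced_spec D f pair dual ε εh hε hεh).2.1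
  comm := (induced_spec D f pair dual ε εh hε hεh).2.2

end Induced

namespace GSpace

variable {X Y : GSpace}

lemma isIso_of_isHomeomorph (m : Y ⟶ X) (hφ : IsHomeomorph m.φ) (hf : IsHomeomorph m.f) :
    IsIso m := by
  let eφ := hφ.homeomorph
  let ef := hf.homeomorph
  have h1 : ∀ g, m.φ (eφ.symm g) = g := eφ.apply_symm_apply
  have h2 : ∀ x, m.f (ef.symm x) = x := ef.apply_symm_apply
  have h1' : ∀ g, eφ.symm (m.φ g) = g := eφ.symm_apply_apply
  have h2' : ∀ x, ef.symm (m.f x) = x := ef.symm_apply_apply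
  let φ' : X.grp →ₜ* Y.grp :=
    { toFun := eφ.symm
      map_one' := by rw [← map_one m.φ, h1']
      map_mul' := fun _ _ => hφ.injective (by rw [h1, map_mul, h1, h1])
      continuous_toFun := eφ.symm.continuous }
  let m' : X ⟶ Y := ⟨φ', ⟨ef.symm, ef.symm.continuous⟩, fun g x => hf.injective (by
    change m.f (ef.symm (g • x)) = m.f (eφ.symm g • ef.symm x)
    rw [h2, m.equivariant, h1, h2])⟩
  exact ⟨m', GSpace.hom_ext (ContinuousMonoidHom.ext h1') (ContinuousMap.ext h2'),
    GSpace.hom_ext (ContinuousMonoidHom.ext h1) (ContinuousMap.ext h2)⟩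

lemma mono_of_injective (m : Y ⟶ X) (hφ : Function.Injective m.φ) (hf : Function.Injective m.f) :
    Mono m :=
  ⟨fun _ _ h => GSpace.hom_ext (ContinuousMonoidHom.ext fun g => hφ (GSpace.congr_φ h g))
    (ContinuousMap.ext fun z => hf (GSpace.congr_f h z))⟩

instance mono_incl (U : SubMulAction X.grp X.space) : Mono (X.incl U) :=
  mono_of_injective _ Function.injective_id Subtype.val_injective

end GSpace

lemma TwistPresheaf.mono_of_base {𝓣 : TwistPresheaf.{v, u}} {A B : 𝓣.Total} (ψ : A ⟶ B)
    [Mono ψ.base] : Mono ψ :=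
  ⟨fun _ _ h => fac_unique ψ ((cancel_mono ψ.base).mp (congrArg CoGrothendieck.Hom.base h)) h⟩

namespace CircleBundle

variable {X Y : GSpace} {f : Y ⟶ X} (E : CircleBundle X)

/-- Followed by the graph of `proj`, the map becomes a restriction of the embedding `f × id`. -/
lemma isEmbedding_pullbackMap (hf : Topology.IsEmbedding f.f) :
    Topology.IsEmbedding (E.pullbackMap f).f := by
  have h : Topology.IsEmbedding fun p : PullbackTotal f E => (f.f p.1.1, p.1.2) :=
    (hf.prodMap Topology.IsEmbedding.id).comp Topology.IsEmbedding.subtypeVal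
  refine Topology.IsEmbedding.of_comp (g := fun e : E.total => (E.proj e, e))
    (ContinuousMap.continuous _) (by fun_prop) ?_
  have e : (fun p : PullbackTotal f E => (f.f p.1.1, p.1.2)) =
      fun p : PullbackTotal f E => (E.proj p.1.2, p.1.2) :=
    funext fun p => Prod.ext p.2 rfl
  rw [e] at h
  exact h

lemma range_pullbackMap : Set.range (E.pullbackMap f).f = E.proj ⁻¹' Set.range f.f := by
  ext e
  constructor
  · rintro ⟨p, rfl⟩
    exact ⟨p.1.1, p.2⟩
  · rintro ⟨y, hy⟩
    exact ⟨⟨(y, e), hy⟩, rfl⟩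

end CircleBundle

/-! ### Pullback of triples and its universal property -/

namespace TTriple

variable {X Y Z : GSpace}

/-- The pullback of a triple. -/
def pull (D : TTriple 𝓣 X) (f : Y ⟶ X) : TTriple 𝓣 Y :=
  D.induced f ⟨D.pair.E.pullback f, (𝓣.pull (D.pair.E.pullbackMap f)).obj D.pair.P⟩
    ⟨D.dual.E.pullback f, (𝓣.pull (D.dual.E.pullbackMap f)).obj D.dual.P⟩
    (lift _ _) (lift _ _) (isBundleMap_pullbackMap _ _) (isBundleMap_pullbackMap _ _)

/-- The canonical morphism from the pullback of a triple to the triple. -/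
def pullHom (D : TTriple 𝓣 X) (f : Y ⟶ X) : (D.pull f).Hom D :=
  D.inducedHom f ⟨D.pair.E.pullback f, (𝓣.pull (D.pair.E.pullbackMap f)).obj D.pair.P⟩
    ⟨D.dual.E.pullback f, (𝓣.pull (D.dual.E.pullbackMap f)).obj D.dual.P⟩
    (lift _ _) (lift _ _) (isBundleMap_pullbackMap _ _) (isBundleMap_pullbackMap _ _)

namespace Hom

variable {D : TTriple 𝓣 X} {D' : TTriple 𝓣 Y} {D'' : TTriple 𝓣 Z}

/-- The composition of morphisms of triples. -/
def comp (η : D''.Hom D') (θ : D'.Hom D) : D''.Hom D where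
  f := η.f ≫ θ.f
  ε := η.ε ≫ θ.ε
  εh := η.εh ≫ θ.εh
  hε := ⟨by rw [comp_base, Category.assoc, θ.hε.1, ← Category.assoc, η.hε.1, Category.assoc],
    fun z v => (congrArg θ.ε.base.f (η.hε.2 z v)).trans (θ.hε.2 z _)⟩
  hεh := ⟨by rw [comp_base, Category.assoc, θ.hεh.1, ← Category.assoc, η.hεh.1, Category.assoc],
    fun z v => (congrArg θ.εh.base.f (η.hεh.2 z v)).trans (θ.hεh.2 z _)⟩
  a := η.a ≫ θ.a
  b := η.b ≫ θ.b
  ha := by rw [Category.assoc, θ.ha, ← Category.assoc, η.ha, Category.assoc]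
  hb := by rw [Category.assoc, θ.hb, ← Category.assoc, η.hb, Category.assoc]
  comm := by rw [Category.assoc, θ.comm, ← Category.assoc, η.comm, Category.assoc]

/-- The components `a` and `b` are forced by `ε` and `εh`. Only their compatibility with the
isomorphisms of twists remains, and after composing with `θ'.b` it reduces to `comm` for `θ` and
`θ'`. -/
lemma exists_of_fac (θ : D''.Hom D) (θ' : D'.Hom D) (k : Z ⟶ Y)
    (ε : tri D''.pair.E.toGSpace D''.pair.P ⟶ tri D'.pair.E.toGSpace D'.pair.P)
    (εh : tri D''.dual.E.toGSpace D''.dual.P ⟶ tri D'.dual.E.toGSpace D'.dual.P)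
    (hε : IsBundleMap k D''.pair.E D'.pair.E ε.base)
    (hεh : IsBundleMap k D''.dual.E D'.dual.E εh.base)
    (e : ε ≫ θ'.ε = θ.ε) (eh : εh ≫ θ'.εh = θ.εh) :
    ∃ η : D''.Hom D', η.f = k ∧ η.ε = ε ∧ η.εh = εh := by
  obtain ⟨a, b, u, ha, hb, hab⟩ := exists_inducedIso D' k D''.pair D''.dual ε εh hε hεh
  have hbase : a.base = b.base := by simpa using congrArg CoGrothendieck.Hom.base hab
  have ea : (a ≫ θ'.a) ≫ lift (corrFst _ _) D.pair.P = θ.a ≫ lift (corrFst _ _) D.pair.P := by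
    rw [Category.assoc, θ'.ha, ← Category.assoc, ha, Category.assoc, e, θ.ha]
  have eb : (b ≫ θ'.b) ≫ lift (corrSnd _ _) D.dual.P = θ.b ≫ lift (corrSnd _ _) D.dual.P := by
    rw [Category.assoc, θ'.hb, ← Category.assoc, hb, Category.assoc, eh, θ.hb]
  have hb1 : (a ≫ θ'.a).base = (b ≫ θ'.b).base := by
    rw [comp_base, comp_base, hbase, θ'.base_eq]
  have hb2 : (a ≫ θ'.a).base = θ.a.base := by
    refine pullback_hom_ext ?_ (congrArg CoGrothendieck.Hom.base ea)
    rw [hb1, θ.base_eq]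
    exact congrArg CoGrothendieck.Hom.base eb
  have ea' : a ≫ θ'.a = θ.a := fac_unique _ hb2 ea
  have eb' : b ≫ θ'.b = θ.b := fac_unique _ (hb1.symm.trans (hb2.trans θ.base_eq)) eb
  refine ⟨⟨k, ε, εh, hε, hεh, a, b, ha, hb, fac_unique θ'.b ?_ ?_⟩, rfl, rfl, rfl⟩
  · rw [comp_base, comp_base, hbase]
    simp
  · rw [Category.assoc, ← θ'.comm, ← Category.assoc, ea', θ.comm, Category.assoc, eb']

/-- The fiber product factors the bundle maps, cartesian lifts factor the maps of twists, and
`exists_of_fac` does the rest. This supplies the maps between restrictions to nested subspaces. -/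
lemma exists_lift (θ : D''.Hom D) (f : Y ⟶ X) (k : Z ⟶ Y) (hk : θ.f = k ≫ f) :
    ∃ η : D''.Hom (D.pull f), η.f = k ∧ η.ε ≫ (D.pullHom f).ε = θ.ε ∧
      η.εh ≫ (D.pullHom f).εh = θ.εh := by
  have aux : ∀ (E : CircleBundle X) (E'' : CircleBundle Z) (P : 𝓣.Tw E.toGSpace)
      (P'' : 𝓣.Tw E''.toGSpace) (ψ : tri E''.toGSpace P'' ⟶ tri E.toGSpace P),
      IsBundleMap θ.f E'' E ψ.base → ∃ χ : tri E''.toGSpace P'' ⟶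
        tri (E.pullback f).toGSpace ((𝓣.pull (E.pullbackMap f)).obj P),
        IsBundleMap k E'' (E.pullback f) χ.base ∧ χ ≫ lift (E.pullbackMap f) P = ψ := by
    intro E E'' P P'' ψ hψ
    have hm : ψ.base ≫ E.π = (E''.π ≫ k) ≫ f := by rw [hψ.1, hk, Category.assoc]
    obtain ⟨χ, hχ, e⟩ := exists_fac (lift (E.pullbackMap f) P) ψ
      (E.pullbackLift f (E''.π ≫ k) ψ.base hm) (pullbackLift_map _ _ _ _ _)
    refine ⟨χ, ?_, e⟩
    rw [hχ]
    refine ⟨rfl, fun z v => Subtype.ext (Prod.ext ?_ (hψ.2 z v))⟩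
    exact congrArg k.f (E''.proj_circle z v)
  obtain ⟨ε, hε, e⟩ := aux _ _ _ _ θ.ε θ.hε
  obtain ⟨εh, hεh, eh⟩ := aux _ _ _ _ θ.εh θ.hεh
  obtain ⟨η, h1, h2, h3⟩ := exists_of_fac θ (D.pullHom f) k ε εh hε hεh e eh
  exact ⟨η, h1, h2 ▸ e, h3 ▸ eh⟩

end Hom

end TTriple

namespace TwistedTheory

variable (h : TwistedTheory.{v, u, w} 𝓣)

lemma T_bijective_iff {X Y : GSpace} {D : TTriple 𝓣 X} {D' : TTriple 𝓣 Y} (θ : D'.Hom D)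
    (hε : ∀ n, Function.Bijective (h.res θ.ε n)) (hεh : ∀ n, Function.Bijective (h.res θ.εh n))
    (n : ℤ) : Function.Bijective (h.T D' n) ↔ Function.Bijective (h.T D n) := by
  have e : h.T D' n ∘ h.res θ.ε (n + 1) = h.res θ.εh n ∘ h.T D n :=
    funext fun x => h.T_natural θ n x
  rw [← Function.Bijective.of_comp_iff _ (hε (n + 1)), e,
    Function.Bijective.of_comp_iff' (hεh n)]

lemma res_bijective_of_base {A B : 𝓣.Total} (ψ : A ⟶ B) (hψ : IsIso ψ.base) (n : ℤ) :
    Function.Bijective (h.res ψ n) :=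
  have := isIso_of_base ψ hψ
  h.res_bijective ψ n

end TwistedTheory

/-! ### Mayer–Vietoris sequences for restricted triples -/

namespace GSpace

variable {X Y : GSpace}

/-- The restriction of an equivariant map to invariant subspaces. -/
def restrict (m : Y ⟶ X) (V : SubMulAction Y.grp Y.space) (U : SubMulAction X.grp X.space)
    (h : Set.MapsTo m.f V U) : Y.sub V ⟶ X.sub U where
  φ := m.φ
  f := ⟨fun y => ⟨m.f y.1, h y.2⟩, by fun_prop⟩
  equivariant g y := Subtype.ext (m.equivariant g y.1)

end GSpace

namespace CircleBundle

variable {X : GSpace} (E : CircleBundle X)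

/-- The identification of the restricted bundle with an invariant subspace of the total space. -/
def subMap (U : SubMulAction X.grp X.space) (W : SubMulAction X.grp E.total)
    (h : ∀ e, e ∈ W ↔ E.proj e ∈ U) : (E.pullback (X.incl U)).toGSpace ⟶ E.toGSpace.sub W where
  φ := ContinuousMonoidHom.id _
  f := ⟨fun p : PullbackTotal (X.incl U) E => ⟨p.1.2, (h _).mpr (by
      rw [← p.2]; exact p.1.1.2)⟩,
    (continuous_snd.comp continuous_subtype_val).subtype_mk _⟩
  equivariant _ _ := rfl

/-- The Mayer–Vietoris axioms speak of invariant subspaces of the total space, while restricted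
triples live on fiber products; this isomorphism passes between the two. -/
instance isIso_subMap (U : SubMulAction X.grp X.space) (W : SubMulAction X.grp E.total)
    (h : ∀ e, e ∈ W ↔ E.proj e ∈ U) : IsIso (E.subMap U W h) := by
  let k : E.toGSpace.sub W ⟶ X.sub U :=
    GSpace.restrict E.π W U fun e he => (h e).mp he
  let j : E.toGSpace.sub W ⟶ (E.pullback (X.incl U)).toGSpace :=
    E.pullbackLift (X.incl U) k (E.toGSpace.incl W) rfl
  refine ⟨j, pullback_hom_ext ?_ rfl, rfl⟩
  refine GSpace.hom_ext rfl (ContinuousMap.ext fun (p : PullbackTotal (X.incl U) E) => ?_)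
  exact Subtype.ext p.2.symm

end CircleBundle

namespace TwistedTheory

variable (h : TwistedTheory.{v, u, w} 𝓣)

section MayerVietoris

variable {Z : GSpace} {Q : 𝓣.Tw Z} {U V : SubMulAction Z.grp Z.space}
  {AU AV AW : 𝓣.Total} {rU : AU ⟶ tri Z Q} {rV : AV ⟶ tri Z Q} {rW : AW ⟶ tri Z Q}
  {cU : AW ⟶ AU} {cV : AW ⟶ AV} (eU : cU ≫ rU = rW) (eV : cV ≫ rV = rW)
  {lU : AU ⟶ tri (Z.sub U) ((𝓣.pull (Z.incl U)).obj Q)} [IsIso lU]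
  {lV : AV ⟶ tri (Z.sub V) ((𝓣.pull (Z.incl V)).obj Q)} [IsIso lV]
  {lW : AW ⟶ tri (Z.sub (U ⊓ V)) ((𝓣.pull (Z.incl (U ⊓ V))).obj Q)} [IsIso lW]
  (hlU : lU ≫ lift (Z.incl U) Q = rU) (hlV : lV ≫ lift (Z.incl V) Q = rV)
  (hlW : lW ≫ lift (Z.incl (U ⊓ V)) Q = rW)
  (hU : IsOpen (U : Set Z.space)) (hV : IsOpen (V : Set Z.space))
  (hUV : (U : Set Z.space) ∪ V = Set.univ)

instance mono_lift_incl : Mono (lift (Z.incl U) Q) :=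
  have : Mono (lift (Z.incl U) Q).base := GSpace.mono_incl U
  mono_of_base _

omit [IsIso lU] [IsIso lW] in
include eU hlU hlW in
-- The inclusion of `U` is a monomorphism of twisted spaces, so the equation may be tested in `(Z,
-- Q)`, where both sides become `rW`.
lemma comparison_left : lW ≫ comparison (Z.inclOfLE inf_le_left) (Z.incl U) (Z.incl (U ⊓ V)) rfl Q =
    cU ≫ lU := by
  rw [← cancel_mono (lift (Z.incl U) Q), Category.assoc, Category.assoc, hlU, eU, ← hlW]
  exact congrArg (lW ≫ ·) (comparison_lift (Z.inclOfLE inf_le_left) _ _ rfl Q)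

omit [IsIso lV] [IsIso lW] in
include eV hlV hlW in
lemma comparison_right :
    lW ≫ comparison (Z.inclOfLE inf_le_right) (Z.incl V) (Z.incl (U ⊓ V)) rfl Q = cV ≫ lV := by
  rw [← cancel_mono (lift (Z.incl V) Q), Category.assoc, Category.assoc, hlV, eV, ← hlW]
  exact congrArg (lW ≫ ·) (comparison_lift (Z.inclOfLE inf_le_right) _ _ rfl Q)

omit [IsIso lU] [IsIso lV] [IsIso lW] in
include eU eV hlU hlV hlW in
lemma res_diff (n : ℤ) (a : (h.h n).obj (op (tri (Z.sub U) ((𝓣.pull (Z.incl U)).obj Q))))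
    (b : (h.h n).obj (op (tri (Z.sub V) ((𝓣.pull (Z.incl V)).obj Q)))) :
    h.res lW n ((h.h n).map (comparison (Z.inclOfLE inf_le_left) (Z.incl U)
        (Z.incl (U ⊓ V)) rfl Q).op a -
      (h.h n).map (comparison (Z.inclOfLE inf_le_right) (Z.incl V)
        (Z.incl (U ⊓ V)) rfl Q).op b) =
    h.res cU n (h.res lU n a) - h.res cV n (h.res lV n b) := by
  rw [map_sub, ← res_comp, ← res_comp, ← comparison_left eU hlU hlW, ← comparison_right eV hlV hlW,
    res_comp, res_comp]
  rfl

include eU eV hlU hlV hlW hU hV hUV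

/-- Exactness is transported from the literal restrictions to the isomorphic models `AU`, `AV`,
`AW`; likewise in `mv_inter` and `mv_total`. -/
lemma mv_sum (n : ℤ) (a : (h.h n).obj (op AU)) (b : (h.h n).obj (op AV))
    (hab : h.res cU n a = h.res cV n b) :
    ∃ x, h.res rU n x = a ∧ h.res rV n x = b := by
  obtain ⟨a, rfl⟩ := (h.res_bijective lU n).2 a
  obtain ⟨b, rfl⟩ := (h.res_bijective lV n).2 b
  rw [← sub_eq_zero, ← h.res_diff eU eV hlU hlV hlW, ← map_zero (h.res lW n)] at hab
  obtain ⟨x, hxa, hxb⟩ := (h.exact_sum Z Q U V hU hV hUV n a b).mp ((h.res_bijective lW n).1 hab)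
  refine ⟨x, ?_, ?_⟩
  · rw [← hlU, res_comp, ← hxa]; rfl
  · rw [← hlV, res_comp, ← hxb]; rfl

lemma mv_inter (n : ℤ)
    (y : (h.h n).obj (op (tri (Z.sub (U ⊓ V)) ((𝓣.pull (Z.incl (U ⊓ V))).obj Q)))) :
    h.δ Z Q U V hU hV hUV n y = 0 ↔ ∃ a b, h.res cU n a - h.res cV n b = h.res lW n y := by
  rw [h.exact_inter]
  constructor
  · rintro ⟨a, b, rfl⟩
    exact ⟨_, _, (h.res_diff eU eV hlU hlV hlW n a b).symm⟩
  · rintro ⟨a, b, e⟩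
    obtain ⟨a, rfl⟩ := (h.res_bijective lU n).2 a
    obtain ⟨b, rfl⟩ := (h.res_bijective lV n).2 b
    rw [← h.res_diff eU eV hlU hlV hlW] at e
    exact ⟨a, b, (h.res_bijective lW n).1 e⟩

omit eU eV hlW lW AW rW cU cV [IsIso lW] in
lemma mv_total (n : ℤ) (x : (h.h (n + 1)).obj (op (tri Z Q))) :
    (h.res rU (n + 1) x = 0 ∧ h.res rV (n + 1) x = 0) ↔
      ∃ y, h.δ Z Q U V hU hV hUV n y = x := by
  rw [← h.exact_total, ← hlU, ← hlV, res_comp, res_comp]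
  refine and_congr ?_ ?_
  · exact (map_eq_zero_iff (h.res lU (n + 1)) (h.res_bijective lU _).1)
  · exact (map_eq_zero_iff (h.res lV (n + 1)) (h.res_bijective lV _).1)

end MayerVietoris

end TwistedTheory

/-! ### Compatibility of `T` with boundary maps, and the five lemma -/

namespace TwistedTheory

variable (h : TwistedTheory.{v, u, w} 𝓣)

lemma exists_subLift {X : GSpace} (E : CircleBundle X) (P : 𝓣.Tw E.toGSpace)
    (U : SubMulAction X.grp X.space) (W : SubMulAction X.grp E.total)
    (hW : ∀ e, e ∈ W ↔ E.proj e ∈ U) :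
    ∃ l : tri (E.pullback (X.incl U)).toGSpace ((𝓣.pull (E.pullbackMap (X.incl U))).obj P) ⟶
        tri (E.toGSpace.sub W) ((𝓣.pull (E.toGSpace.incl W)).obj P),
      l.base = E.subMap U W hW ∧ IsIso l ∧
        l ≫ lift (E.toGSpace.incl W) P = lift (E.pullbackMap (X.incl U)) P := by
  obtain ⟨l, hl, e⟩ := exists_fac (lift (E.toGSpace.incl W) P) (lift (E.pullbackMap (X.incl U)) P)
    (E.subMap U W hW) rfl
  exact ⟨l, hl, isIso_of_base l (by rw [hl]; infer_instance), e⟩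

/-- `T` is pullback along a single morphism `ψ` followed by push-forward. `δ_natural` moves the
boundary past the first and `δ_push` past the second, at the cost of a sign. The class left over `U
∩ V` is recognized as `T` of the restricted triple by `push_natural`. Allowing any `yh` with `hy`
avoids choosing an inverse of `h.res lh n`. -/
lemma T_δ {X : GSpace} (D : TTriple 𝓣 X) (U V : SubMulAction X.grp X.space)
    (hU : IsOpen (GSpace.preimage D.pair.E.π U : Set D.pair.E.total))
    (hV : IsOpen (GSpace.preimage D.pair.E.π V : Set D.pair.E.total))
    (hUV : (GSpace.preimage D.pair.E.π U : Set D.pair.E.total) ∪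
      GSpace.preimage D.pair.E.π V = Set.univ)
    (hU' : IsOpen (GSpace.preimage D.dual.E.π U : Set D.dual.E.total))
    (hV' : IsOpen (GSpace.preimage D.dual.E.π V : Set D.dual.E.total))
    (hUV' : (GSpace.preimage D.dual.E.π U : Set D.dual.E.total) ∪
      GSpace.preimage D.dual.E.π V = Set.univ)
    {Y : GSpace} {D' : TTriple 𝓣 Y} (θ : D'.Hom D)
    (l : tri D'.pair.E.toGSpace D'.pair.P ⟶
      tri (D.pair.E.toGSpace.sub (GSpace.preimage D.pair.E.π U ⊓ GSpace.preimage D.pair.E.π V))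
        ((𝓣.pull (D.pair.E.toGSpace.incl _)).obj D.pair.P))
    (hl : l ≫ lift (D.pair.E.toGSpace.incl _) D.pair.P = θ.ε)
    (lh : tri D'.dual.E.toGSpace D'.dual.P ⟶
      tri (D.dual.E.toGSpace.sub (GSpace.preimage D.dual.E.π U ⊓ GSpace.preimage D.dual.E.π V))
        ((𝓣.pull (D.dual.E.toGSpace.incl _)).obj D.dual.P))
    (hlh : lh ≫ lift (D.dual.E.toGSpace.incl _) D.dual.P = θ.εh) (n : ℤ)
    (y : (h.h (n + 1)).obj (op (tri (D.pair.E.toGSpace.sub _)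
      ((𝓣.pull (D.pair.E.toGSpace.incl _)).obj D.pair.P))))
    (yh : (h.h n).obj (op (tri (D.dual.E.toGSpace.sub _)
      ((𝓣.pull (D.dual.E.toGSpace.incl _)).obj D.dual.P))))
    (hlhi : Function.Injective (h.res lh n))
    (hy : h.res lh n yh = h.T D' n (h.res l (n + 1) y)) :
    h.T D (n + 1) (h.δ D.pair.E.toGSpace D.pair.P _ _ hU hV hUV (n + 1) y) =
      (h.sign n : ℤ) • h.δ D.dual.E.toGSpace D.dual.P _ _ hU' hV' hUV' n yh := by
  let C := corr D.pair.E D.dual.E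
  let U2 := GSpace.preimage D.dual.E.π U
  let V2 := GSpace.preimage D.dual.E.π V
  let ψ := vert D.u.inv ≫ lift (corrFst D.pair.E D.dual.E) D.pair.P
  have hψ : ψ.base = corrFst D.pair.E D.dual.E := Category.id_comp _
  have hmem : ∀ (W : SubMulAction X.grp X.space) (p : C.total),
      p ∈ GSpace.preimage C.π (GSpace.preimage D.dual.E.π W) →
        (corrFst D.pair.E D.dual.E).f p ∈ GSpace.preimage D.pair.E.π W := by
    intro W p hp
    change D.pair.E.proj p.1.2 ∈ W
    rw [← p.2]
    exact hp
  have hU3 : IsOpen (GSpace.preimage C.π U2 : Set C.total) := hU'.preimage C.proj.continuous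
  have hV3 : IsOpen (GSpace.preimage C.π V2 : Set C.total) := hV'.preimage C.proj.continuous
  have hUV3 : (GSpace.preimage C.π U2 : Set C.total) ∪ GSpace.preimage C.π V2 = Set.univ :=
    congrArg (C.proj ⁻¹' ·) hUV'
  obtain ⟨ψ', hψ', eψ'⟩ := exists_fac
    (lift (D.pair.E.toGSpace.incl (GSpace.preimage D.pair.E.π U ⊓ GSpace.preimage D.pair.E.π V))
      D.pair.P)
    (lift (C.toGSpace.incl (GSpace.preimage C.π U2 ⊓ GSpace.preimage C.π V2)) _ ≫ ψ)
    (GSpace.restrict (corrFst D.pair.E D.dual.E) _ _ fun p hp =>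
      ⟨hmem U p hp.1, hmem V p hp.2⟩) (by rw [comp_base, hψ]; rfl)
  -- The identification demanded by `δ_push`, covering `subMap`.
  obtain ⟨κ, hκ, eκ⟩ := exists_fac
    (lift (C.toGSpace.incl (GSpace.preimage C.π U2 ⊓ GSpace.preimage C.π V2)) _ ≫
      lift C.π D.dual.P)
    (lift (C.pullback (D.dual.E.toGSpace.incl (U2 ⊓ V2))).π _ ≫
      lift (D.dual.E.toGSpace.incl (U2 ⊓ V2)) D.dual.P)
    (C.subMap (U2 ⊓ V2) _ fun _ => Iff.rfl) (by
      change C.pullbackMap _ ≫ C.π = (C.pullback (D.dual.E.toGSpace.incl (U2 ⊓ V2))).π ≫ _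
      exact (isBundleMap_pullbackMap _ C).1)
  have hlhb : lh.base ≫ D.dual.E.toGSpace.incl (U2 ⊓ V2) = θ.εh.base :=
    congrArg CoGrothendieck.Hom.base hlh
  have hm : θ.b.base ≫ C.π = (corrSnd D'.pair.E D'.dual.E ≫ lh.base) ≫
      D.dual.E.toGSpace.incl (U2 ⊓ V2) := by
    rw [Category.assoc, hlhb]
    exact congrArg CoGrothendieck.Hom.base θ.hb
  let m := C.pullbackLift (D.dual.E.toGSpace.incl (U2 ⊓ V2)) _ θ.b.base hm
  -- `Ψ` maps the correspondence space of `D'` to the restriction of that of `D`, so that the two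
  -- push-forwards over `U ∩ V` can be compared.
  obtain ⟨Ψ, hΨ, eΨ⟩ := exists_fac (lift (C.pullback (D.dual.E.toGSpace.incl (U2 ⊓ V2))).π
      ((𝓣.pull (D.dual.E.toGSpace.incl (U2 ⊓ V2))).obj D.dual.P))
    (lift (corrSnd D'.pair.E D'.dual.E) D'.dual.P ≫ lh) m rfl
  have e1 : Ψ ≫ κ ≫ lift (C.toGSpace.incl (GSpace.preimage C.π U2 ⊓ GSpace.preimage C.π V2)) _ =
      θ.b := by
    refine fac_unique (lift C.π D.dual.P) ?_ ?_
    · rw [comp_base, comp_base, hΨ, hκ]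
      exact pullbackLift_map _ _ _ _ _
    · rw [Category.assoc, Category.assoc, eκ, ← Category.assoc, eΨ, Category.assoc, hlh]
      exact θ.hb.symm
  have : Mono (lift (D.pair.E.toGSpace.incl
      (GSpace.preimage D.pair.E.π U ⊓ GSpace.preimage D.pair.E.π V)) D.pair.P) := mono_lift_incl
  have e2 : Ψ ≫ κ ≫ ψ' = (vert D'.u.inv ≫ lift (corrFst _ _) D'.pair.P) ≫ l := by
    rw [← cancel_mono (lift (D.pair.E.toGSpace.incl
      (GSpace.preimage D.pair.E.π U ⊓ GSpace.preimage D.pair.E.π V)) D.pair.P), Category.assoc,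
      Category.assoc, eψ', Category.assoc, hl]
    refine Eq.trans ?_ θ.comm_inv.symm
    rw [← e1]
    simp only [Category.assoc]
    rfl
  have hpush := h.push_natural lh.base (corr D'.pair.E D'.dual.E)
    (C.pullback (D.dual.E.toGSpace.incl (U2 ⊓ V2))) Ψ.base ?_ _ _ lh Ψ rfl rfl eΨ n
    (h.res κ (n + 1) (h.res ψ' (n + 1) y))
  · have hyh : yh = h.push (C.pullback (D.dual.E.toGSpace.incl (U2 ⊓ V2)))
        ((𝓣.pull (D.dual.E.toGSpace.incl (U2 ⊓ V2))).obj D.dual.P) n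
          (h.res κ (n + 1) (h.res ψ' (n + 1) y)) := by
      apply hlhi
      rw [hy, T_apply]
      refine Eq.trans ?_ hpush
      change _ = h.push _ _ n (h.res Ψ (n + 1) _)
      rw [← res_comp, ← res_comp, ← res_comp, ← e2, Category.assoc]
    rw [T_apply]
    have e3 := h.δ_natural C.toGSpace D.pair.E.toGSpace _ D.pair.P ψ
      (GSpace.preimage C.π U2) (GSpace.preimage C.π V2) _ _ hU3 hV3 hUV3 hU hV hUV
      (by rw [hψ]; exact hmem U) (by rw [hψ]; exact hmem V) ψ' eψ' (n + 1) y
    refine (congrArg (h.push C D.dual.P (n + 1)) e3.symm).trans ?_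
    refine (h.δ_push D.dual.E.toGSpace D.dual.P C U2 V2 hU' hV' hUV' hU3 hV3 hUV3 κ
      (by rw [hκ]; rfl) eκ n (h.res ψ' (n + 1) y)).trans ?_
    rw [hyh]
    rfl
  · rw [hΨ]
    refine ⟨rfl, fun z v => Subtype.ext (Prod.ext ?_ ?_)⟩
    · rfl
    · have e4 : (θ.b.base.f (z • v) : PullbackTotal D.dual.E.π D.pair.E) =
          z • (θ.b.base.f v : C.total) := θ.isBundleMap_b.2 z v
      exact e4

end TwistedTheory

/-- The morphism of triples identifies its source with the restriction of the total spaces to the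
given invariant subspaces. -/
def TTriple.Hom.IsRestriction {Y X : GSpace} {D' : TTriple 𝓣 Y} {D : TTriple 𝓣 X} (θ : D'.Hom D)
    (U : SubMulAction X.grp D.pair.E.total) (V : SubMulAction X.grp D.dual.E.total) : Prop :=
  (∃ l : tri D'.pair.E.toGSpace D'.pair.P ⟶ tri (D.pair.E.toGSpace.sub U)
      ((𝓣.pull (D.pair.E.toGSpace.incl U)).obj D.pair.P),
    IsIso l ∧ l ≫ lift (D.pair.E.toGSpace.incl U) D.pair.P = θ.ε) ∧
  ∃ l : tri D'.dual.E.toGSpace D'.dual.P ⟶ tri (D.dual.E.toGSpace.sub V)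
      ((𝓣.pull (D.dual.E.toGSpace.incl V)).obj D.dual.P),
    IsIso l ∧ l ≫ lift (D.dual.E.toGSpace.incl V) D.dual.P = θ.εh

lemma TTriple.isRestriction_pullHom {X : GSpace} (D : TTriple 𝓣 X)
    (U : SubMulAction X.grp X.space) (W : SubMulAction X.grp D.pair.E.total)
    (W' : SubMulAction X.grp D.dual.E.total)
    (hW : ∀ e, e ∈ W ↔ D.pair.E.proj e ∈ U) (hW' : ∀ e, e ∈ W' ↔ D.dual.E.proj e ∈ U) :
    (D.pullHom (X.incl U)).IsRestriction W W' := by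
  obtain ⟨l, -, h1, h2⟩ := TwistedTheory.exists_subLift D.pair.E D.pair.P U W hW
  obtain ⟨l', -, h1', h2'⟩ := TwistedTheory.exists_subLift D.dual.E D.dual.P U W' hW'
  exact ⟨⟨l, h1, h2⟩, ⟨l', h1', h2'⟩⟩

namespace TwistedTheory

variable (h : TwistedTheory.{v, u, w} 𝓣)

/-- The five lemma for the Mayer–Vietoris sequences of the two total spaces, as a chase on elements.
`key` is the square with the boundary maps, which commutes up to a unit. -/
lemma T_bijective_of_restrictions {X YU YV YW : GSpace} {D : TTriple 𝓣 X}
    {DU : TTriple 𝓣 YU} {DV : TTriple 𝓣 YV} {DW : TTriple 𝓣 YW}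
    (θU : DU.Hom D) (θV : DV.Hom D) (θW : DW.Hom D) (ηU : DW.Hom DU) (ηV : DW.Hom DV)
    (eU : ηU.ε ≫ θU.ε = θW.ε) (eV : ηV.ε ≫ θV.ε = θW.ε)
    (eU' : ηU.εh ≫ θU.εh = θW.εh) (eV' : ηV.εh ≫ θV.εh = θW.εh)
    (U V : SubMulAction X.grp X.space)
    (hU : IsOpen (U : Set X.space)) (hV : IsOpen (V : Set X.space))
    (hUV : (U : Set X.space) ∪ V = Set.univ)
    (rU : θU.IsRestriction (GSpace.preimage D.pair.E.π U) (GSpace.preimage D.dual.E.π U))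
    (rV : θV.IsRestriction (GSpace.preimage D.pair.E.π V) (GSpace.preimage D.dual.E.π V))
    (rW : θW.IsRestriction (GSpace.preimage D.pair.E.π U ⊓ GSpace.preimage D.pair.E.π V)
      (GSpace.preimage D.dual.E.π U ⊓ GSpace.preimage D.dual.E.π V))
    (bU : ∀ n, Function.Bijective (h.T DU n)) (bV : ∀ n, Function.Bijective (h.T DV n))
    (bW : ∀ n, Function.Bijective (h.T DW n)) (n : ℤ) : Function.Bijective (h.T D n) := by
  obtain ⟨⟨lU, iU, hlU⟩, lU', iU', hlU'⟩ := rU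
  obtain ⟨⟨lV, iV, hlV⟩, lV', iV', hlV'⟩ := rV
  obtain ⟨⟨lW, iW, hlW⟩, lW', iW', hlW'⟩ := rW
  have oU : IsOpen (GSpace.preimage D.pair.E.π U : Set D.pair.E.total) :=
    hU.preimage D.pair.E.proj.continuous
  have oV : IsOpen (GSpace.preimage D.pair.E.π V : Set D.pair.E.total) :=
    hV.preimage D.pair.E.proj.continuous
  have oU' : IsOpen (GSpace.preimage D.dual.E.π U : Set D.dual.E.total) :=
    hU.preimage D.dual.E.proj.continuous
  have oV' : IsOpen (GSpace.preimage D.dual.E.π V : Set D.dual.E.total) :=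
    hV.preimage D.dual.E.proj.continuous
  have oUV : (GSpace.preimage D.pair.E.π U : Set D.pair.E.total) ∪
      GSpace.preimage D.pair.E.π V = Set.univ := congrArg (D.pair.E.proj ⁻¹' ·) hUV
  have oUV' : (GSpace.preimage D.dual.E.π U : Set D.dual.E.total) ∪
      GSpace.preimage D.dual.E.π V = Set.univ := congrArg (D.dual.E.proj ⁻¹' ·) hUV
  -- The boundary map into degree `n` on the dual side starts in degree `n - 1`.
  obtain ⟨m, rfl⟩ : ∃ m, n = m + 1 := ⟨n - 1, by ring⟩
  have key : ∀ y yh, h.res lW' m yh = h.T DW m (h.res lW (m + 1) y) →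
      h.T D (m + 1) (h.δ D.pair.E.toGSpace D.pair.P _ _ oU oV oUV (m + 1) y) =
        (h.sign m : ℤ) • h.δ D.dual.E.toGSpace D.dual.P _ _ oU' oV' oUV' m yh := fun y yh hy =>
    h.T_δ D U V oU oV oUV oU' oV' oUV' θW lW hlW lW' hlW' m y yh (h.res_bijective lW' m).1 hy
  constructor
  · rw [injective_iff_map_eq_zero]
    intro x hx
    -- By injectivity over `U` and `V`, a class killed by `T` restricts to zero on both and hence is
    -- a boundary.
    obtain ⟨y, rfl⟩ : ∃ y, h.δ D.pair.E.toGSpace D.pair.P _ _ oU oV oUV (m + 1) y = x := by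
      refine (h.mv_total hlU hlV oU oV oUV (m + 1) x).mp ⟨?_, ?_⟩
      · exact (bU (m + 1)).1 (by rw [T_natural, hx, map_zero, map_zero])
      · exact (bV (m + 1)).1 (by rw [T_natural, hx, map_zero, map_zero])
    obtain ⟨yh, hyh⟩ := (h.res_bijective lW' m).2 (h.T DW m (h.res lW (m + 1) y))
    rw [key y yh hyh] at hx
    have hx' : h.δ D.dual.E.toGSpace D.dual.P _ _ oU' oV' oUV' m yh = 0 := by
      -- The sign is its own inverse.
      have := congrArg (fun z => (h.sign m : ℤ) • z) hx
      simpa [smul_smul, ← Units.val_mul, Int.units_mul_self] using this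
    obtain ⟨a, b, hab⟩ := (h.mv_inter eU' eV' hlU' hlV' hlW' oU' oV' oUV' m yh).mp hx'
    obtain ⟨a, rfl⟩ := (bU m).2 a
    obtain ⟨b, rfl⟩ := (bV m).2 b
    refine (h.mv_inter eU eV hlU hlV hlW oU oV oUV (m + 1) y).mpr ⟨a, b, (bW m).1 ?_⟩
    rw [← hyh, ← hab, map_sub, T_natural, T_natural]
  · intro z
    obtain ⟨a, ha⟩ := (bU (m + 1)).2 (h.res θU.εh (m + 1) z)
    obtain ⟨b, hb⟩ := (bV (m + 1)).2 (h.res θV.εh (m + 1) z)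
    obtain ⟨x, rfl, rfl⟩ := h.mv_sum eU eV hlU hlV hlW oU oV oUV (m + 1 + 1) a b (by
      apply (bW (m + 1)).1
      rw [T_natural, T_natural, ha, hb, ← res_comp, ← res_comp, eU', eV'])
    rw [T_natural] at ha hb
    -- What is missing after subtracting the image of the glued class `x` is a boundary, and it is
    -- hit by the boundary of a class over `U ∩ V`, corrected by the sign.
    obtain ⟨yh, hyh⟩ := (h.mv_total hlU' hlV' oU' oV' oUV' m (z - h.T D (m + 1) x)).mp
      ⟨by rw [map_sub, ha, sub_self], by rw [map_sub, hb, sub_self]⟩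
    obtain ⟨y', hy'⟩ := (bW m).2 (h.res lW' m yh)
    obtain ⟨y, rfl⟩ := (h.res_bijective lW (m + 1)).2 y'
    refine ⟨x + (h.sign m : ℤ) • h.δ D.pair.E.toGSpace D.pair.P _ _ oU oV oUV (m + 1) y, ?_⟩
    rw [map_add, map_zsmul, key y yh hy'.symm, hyh, smul_smul, ← Units.val_mul,
      Int.units_mul_self]
    simp

lemma T_bijective_of_cover {X : GSpace} (D : TTriple 𝓣 X) (U V : SubMulAction X.grp X.space)
    (hU : IsOpen (U : Set X.space)) (hV : IsOpen (V : Set X.space))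
    (hUV : (U : Set X.space) ∪ V = Set.univ)
    (bU : ∀ n, Function.Bijective (h.T (D.pull (X.incl U)) n))
    (bV : ∀ n, Function.Bijective (h.T (D.pull (X.incl V)) n))
    (bW : ∀ n, Function.Bijective (h.T (D.pull (X.incl (U ⊓ V))) n)) (n : ℤ) :
    Function.Bijective (h.T D n) := by
  obtain ⟨ηU, -, eU, eU'⟩ := (D.pullHom (X.incl (U ⊓ V))).exists_lift (X.incl U)
    (X.inclOfLE inf_le_left) rfl
  obtain ⟨ηV, -, eV, eV'⟩ := (D.pullHom (X.incl (U ⊓ V))).exists_lift (X.incl V)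
    (X.inclOfLE inf_le_right) rfl
  exact h.T_bijective_of_restrictions _ _ _ ηU ηV eU eV eU' eV' U V hU hV hUV
    (D.isRestriction_pullHom U _ _ (fun _ => Iff.rfl) fun _ => Iff.rfl)
    (D.isRestriction_pullHom V _ _ (fun _ => Iff.rfl) fun _ => Iff.rfl)
    (D.isRestriction_pullHom (U ⊓ V) _ _ (fun _ => Iff.rfl) fun _ => Iff.rfl) bU bV bW n

end TwistedTheory

/-! ### Homotopy invariance and good subsets -/

namespace TwistedTheory

variable (h : TwistedTheory.{v, u, w} 𝓣)

/-- Morphisms over the same base map differ by an isomorphism over the identity, so it suffices to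
treat `lift f P`. The homotopy axiom compares it with `lift (𝟙 X) P`, which is an isomorphism. -/
lemma res_bijective_of_homotopic_id {X : GSpace} {f : X ⟶ X} (hf : GSpace.Homotopic f (𝟙 X))
    {Q P : 𝓣.Tw X} (ψ : tri X Q ⟶ tri X P) (hψ : ψ.base = f) (n : ℤ) :
    Function.Bijective (h.res ψ n) := by
  obtain ⟨a, ha⟩ := h.homotopy f (𝟙 X) hf P
  obtain ⟨χ, hχ, rfl⟩ := exists_fac (lift f P) ψ (𝟙 X) (by rw [hψ]; exact Category.id_comp f)
  have h1 : Function.Bijective (h.res χ n) :=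
    h.res_bijective_of_base χ (by rw [hχ]; infer_instance) n
  have h2 : Function.Bijective (h.res (vert a.inv) n) :=
    h.res_bijective_of_base _ (by rw [vert_base]; infer_instance) n
  have h3 : Function.Bijective (h.res (lift (𝟙 X) P) n) :=
    h.res_bijective_of_base _ (inferInstanceAs (IsIso (𝟙 X))) n
  have e : h.res (lift (𝟙 X) P) n = (h.res (vert a.inv) n) ∘ h.res (lift f P) n :=
    funext fun x => ha n x
  rw [e] at h3
  have h4 := (Function.Bijective.of_comp_iff' h2 _).mp h3
  have e2 : ⇑(h.res (χ ≫ lift f P) n) = h.res χ n ∘ h.res (lift f P) n :=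
    funext fun x => h.res_comp _ _ n x
  rw [e2]
  exact h1.comp h4

lemma res_bijective_of_homotopyEquiv {X Y : GSpace} (j : Y ⟶ X) (k : X ⟶ Y)
    (hkj : GSpace.Homotopic (k ≫ j) (𝟙 X)) (hjk : GSpace.Homotopic (j ≫ k) (𝟙 Y))
    {Q : 𝓣.Tw Y} {P : 𝓣.Tw X} (ψ : tri Y Q ⟶ tri X P) (hψ : ψ.base = j) (n : ℤ) :
    Function.Bijective (h.res ψ n) := by
  have h1 := h.res_bijective_of_homotopic_id hkj (lift k Q ≫ ψ) (by rw [comp_base, hψ]) n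
  have h2 := h.res_bijective_of_homotopic_id hjk (lift j ((𝓣.pull k).obj Q) ≫ lift k Q) rfl n
  have e1 : ⇑(h.res (lift k Q ≫ ψ) n) = h.res (lift k Q) n ∘ h.res ψ n :=
    funext fun x => h.res_comp _ _ n x
  have e2 : ⇑(h.res (lift j ((𝓣.pull k).obj Q) ≫ lift k Q) n) =
      h.res (lift j ((𝓣.pull k).obj Q)) n ∘ h.res (lift k Q) n :=
    funext fun x => h.res_comp _ _ n x
  rw [e1] at h1
  rw [e2] at h2
  -- Two out of six: one composite makes the middle map injective, the other surjective.
  have h3 : Function.Bijective (h.res (lift k Q) n) := ⟨h2.1.of_comp, h1.2.of_comp⟩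
  exact (Function.Bijective.of_comp_iff' h3 _).mp h1

/-- For each of the two bundles, both total spaces embed into the one over `X` with image the
preimage of `A`. The comparison map is therefore an isomorphism, which `T` does not notice. -/
lemma T_bijective_pull_incl_iff {X Z : GSpace} {D : TTriple 𝓣 X} {D' : TTriple 𝓣 Z}
    (A : SubMulAction X.grp X.space) (θ : D'.Hom D) (k : Z ⟶ X.sub A) (hk : θ.f = k ≫ X.incl A)
    (hφ : IsHomeomorph θ.f.φ)
    (h1 : Topology.IsEmbedding θ.ε.base.f) (h1' : Topology.IsEmbedding θ.εh.base.f)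
    (h2 : Set.range θ.ε.base.f = D.pair.E.proj ⁻¹' A)
    (h2' : Set.range θ.εh.base.f = D.dual.E.proj ⁻¹' A) (n : ℤ) :
    Function.Bijective (h.T D' n) ↔ Function.Bijective (h.T (D.pull (X.incl A)) n) := by
  obtain ⟨η, -, e, eh⟩ := θ.exists_lift (X.incl A) k hk
  have aux : ∀ (E : CircleBundle X) (E' : CircleBundle Z)
      (m : E'.toGSpace ⟶ (E.pullback (X.incl A)).toGSpace) (m' : E'.toGSpace ⟶ E.toGSpace),
      m ≫ E.pullbackMap (X.incl A) = m' → IsBundleMap θ.f E' E m' → Topology.IsEmbedding m'.f →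
      Set.range m'.f = E.proj ⁻¹' A → IsIso m := by
    intro E E' m m' hm hb he hr
    have he2 := E.isEmbedding_pullbackMap (f := X.incl A) Topology.IsEmbedding.subtypeVal
    have hc : (m'.f : E'.total → E.total) = (E.pullbackMap (X.incl A)).f ∘ m.f :=
      funext fun v => (GSpace.congr_f hm v).symm
    refine GSpace.isIso_of_isHomeomorph m ?_ ?_
    · have : (m.φ : Z.grp → X.grp) = θ.f.φ :=
        funext fun g => (GSpace.congr_φ hm g).trans (GSpace.congr_φ hb.1 g)
      rw [← this] at hφ
      exact hφ
    · rw [isHomeomorph_iff_isEmbedding_surjective]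
      refine ⟨Topology.IsEmbedding.of_comp m.f.continuous
        (E.pullbackMap (X.incl A)).f.continuous (hc ▸ he), fun p => ?_⟩
      have hp : (E.pullbackMap (X.incl A)).f p ∈ Set.range m'.f := by
        rw [hr]
        obtain ⟨a, ha⟩ := (E.range_pullbackMap (f := X.incl A)).le ⟨p, rfl⟩
        rw [Set.mem_preimage, ← ha]
        exact a.2
      obtain ⟨v, hv⟩ := hp
      exact ⟨v, he2.injective ((congrFun hc v).symm.trans hv)⟩
  refine h.T_bijective_iff η (fun n => ?_) (fun n => ?_) n
  · exact h.res_bijective_of_base _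
      (aux _ _ _ _ (congrArg CoGrothendieck.Hom.base e) θ.hε h1 h2) n
  · exact h.res_bijective_of_base _
      (aux _ _ _ _ (congrArg CoGrothendieck.Hom.base eh) θ.hεh h1' h2') n

/-- The T-duality transformation is bijective for the restriction of the triple to `A`. -/
def GoodOn {X : GSpace} (D : TTriple 𝓣 X) (A : SubMulAction X.grp X.space) : Prop :=
  ∀ n, Function.Bijective (h.T (D.pull (X.incl A)) n)

/-- Pulling back along `g` and then restricting gives, up to isomorphism, the same total spaces as
restricting directly to `A`. -/
lemma goodOn_preimage {X Z : GSpace} (D : TTriple 𝓣 X) (g : Z ⟶ X) (hg : Topology.IsEmbedding g.f)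
    (hφ : IsHomeomorph g.φ) (A : SubMulAction X.grp X.space)
    (hA : (A : Set X.space) ⊆ Set.range g.f) :
    h.GoodOn (D.pull g) (GSpace.preimage g A) ↔ h.GoodOn D A := by
  refine forall_congr' fun n => ?_
  have hr : ∀ E : CircleBundle X, Set.range ((E.pullback g).pullbackMap
      (Z.incl (GSpace.preimage g A)) ≫ E.pullbackMap g).f = E.proj ⁻¹' A := by
    intro E
    ext e
    constructor
    · rintro ⟨p, rfl⟩
      have h1 : (Z.incl (GSpace.preimage g A)).f p.1.1 = p.1.2.1.1 := p.2
      change E.proj p.1.2.1.2 ∈ A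
      rw [← p.1.2.2, ← h1]
      exact p.1.1.2
    · intro he
      obtain ⟨z, hz⟩ := hA he
      exact ⟨⟨(⟨z, by change g.f z ∈ A; rw [hz]; exact he⟩, ⟨(z, e), hz⟩), rfl⟩, rfl⟩
  have hemb : ∀ E : CircleBundle X, Topology.IsEmbedding ((E.pullback g).pullbackMap
      (Z.incl (GSpace.preimage g A)) ≫ E.pullbackMap g).f := fun E =>
    (E.isEmbedding_pullbackMap hg).comp
      ((E.pullback g).isEmbedding_pullbackMap Topology.IsEmbedding.subtypeVal)
  exact h.T_bijective_pull_incl_iff A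
    (((D.pull g).pullHom (Z.incl (GSpace.preimage g A))).comp (D.pullHom g))
    (GSpace.restrict g _ A fun z hz => hz) rfl hφ
    (hemb D.pair.E) (hemb D.dual.E) (hr D.pair.E) (hr D.dual.E) n

lemma goodOn_sub {X : GSpace} (D : TTriple 𝓣 X) (A B : SubMulAction X.grp X.space) (hAB : A ≤ B) :
    h.GoodOn (D.pull (X.incl B)) (GSpace.preimage (X.incl B) A) ↔ h.GoodOn D A :=
  h.goodOn_preimage D (X.incl B) Topology.IsEmbedding.subtypeVal (Homeomorph.refl _).isHomeomorph A
    fun x hx => ⟨⟨x, hAB hx⟩, rfl⟩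

lemma goodOn_top {X : GSpace} (D : TTriple 𝓣 X) :
    h.GoodOn D ⊤ ↔ ∀ n, Function.Bijective (h.T D n) := by
  refine forall_congr' fun n => ?_
  have aux : ∀ E : CircleBundle X, IsIso (E.pullbackMap (X.incl ⊤)) := fun E =>
    GSpace.isIso_of_isHomeomorph _ (Homeomorph.refl _).isHomeomorph
      (isHomeomorph_iff_isEmbedding_surjective.mpr
        ⟨E.isEmbedding_pullbackMap Topology.IsEmbedding.subtypeVal, fun e =>
          ⟨⟨(⟨E.proj e, trivial⟩, e), rfl⟩, rfl⟩⟩)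
  exact h.T_bijective_iff (D.pullHom (X.incl ⊤)) (fun n => h.res_bijective_of_base _ (aux _) n)
    (fun n => h.res_bijective_of_base _ (aux _) n) n

lemma goodOn_sup {X : GSpace} (D : TTriple 𝓣 X) (U V : SubMulAction X.grp X.space)
    (hU : IsOpen (U : Set X.space)) (hV : IsOpen (V : Set X.space))
    (gU : h.GoodOn D U) (gV : h.GoodOn D V) (gUV : h.GoodOn D (U ⊓ V)) : h.GoodOn D (U ⊔ V) := by
  intro n
  refine h.T_bijective_of_cover _ (GSpace.preimage (X.incl (U ⊔ V)) U)
    (GSpace.preimage (X.incl (U ⊔ V)) V) (hU.preimage continuous_subtype_val)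
    (hV.preimage continuous_subtype_val) ?_ ((h.goodOn_sub D U _ le_sup_left).mpr gU)
    ((h.goodOn_sub D V _ le_sup_right).mpr gV)
    ((h.goodOn_sub D (U ⊓ V) _ (inf_le_left.trans le_sup_left)).mpr gUV) n
  ext x
  simp only [Set.mem_union, Set.mem_univ, iff_true]
  exact x.2

end TwistedTheory

/-! ### Equivariant transport between nearby fibers of a circle bundle -/

section Averaging

open MeasureTheory

variable {G : Type} [Group G] [TopologicalSpace G] [IsTopologicalGroup G] [CompactSpace G]
  [T2Space G]

/-- An invariant mean on the continuous complex valued functions on a compact group. -/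
lemma exists_invariant_mean : ∃ I : C(G, ℂ) → ℂ, Continuous I ∧
    (∀ (g : G) (φ : C(G, ℂ)), I (φ.comp (ContinuousMap.mulLeft g)) = I φ) ∧
    (∀ (c : ℂ) (φ : C(G, ℂ)), I (c • φ) = c * I φ) ∧
    ∀ φ : C(G, ℂ), (∀ g, ∃ r : ℝ, 0 < r ∧ φ g = r) → ∃ r : ℝ, 0 < r ∧ I φ = r := by
  borelize G
  let μ : Measure G := Measure.haar
  have hint : ∀ φ : C(G, ℂ), Integrable φ μ := fun φ =>
    φ.continuous.integrable_of_hasCompactSupport (HasCompactSupport.of_compactSpace _)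
  refine ⟨fun φ => ∫ g, φ g ∂μ, ?_, fun g φ => integral_mul_left_eq_self φ g,
    fun c φ => integral_const_mul c φ, fun φ hφ => ?_⟩
  -- Continuity for the sup norm, with the total mass as Lipschitz constant. It keeps averaged
  -- kernels continuous.
  · refine (LipschitzWith.of_dist_le_mul (K := (μ Set.univ).toNNReal) fun φ ψ => ?_).continuous
    rw [dist_eq_norm, ← integral_sub (hint φ) (hint ψ)]
    refine (norm_integral_le_of_norm_le_const (C := dist φ ψ)
      (Filter.Eventually.of_forall fun g => ?_)).trans (le_of_eq ?_)
    · rw [← dist_eq_norm]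
      exact ContinuousMap.dist_apply_le_dist g
    · rw [mul_comm]; rfl
  · have hre : ∀ g, φ g = ((φ g).re : ℂ) ∧ 0 < (φ g).re := fun g => by
      obtain ⟨r, hr, e⟩ := hφ g
      rw [e]; exact ⟨rfl, hr⟩
    have hc : Continuous fun g => (φ g).re := Complex.continuous_re.comp φ.continuous
    refine ⟨∫ g, (φ g).re ∂μ, ?_, ?_⟩
    · exact hc.integral_pos_of_hasCompactSupport_nonneg_nonzero
        (HasCompactSupport.of_compactSpace _) (fun g => (hre g).2.le) (x := 1) (hre 1).2.ne'
    · exact (integral_congr_ae (Filter.Eventually.of_forall fun g => (hre g).1)).trans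
        integral_ofReal

end Averaging

namespace CircleBundle

variable {X : GSpace} (E : CircleBundle X)

/-- Take a cutoff function times the circle coordinate of a local trivialization, extended by zero.
-/
lemma exists_local_coordinate [CompactSpace X.space] [T2Space X.space] (x : X.space) :
    ∃ f : C(E.total, ℂ), (∀ (z : Circle) v, f (z • v) = z * f v) ∧
      ∃ W : Set X.space, IsOpen W ∧ x ∈ W ∧ ∀ v, E.proj v ∈ W → f v ≠ 0 := by
  classical
  obtain ⟨U, hU, hx, e, he, hz⟩ := E.locally_trivial x
  obtain ⟨ρ, hρ, hρ1, -⟩ := exists_tsupport_one_of_isOpen_isClosed hU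
    (isClosed_closure.isCompact) (isClosed_singleton (x := x)) (Set.singleton_subset_iff.mpr hx)
  let f : E.total → ℂ := fun v =>
    if h : E.proj v ∈ U then (ρ (E.proj v) : ℂ) * ((e ⟨v, h⟩).2 : ℂ) else 0
  have hf1 : ∀ v (h : E.proj v ∈ U), f v = (ρ (E.proj v) : ℂ) * ((e ⟨v, h⟩).2 : ℂ) :=
    fun v h => dif_pos h
  have hf0 : ∀ v, ρ (E.proj v) = 0 → f v = 0 := fun v h => by
    by_cases hv : E.proj v ∈ U
    · rw [hf1 v hv, h]; simp
    · exact dif_neg hv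
  refine ⟨⟨f, continuous_iff_continuousAt.mpr fun v => ?_⟩, fun z v => ?_,
    {y | ρ y ≠ 0} ∩ U, (isOpen_ne.preimage ρ.continuous).inter hU, ⟨?_, hx⟩, fun v hv => ?_⟩
  · by_cases hv : E.proj v ∈ U
    · have hop : IsOpen {v | E.proj v ∈ U} := hU.preimage E.proj.continuous
      refine ContinuousOn.continuousAt (s := {v | E.proj v ∈ U}) ?_ (hop.mem_nhds hv)
      rw [continuousOn_iff_continuous_domRestrict]
      have : Set.domRestrict {v | E.proj v ∈ U} f = fun v => (ρ (E.proj v.1) : ℂ) * ((e v).2 : ℂ) :=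
        funext fun v => hf1 v.1 v.2
      rw [this]
      have h1 : Continuous fun v : {v | E.proj v ∈ U} => (ρ (E.proj v.1) : ℂ) := by fun_prop
      exact h1.mul (continuous_subtype_val.comp (continuous_snd.comp e.continuous))
    · have hv' : E.proj v ∉ tsupport ρ := fun h => hv (hρ h)
      have : f =ᶠ[nhds v] fun _ => 0 := by
        filter_upwards [E.proj.continuous.continuousAt
          ((isClosed_tsupport ρ).isOpen_compl.mem_nhds hv')] with w hw
        exact hf0 w (image_eq_zero_of_notMem_tsupport hw)
      exact continuousAt_const.congr this.symm
  · change f (z • v) = z * f v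
    by_cases hv : E.proj v ∈ U
    · have hv' : E.proj (z • v) ∈ U := by rw [E.proj_circle]; exact hv
      rw [hf1 _ hv', hf1 _ hv, hz z ⟨v, hv⟩, E.proj_circle, Circle.coe_mul]
      ring
    · have hv' : E.proj (z • v) ∉ U := by rw [E.proj_circle]; exact hv
      rw [show f (z • v) = 0 from dif_neg hv', show f v = 0 from dif_neg hv, mul_zero]
  · change ρ x ≠ 0
    rw [hρ1 rfl]; exact one_ne_zero
  · change f v ≠ 0
    rw [hf1 v hv.2]
    exact mul_ne_zero (Complex.ofReal_ne_zero.mpr hv.1) (Circle.coe_ne_zero _)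

/-- With local coordinates `f x` for a finite subcover, the sum of `conj (f x v) * f x w` has the
required weights for the circle, and it is positive on the diagonal because some `f x` is nonzero at
`v`. -/
lemma exists_kernel [CompactSpace X.space] [T2Space X.space] :
    ∃ F : C(E.total × E.total, ℂ), (∀ (z : Circle) v w, F (v, z • w) = z * F (v, w)) ∧
      (∀ (z : Circle) v w, F (z • v, w) = (z⁻¹ : Circle) * F (v, w)) ∧
      ∀ v, ∃ r : ℝ, 0 < r ∧ F (v, v) = r := by
  choose f hf W hW hx hfW using E.exists_local_coordinate
  obtain ⟨t, ht⟩ := isCompact_univ.elim_finite_subcover W hW fun x _ => Set.mem_iUnion.mpr ⟨x, hx x⟩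
  refine ⟨⟨fun p => ∑ x ∈ t, (starRingEnd ℂ) (f x p.1) * f x p.2, by fun_prop⟩,
    fun z v w => ?_, fun z v w => ?_, fun v => ⟨∑ x ∈ t, Complex.normSq (f x v), ?_, ?_⟩⟩
  · change ∑ x ∈ t, _ = _ * ∑ x ∈ t, _
    rw [Finset.mul_sum]
    exact Finset.sum_congr rfl fun x _ => by rw [hf]; ring
  · change ∑ x ∈ t, _ = _ * ∑ x ∈ t, _
    rw [Finset.mul_sum]
    refine Finset.sum_congr rfl fun x _ => ?_
    simp only [hf, map_mul, Circle.coe_inv_eq_conj]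
    ring
  · obtain ⟨x, hxt, hxv⟩ := Set.mem_iUnion₂.mp (ht (Set.mem_univ (E.proj v)))
    exact Finset.sum_pos' (fun x _ => Complex.normSq_nonneg _)
      ⟨x, hxt, Complex.normSq_pos.mpr (hfW x v hxv)⟩
  · change ∑ x ∈ t, _ = _
    rw [Complex.ofReal_sum]
    exact Finset.sum_congr rfl fun x _ => (Complex.normSq_eq_conj_mul_self).symm

/-- Average the kernel over diagonal translations by the group. Its values on the diagonal are
positive reals, so they cannot cancel. -/
lemma exists_invariant_kernel [CompactSpace X.space] [T2Space X.space] :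
    ∃ F : C(E.total × E.total, ℂ), (∀ (z : Circle) v w, F (v, z • w) = z * F (v, w)) ∧
      (∀ (z : Circle) v w, F (z • v, w) = (z⁻¹ : Circle) * F (v, w)) ∧
      (∀ (g : X.grp) v w, F (g • v, g • w) = F (v, w)) ∧
      ∀ v, ∃ r : ℝ, 0 < r ∧ F (v, v) = r := by
  obtain ⟨F, h1, h2, h3⟩ := E.exists_kernel
  obtain ⟨I, hI, i1, i2, i3⟩ := exists_invariant_mean (G := X.grp)
  let Φ : C((E.total × E.total) × X.grp, ℂ) :=
    F.comp ⟨fun p => (p.2⁻¹ • p.1.1, p.2⁻¹ • p.1.2), by fun_prop⟩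
  have hΦ : ∀ v w g, Φ.curry (v, w) g = F (g⁻¹ • v, g⁻¹ • w) := fun _ _ _ => rfl
  refine ⟨⟨fun p => I (Φ.curry p), hI.comp Φ.curry.continuous⟩, fun z v w => ?_,
    fun z v w => ?_, fun g v w => ?_, fun v => i3 _ fun g => h3 (g⁻¹ • v)⟩
  · refine Eq.trans (congrArg I (ContinuousMap.ext fun g => ?_)) (i2 _ _)
    change F (g⁻¹ • v, g⁻¹ • z • w) = z * F (g⁻¹ • v, g⁻¹ • w)
    rw [smul_comm, h1]
  · refine Eq.trans (congrArg I (ContinuousMap.ext fun g => ?_)) (i2 _ _)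
    change F (g⁻¹ • z • v, g⁻¹ • w) = _ * F (g⁻¹ • v, g⁻¹ • w)
    rw [smul_comm, h2]
  · refine Eq.trans (i1 g _).symm (congrArg I (ContinuousMap.ext fun k => ?_))
    change F ((g * k)⁻¹ • g • v, (g * k)⁻¹ • g • w) = F (k⁻¹ • v, k⁻¹ • w)
    simp only [mul_inv_rev, mul_smul, inv_smul_smul]

lemma exists_smul_of_proj_eq {v w : E.total} (h : E.proj v = E.proj w) :
    ∃ z : Circle, w = z • v := by
  obtain ⟨U, hU, hx, e, he, hz⟩ := E.locally_trivial (E.proj v)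
  let v' : {v // E.proj v ∈ U} := ⟨v, hx⟩
  let w' : {v // E.proj v ∈ U} := ⟨w, by rw [← h]; exact hx⟩
  refine ⟨(e w').2 * (e v').2⁻¹, ?_⟩
  have : w' = ⟨((e w').2 * (e v').2⁻¹) • v, by rw [E.proj_circle]; exact hx⟩ := by
    refine e.injective (Prod.ext (Subtype.ext ?_) ?_)
    · rw [he, he]
      exact h.symm.trans (E.proj_circle _ _).symm
    · exact ((hz _ v').trans (by group)).symm
  exact congrArg Subtype.val this

lemma isOpenQuotientMap_proj : IsOpenQuotientMap E.proj where
  surjective x := by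
    obtain ⟨U, hU, hx, e, he, hz⟩ := E.locally_trivial x
    refine ⟨(e.symm (⟨x, hx⟩, 1)).1, ?_⟩
    rw [← he, e.apply_symm_apply]
  continuous := E.proj.continuous
  isOpenMap := by
    rw [isOpenMap_iff_nhds_le]
    intro v
    obtain ⟨U, hU, hx, e, he, hz⟩ := E.locally_trivial (E.proj v)
    have hop : IsOpen {v | E.proj v ∈ U} := hU.preimage E.proj.continuous
    have h1 : IsOpenMap fun v : {v // E.proj v ∈ U} => E.proj v.1 := by
      have : (fun v : {v // E.proj v ∈ U} => E.proj v.1) = Subtype.val ∘ Prod.fst ∘ e :=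
        funext fun v => (he v).symm
      rw [this]
      exact hU.isOpenMap_subtype_val.comp (isOpenMap_fst.comp e.isOpenMap)
    have h2 := h1.nhds_le ⟨v, hx⟩
    refine h2.trans (le_of_eq ?_)
    change Filter.map (E.proj ∘ Subtype.val) _ = _
    rw [← Filter.map_map]
    exact congrArg _ (map_nhds_subtype_coe_eq_nhds (p := fun v => E.proj v ∈ U) hx
      (hop.mem_nhds hx))

/-- The phase of a complex number. -/
def phase (c : ℂ) : Circle :=
  if h : c = 0 then 1 else
    ⟨c / ‖c‖, show _ ∈ Submonoid.unitSphere ℂ from mem_sphere_zero_iff_norm.mpr (by simp [h])⟩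

lemma coe_phase {c : ℂ} (h : c ≠ 0) : (phase c : ℂ) = c / ‖c‖ :=
  congrArg Subtype.val (dif_neg h : phase c = _)

lemma phase_mul (z : Circle) {c : ℂ} (h : c ≠ 0) : phase (z * c) = z * phase c := by
  refine Subtype.ext ?_
  rw [Circle.coe_mul, coe_phase h, coe_phase (mul_ne_zero z.coe_ne_zero h), norm_mul,
    Circle.norm_coe, one_mul, mul_div_assoc]

lemma phase_ofReal {r : ℝ} (h : 0 < r) : phase (r : ℂ) = 1 := by
  have h' : (r : ℂ) ≠ 0 := Complex.ofReal_ne_zero.mpr h.ne'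
  refine Subtype.ext ?_
  rw [coe_phase h', Complex.norm_real, Real.norm_of_nonneg h.le, div_self h']
  rfl

lemma continuousAt_phase {c : ℂ} (h : c ≠ 0) : ContinuousAt phase c := by
  have hi : Topology.IsInducing ((↑) : Circle → ℂ) := ⟨rfl⟩
  refine hi.continuousAt_iff.mpr ?_
  have h1 : ContinuousAt (fun c : ℂ => c / (‖c‖ : ℂ)) c :=
    continuousAt_id.div (by fun_prop) (by simpa using h)
  refine h1.congr ?_
  filter_upwards [isOpen_ne.mem_nhds h] with d hd using (coe_phase hd).symm

/-- An equivariant parallel transport between nearby fibers. -/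
lemma exists_transport [CompactSpace X.space] [T2Space X.space] :
    ∃ (N : Set (X.space × X.space)) (τ : E.total × X.space → E.total), IsOpen N ∧
      (∀ x, (x, x) ∈ N) ∧ (∀ p, E.proj (τ p) = p.2) ∧ (∀ v, τ (v, E.proj v) = v) ∧
      (∀ v y, (E.proj v, y) ∈ N → ContinuousAt τ (v, y)) ∧
      ∀ (g : X.grp) v y, (E.proj v, y) ∈ N → τ (g • v, g • y) = g • τ (v, y) := by
  obtain ⟨F, F1, F2, F3, F4⟩ := E.exists_invariant_kernel
  have hq := E.isOpenQuotientMap_proj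
  -- Only a set-theoretic section: nonvanishing of `F` and, where `F` does not vanish, the value of
  -- `t` do not depend on the chosen points of the fibers.
  choose s hs using hq.surjective
  have hF : ∀ v w, F (v, w) ≠ 0 ↔ F (s (E.proj v), s (E.proj w)) ≠ 0 := by
    intro v w
    obtain ⟨z, hz⟩ := E.exists_smul_of_proj_eq (hs (E.proj v)).symm
    obtain ⟨z', hz'⟩ := E.exists_smul_of_proj_eq (hs (E.proj w)).symm
    rw [hz, hz', F1, F2, mul_ne_zero_iff, mul_ne_zero_iff]
    simp [Circle.coe_ne_zero]
  -- `t (v, w)` rotates `w` until `F (v, ·)` is positive, hence depends only on the fiber of `w` and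
  -- descends to `E × X`. Where `F` vanishes, the default value of `phase` merely keeps the result
  -- in the right fiber.
  let t : E.total × E.total → E.total := fun p => (phase (F p))⁻¹ • p.2
  have ht : ∀ v w w', E.proj w = E.proj w' → F (v, w) ≠ 0 → t (v, w) = t (v, w') := by
    intro v w w' h hw
    obtain ⟨z, rfl⟩ := E.exists_smul_of_proj_eq h
    change _ = (phase (F (v, z • w)))⁻¹ • z • w
    rw [F1, phase_mul z hw, mul_inv_rev, mul_smul, inv_smul_smul]
  have hN : ∀ v y, (E.proj v, y) ∈ {p : X.space × X.space | F (s p.1, s p.2) ≠ 0} →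
      F (v, s y) ≠ 0 := fun v y h => by
    rw [hF, hs]; exact h
  refine ⟨{p | F (s p.1, s p.2) ≠ 0}, fun p => t (p.1, s p.2), ?_, fun x => ?_, fun p => ?_,
    fun v => ?_, fun v y h => ?_, fun g v y h => ?_⟩
  · rw [← (hq.prodMap hq).isQuotientMap.isOpen_preimage]
    have : Prod.map E.proj E.proj ⁻¹' {p | F (s p.1, s p.2) ≠ 0} = {p | F p ≠ 0} :=
      Set.ext fun p => (hF p.1 p.2).symm
    rw [this]
    exact isOpen_ne.preimage F.continuous
  · obtain ⟨r, hr, e⟩ := F4 (s x)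
    change F (s x, s x) ≠ 0
    rw [e]
    exact Complex.ofReal_ne_zero.mpr hr.ne'
  · exact (E.proj_circle _ _).trans (hs _)
  · obtain ⟨r, hr, e⟩ := F4 v
    have h0 : F (v, v) ≠ 0 := by rw [e]; exact Complex.ofReal_ne_zero.mpr hr.ne'
    refine (ht v v _ (hs _).symm h0).symm.trans ?_
    change (phase (F (v, v)))⁻¹ • v = v
    rw [e, phase_ofReal hr, inv_one, one_smul]
  · have hF0 := hN v y h
    have h1 : ContinuousAt t (v, s y) :=
      (((continuousAt_phase hF0).comp F.continuous.continuousAt).inv).smul continuousAt_snd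
    have h2 : (fun p : E.total × X.space => t (p.1, s p.2)) ∘ Prod.map id E.proj
        =ᶠ[nhds (v, s y)] t := by
      filter_upwards [(isOpen_ne.preimage F.continuous).mem_nhds hF0] with p hp
      exact (ht p.1 p.2 _ (hs _).symm hp).symm
    -- Continuity is tested along an open quotient map, on `E × E`, where the composite agrees with
    -- `t` near the point.
    have h3 := (IsOpenQuotientMap.id.prodMap hq).continuousAt_comp_iff.mp (h1.congr h2.symm)
    change ContinuousAt _ (v, E.proj (s y)) at h3
    rw [hs] at h3
    exact h3
  · have hF0 := hN v y h
    have h1 : F (g • v, g • s y) ≠ 0 := by rw [F3]; exact hF0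
    refine (ht _ _ _ ?_ h1).symm.trans ?_
    · rw [E.proj_smul, hs, hs]
    · change (phase (F (g • v, g • s y)))⁻¹ • g • s y = g • (phase (F (v, s y)))⁻¹ • s y
      rw [F3, smul_comm g]

end CircleBundle

/-! ### Lifting equivariant homotopies by small steps -/

open unitInterval

/-- Steps of length at most `1 / (n + 1)` along the paths of `K` stay in `N`. -/
def IsFine {W Y : Type} (N : Set (Y × Y)) (K : W × I → Y) (n : ℕ) : Prop :=
  ∀ (w : W) (s t : I), |(s : ℝ) - t| ≤ 1 / (n + 1) → (K (w, s), K (w, t)) ∈ N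

/-- A Lebesgue number argument: on the compact set of `(z, s, t)` whose pair of points leaves `N`,
the distance `|s - t|` has a minimum, positive because `N` contains the diagonal. -/
lemma exists_isFine {Z Y : Type} [TopologicalSpace Z] [CompactSpace Z] [TopologicalSpace Y]
    (N : Set (Y × Y)) (hN : IsOpen N) (hd : ∀ y, (y, y) ∈ N) (κ : C(Z × I, Y)) :
    ∃ n, IsFine N κ n := by
  let m : Z × I × I → Y × Y := fun q => (κ (q.1, q.2.1), κ (q.1, q.2.2))
  have hm : Continuous m := by fun_prop
  have hC : IsCompact (m ⁻¹' Nᶜ) := (hN.isClosed_compl.preimage hm).isCompact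
  rcases (m ⁻¹' Nᶜ).eq_empty_or_nonempty with he | hne
  · refine ⟨0, fun w s t _ => ?_⟩
    by_contra hc
    exact he.le (show (w, s, t) ∈ m ⁻¹' Nᶜ from hc)
  · obtain ⟨q, hq, hmin⟩ := hC.exists_isMinOn hne
      (f := fun q : Z × I × I => |(q.2.1 : ℝ) - q.2.2|) (by fun_prop)
    have hpos : 0 < |(q.2.1 : ℝ) - q.2.2| := by
      refine abs_pos.mpr (sub_ne_zero.mpr fun h => hq ?_)
      change (κ (q.1, q.2.1), κ (q.1, q.2.2)) ∈ N
      rw [Subtype.ext h]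
      exact hd _
    obtain ⟨n, hn⟩ := exists_nat_one_div_lt hpos
    refine ⟨n, fun w s t hst => ?_⟩
    by_contra hc
    have := hmin (show (w, s, t) ∈ m ⁻¹' Nᶜ from hc)
    exact absurd (hn.trans_le this) (not_lt.mpr hst)

namespace CircleBundle

variable {X : GSpace} (E : CircleBundle X)

/-- Transport in `n + 1` steps. Stage `k` lifts the homotopy stopped at time `c k`, so each stage is
defined on the whole interval and nothing has to be glued. -/
lemma exists_lift_homotopy {N : Set (X.space × X.space)} {τ : E.total × X.space → E.total}
    (h1 : ∀ p, E.proj (τ p) = p.2) (h2 : ∀ v, τ (v, E.proj v) = v)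
    (h3 : ∀ v y, (E.proj v, y) ∈ N → ContinuousAt τ (v, y))
    (h4 : ∀ (g : X.grp) v y, (E.proj v, y) ∈ N → τ (g • v, g • y) = g • τ (v, y))
    {W : GSpace} (q : W ⟶ E.toGSpace) (K : C(W.space × I, X.space))
    (φ : W.grp → X.grp) (hq : ∀ g w, q.f (g • w) = φ g • (q.f w : E.total))
    (K0 : ∀ w, K (w, 0) = E.proj (q.f w))
    (hK : ∀ (g : W.grp) w t, K (g • w, t) = φ g • K (w, t))
    {n : ℕ} (hn : IsFine N K n) :
    ∃ L : C(W.space × I, E.total), (∀ w t, E.proj (L (w, t)) = K (w, t)) ∧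
      (∀ w, L (w, 0) = q.f w) ∧ ∀ (g : W.grp) w t, L (g • w, t) = φ g • L (w, t) := by
  let c : ℕ → I := fun k => Set.projIcc 0 1 zero_le_one ((k : ℝ) / (n + 1))
  -- Stopping at consecutive subdivision points changes the time by at most one step, as `min` and
  -- `max` are 1-Lipschitz.
  have hc : ∀ k (t : I), |((min t (c k) : I) : ℝ) - (min t (c (k + 1)) : I)| ≤ 1 / (n + 1) := by
    intro k t
    have hpos : (0 : ℝ) < n + 1 := by positivity
    have e1 : ((min t (c k) : I) : ℝ) = min (t : ℝ) (max 0 (min 1 ((k : ℝ) / (n + 1)))) := rfl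
    have e2 : ((min t (c (k + 1)) : I) : ℝ) =
      min (t : ℝ) (max 0 (min 1 ((k : ℝ) / (n + 1) + 1 / (n + 1)))) := by
      rw [← add_div, ← Nat.cast_add_one]; rfl
    have hd : (0 : ℝ) < 1 / (n + 1) := by positivity
    rw [e1, e2]
    refine (abs_min_sub_min_le_max _ _ _ _).trans ?_
    rw [sub_self, abs_zero]
    refine max_le hd.le ((abs_max_sub_max_le_max _ _ _ _).trans ?_)
    rw [sub_self, abs_zero]
    refine max_le hd.le ((abs_min_sub_min_le_max _ _ _ _).trans ?_)
    rw [sub_self, abs_zero]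
    refine max_le hd.le ?_
    rw [sub_add_cancel_left, abs_neg, abs_of_pos hd]
  have key : ∀ k : ℕ, ∃ L : C(W.space × I, E.total),
      (∀ w t, E.proj (L (w, t)) = K (w, min t (c k))) ∧
      (∀ w, L (w, 0) = q.f w) ∧ ∀ (g : W.grp) w t, L (g • w, t) = φ g • L (w, t) := by
    intro k
    induction k with
    | zero =>
      have hc0 : c 0 = 0 := by
        change Set.projIcc (0 : ℝ) 1 zero_le_one (((0 : ℕ) : ℝ) / (n + 1)) = 0
        rw [Nat.cast_zero, zero_div]
        exact Set.projIcc_left _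
      refine ⟨⟨fun p => q.f p.1, by fun_prop⟩, fun w t => ?_, fun w => rfl,
        fun g w t => hq g w⟩
      rw [hc0, min_eq_right (show (0 : I) ≤ t from t.2.1), K0]
      rfl
    | succ k ih =>
      obtain ⟨L, L1, L2, L3⟩ := ih
      have hm : ∀ w t, (E.proj (L (w, t)), K (w, min t (c (k + 1)))) ∈ N := fun w t => by
        rw [L1]
        exact hn w _ _ (hc k t)
      refine ⟨⟨fun p => τ (L p, K (p.1, min p.2 (c (k + 1)))), ?_⟩, fun w t => h1 _,
        fun w => ?_, fun g w t => ?_⟩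
      · refine continuous_iff_continuousAt.mpr fun p => ?_
        exact ContinuousAt.comp (f := fun p : W.space × I => (L p, K (p.1, min p.2 (c (k + 1)))))
          (h3 _ _ (hm p.1 p.2)) (by fun_prop)
      · change τ (L (w, 0), K (w, min 0 (c (k + 1)))) = _
        have e : K (w, min 0 (c (k + 1))) = E.proj (L (w, 0)) := by
          rw [L1, min_eq_left (show (0 : I) ≤ _ from (c (k + 1)).2.1),
            min_eq_left (show (0 : I) ≤ _ from (c k).2.1)]
        rw [e, h2, L2]
      · change τ (L (g • w, t), K (g • w, _)) = _
        rw [L3, hK]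
        exact h4 _ _ _ (hm w t)
  obtain ⟨L, L1, L2, L3⟩ := key (n + 1)
  refine ⟨L, fun w t => ?_, L2, L3⟩
  have hc1 : c (n + 1) = 1 := by
    change Set.projIcc (0 : ℝ) 1 zero_le_one (((n + 1 : ℕ) : ℝ) / (n + 1)) = 1
    rw [Nat.cast_add_one, div_self (by positivity)]
    exact Set.projIcc_right _
  rw [L1, hc1, min_eq_left (show t ≤ 1 from t.2.2)]

end CircleBundle

/-! ### Equivariant deformations -/

namespace GSpace

/-- An equivariant deformation of the invariant subspace `A` of `X` into `B`, preserving `B`. -/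
structure Deformation (X : GSpace) (A B : SubMulAction X.grp X.space) where
  K : C(A × I, X.space)
  zero : ∀ a, K (a, 0) = a
  smul : ∀ (g : X.grp) a t, K (g • a, t) = g • K (a, t)
  mem : ∀ a t, K (a, t) ∈ A
  one_mem : ∀ a, K (a, 1) ∈ B
  mem_of_mem : ∀ (a : A), (a : X.space) ∈ B → ∀ t, K (a, t) ∈ B
  fine : ∀ N : Set (X.space × X.space), IsOpen N → (∀ x, (x, x) ∈ N) → ∃ n, IsFine N K n

/-- The formula is given on a compact space `Z` whose image contains `A`. It descends because `p ×
id` is a closed map, and so is its restriction over `A`, which is thus a quotient map. `A` need not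
be compact, so fineness is proved on `Z`. -/
lemma exists_deformation {X : GSpace} [T2Space X.space] {A B : SubMulAction X.grp X.space}
    {Z : Type} [TopologicalSpace Z] [CompactSpace Z] (p : C(Z, X.space))
    (hA : (A : Set X.space) ⊆ Set.range p) (κ : C(Z × I, X.space)) (zero : ∀ z, κ (z, 0) = p z)
    (smul : ∀ (g : X.grp) z z', p z ∈ A → p z' = g • p z → ∀ t, κ (z', t) = g • κ (z, t))
    (mem : ∀ z t, p z ∈ A → κ (z, t) ∈ A) (one_mem : ∀ z, p z ∈ A → κ (z, 1) ∈ B)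
    (mem_of_mem : ∀ z t, p z ∈ A → p z ∈ B → κ (z, t) ∈ B) : Nonempty (X.Deformation A B) := by
  choose s hs using fun a : A => hA a.2
  have hs' : ∀ a, p (s a) ∈ A := fun a => by rw [hs]; exact a.2
  -- Equivariance for `g = 1` says that `κ` depends only on `p z`.
  have hwd : ∀ (a : A) z, p z = a → ∀ t, κ (s a, t) = κ (z, t) := fun a z hz t => by
    refine (smul 1 z (s a) (by rw [hz]; exact a.2) ?_ t).trans (one_smul _ _)
    rw [one_smul, hs, hz]
  have hcl : IsClosedMap (Prod.map p (id : I → I)) :=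
    (p.continuous.prodMap continuous_id).isClosedMap
  have hq := (hcl.restrictPreimage {x : X.space × I | x.1 ∈ A}).isQuotientMap
    ((p.continuous.prodMap continuous_id).restrictPreimage) (by
      rintro ⟨⟨x, t⟩, hx⟩
      obtain ⟨z, hz⟩ := hA hx
      refine ⟨⟨(z, t), ?_⟩, Subtype.ext (Prod.ext hz rfl)⟩
      change p z ∈ A
      rw [hz]
      exact hx)
  have hcont : Continuous fun y : {x : X.space × I | x.1 ∈ A} => κ (s ⟨y.1.1, y.2⟩, y.1.2) := by
    refine hq.continuous_iff.mpr ?_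
    have : ((fun y : {x : X.space × I | x.1 ∈ A} => κ (s ⟨y.1.1, y.2⟩, y.1.2)) ∘
        Set.restrictPreimage {x : X.space × I | x.1 ∈ A} (Prod.map p (id : I → I))) =
        fun z => κ z.1 := funext fun z => hwd _ z.1.1 rfl z.1.2
    rw [this]
    fun_prop
  refine ⟨⟨⟨fun y => κ (s y.1, y.2), ?_⟩, fun a => (zero _).trans (hs a),
    fun g a t => smul g _ _ (hs' a) ?_ t, fun a t => mem _ t (hs' a), fun a => one_mem _ (hs' a),
    fun a ha t => mem_of_mem _ t (hs' a) (by rw [hs]; exact ha), fun N hN hd => ?_⟩⟩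
  · exact hcont.comp (g := fun y : {x : X.space × I | x.1 ∈ A} => κ (s ⟨y.1.1, y.2⟩, y.1.2))
      (f := fun y : A × I => ⟨(y.1, y.2), y.1.2⟩) (by fun_prop)
  · rw [hs, hs]; rfl
  · obtain ⟨n, hn⟩ := exists_isFine N hN hd κ
    exact ⟨n, fun a => hn (s a)⟩

lemma Homotopic.symm {X Y : GSpace} {f g : Y ⟶ X} (h : Homotopic f g) : Homotopic g f := by
  obtain ⟨h1, F, hF⟩ := h
  exact ⟨h1.symm, F.symm, fun t k y => by rw [← h1]; exact hF _ k y⟩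

end GSpace

/-- Lift the deformation to `E`, starting at the inclusion. The end of the lift is the inverse `k`
and the lift itself gives both homotopies; over `B` it stays over `B` by `mem_of_mem`. -/
lemma CircleBundle.exists_homotopyInverse {X : GSpace} [CompactSpace X.space] [T2Space X.space]
    (E : CircleBundle X) {A B : SubMulAction X.grp X.space} (d : X.Deformation A B)
    (j : (E.pullback (X.incl B)).toGSpace ⟶ (E.pullback (X.incl A)).toGSpace)
    (hj : j ≫ E.pullbackMap (X.incl A) = E.pullbackMap (X.incl B)) :
    ∃ k, GSpace.Homotopic (k ≫ j) (𝟙 (E.pullback (X.incl A)).toGSpace) ∧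
      GSpace.Homotopic (j ≫ k) (𝟙 (E.pullback (X.incl B)).toGSpace) := by
  obtain ⟨N, τ, hN, hd, h1, h2, h3, h4⟩ := E.exists_transport
  obtain ⟨n, hn⟩ := d.fine N hN hd
  let πA : C(PullbackTotal (X.incl A) E, A) := (E.pullback (X.incl A)).proj
  obtain ⟨L, L1, L2, L3⟩ := E.exists_lift_homotopy h1 h2 h3 h4 (E.pullbackMap (X.incl A))
    (d.K.comp (πA.prodMap (ContinuousMap.id I))) id
    (fun _ _ => rfl) (fun w => (d.zero _).trans w.2)
    (fun g w t => d.smul g _ t) (n := n) (fun w => hn (πA w))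
  have L1' : ∀ w t, E.proj (L (w, t)) = d.K (w.1.1, t) := L1
  have hL : Continuous L := L.continuous
  have hjf : ∀ w, (j.f w).1.2 = w.1.2 := GSpace.congr_f hj
  have hjb : ∀ w, ((j.f w).1.1 : X.space) = w.1.1 := fun w =>
    ((j.f w).2.trans (congrArg E.proj (hjf w))).trans w.2.symm
  have hjφ : ∀ g, j.φ g = g := GSpace.congr_φ hj
  refine ⟨⟨ContinuousMonoidHom.id _, ⟨fun w => ⟨(⟨d.K (w.1.1, 1), d.one_mem _⟩, L (w, 1)),
    (L1' w 1).symm⟩, ?_⟩, fun g w => ?_⟩, ?_, ?_⟩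
  · refine Continuous.subtype_mk (Continuous.prodMk (Continuous.subtype_mk ?_ _) ?_) _
    · exact d.K.continuous.comp (πA.continuous.prodMk continuous_const)
    · exact hL.comp (continuous_id.prodMk continuous_const)
  · exact Subtype.ext (Prod.ext (Subtype.ext (d.smul g _ _)) (L3 g w 1))
  · refine GSpace.Homotopic.symm ⟨?_, ⟨⟨⟨fun q => ⟨(⟨d.K (q.2.1.1, q.1), d.mem _ _⟩, L (q.2, q.1)),
      (L1' _ _).symm⟩, ?_⟩, fun w => ?_, fun w => ?_⟩, fun t g w => ?_⟩⟩
    · exact ContinuousMonoidHom.ext fun g => (hjφ g).symm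
    · refine Continuous.subtype_mk (Continuous.prodMk (Continuous.subtype_mk ?_ _) ?_) _
      · exact d.K.continuous.comp ((πA.continuous.comp continuous_snd).prodMk continuous_fst)
      · exact hL.comp continuous_swap
    · exact Subtype.ext (Prod.ext (Subtype.ext (d.zero _)) (L2 w))
    · refine Subtype.ext (Prod.ext (Subtype.ext ?_) ?_)
      · exact (hjb ⟨(⟨d.K (w.1.1, 1), d.one_mem _⟩, L (w, 1)), (L1' w 1).symm⟩).symm
      · exact (hjf ⟨(⟨d.K (w.1.1, 1), d.one_mem _⟩, L (w, 1)), (L1' w 1).symm⟩).symm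
    · exact Subtype.ext (Prod.ext (Subtype.ext (d.smul g _ _)) (L3 g w t))
  · have hB : ∀ (w : PullbackTotal (X.incl B) E) t, d.K ((j.f w).1.1, t) ∈ B := fun w t =>
      d.mem_of_mem _ ((hjb w).symm ▸ w.1.1.2) t
    have hjc : Continuous j.f := j.f.continuous
    refine GSpace.Homotopic.symm ⟨?_, ⟨⟨⟨fun q => ⟨(⟨d.K ((j.f q.2).1.1, q.1), hB _ _⟩,
      L (j.f q.2, q.1)), (L1' _ _).symm⟩, ?_⟩, fun w => ?_, fun w => ?_⟩, fun t g w => ?_⟩⟩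
    · exact ContinuousMonoidHom.ext fun g => (hjφ g).symm
    · refine Continuous.subtype_mk (Continuous.prodMk (Continuous.subtype_mk ?_ _) ?_) _
      · exact d.K.continuous.comp
          ((πA.continuous.comp (hjc.comp continuous_snd)).prodMk continuous_fst)
      · exact hL.comp ((hjc.comp continuous_snd).prodMk continuous_fst)
    · exact Subtype.ext (Prod.ext (Subtype.ext ((d.zero _).trans (hjb w)))
        ((L2 _).trans (hjf w)))
    · exact Subtype.ext (Prod.ext (Subtype.ext rfl) rfl)
    · have e : j.f ((pullbackAction (X.incl B) E).smul g w) =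
          (pullbackAction (X.incl A) E).smul g (j.f w) :=
        (j.equivariant g w).trans (congrArg
          (fun k => (pullbackAction (X.incl A) E).smul k (j.f w)) (hjφ g))
      refine Subtype.ext (Prod.ext (Subtype.ext ?_) ?_)
      · exact (congrArg (fun x : PullbackTotal (X.incl A) E => d.K (x.1.1, t)) e).trans
          (d.smul g _ _)
      · exact (congrArg (fun x : PullbackTotal (X.incl A) E => L (x, t)) e).trans (L3 g _ t)

namespace TwistedTheory

variable (h : TwistedTheory.{v, u, w} 𝓣)

lemma goodOn_iff_of_deformation {X : GSpace} [CompactSpace X.space] [T2Space X.space]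
    (D : TTriple 𝓣 X) {A B : SubMulAction X.grp X.space} (hBA : B ≤ A) (d : X.Deformation A B) :
    h.GoodOn D B ↔ h.GoodOn D A := by
  obtain ⟨η, -, e, eh⟩ := (D.pullHom (X.incl B)).exists_lift (X.incl A) (X.inclOfLE hBA) rfl
  have aux : ∀ (E : CircleBundle X) (Q : 𝓣.Tw (E.pullback (X.incl B)).toGSpace)
      (P : 𝓣.Tw (E.pullback (X.incl A)).toGSpace) (ψ : tri _ Q ⟶ tri _ P),
      ψ.base ≫ E.pullbackMap (X.incl A) = E.pullbackMap (X.incl B) →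
      ∀ n, Function.Bijective (h.res ψ n) := by
    intro E Q P ψ hψ n
    obtain ⟨k, h1, h2⟩ := E.exists_homotopyInverse d ψ.base hψ
    exact h.res_bijective_of_homotopyEquiv ψ.base k h1 h2 ψ rfl n
  exact forall_congr' fun n => h.T_bijective_iff η
    (aux _ _ _ η.ε (congrArg CoGrothendieck.Hom.base e))
    (aux _ _ _ η.εh (congrArg CoGrothendieck.Hom.base eh)) n

end TwistedTheory

/-! ### Orbits and induction from stabilizers -/

namespace CircleBundle

variable {X : GSpace} (E : CircleBundle X)

/-- Needed so that continuous bijections from compact induced spaces onto total spaces are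
homeomorphisms. -/
lemma t2Space_total [T2Space X.space] : T2Space E.total := by
  refine ⟨fun v w hvw => ?_⟩
  by_cases h : E.proj v = E.proj w
  · obtain ⟨U, hU, hx, e, he, hz⟩ := E.locally_trivial (E.proj v)
    have hop : IsOpen {v | E.proj v ∈ U} := hU.preimage E.proj.continuous
    have : T2Space {v // E.proj v ∈ U} := e.symm.t2Space
    exact separated_by_isOpenEmbedding (X := {v // E.proj v ∈ U})
      (x := ⟨v, hx⟩) (y := ⟨w, by rw [← h]; exact hx⟩) hop.isOpenEmbedding_subtypeVal
      (fun e => hvw (congrArg Subtype.val e))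
  · exact separated_by_continuous E.proj.continuous h

lemma compactSpace_total_of_subsingleton [Subsingleton X.space] [Nonempty X.space] :
    CompactSpace E.total := by
  obtain ⟨v, -⟩ := E.isOpenQuotientMap_proj.surjective (Classical.arbitrary X.space)
  have : Function.Surjective fun z : Circle => z • v := fun w => by
    obtain ⟨z, hz⟩ := E.exists_smul_of_proj_eq (Subsingleton.elim (E.proj v) (E.proj w))
    exact ⟨z, hz.symm⟩
  exact this.compactSpace (by fun_prop)

end CircleBundle

namespace GSpace

variable {Z : GSpace} [T2Space Z.space] (H : Subgroup Z.grp) (hH : IsClosed (H : Set Z.grp))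
  {W : Type} [TopologicalSpace W] [CompactSpace W] [MulAction H W] [ContinuousSMul H W]
  (m : ofClosed H hH W ⟶ Z)

instance : CompactSpace (IndSpace H W) := inferInstanceAs (CompactSpace (Quotient _))

/-- The map `G ×_H W → Z` induced by an equivariant map `W → Z`. -/
def indDesc (hφ : ∀ g : H, m.φ g = g) : ind H W ⟶ Z where
  φ := ContinuousMonoidHom.id _
  f := ⟨Quotient.lift (fun p : Z.grp × W => p.1 • m.f p.2) (by
      rintro p q ⟨g, rfl⟩
      have := m.equivariant g p.2
      change _ = (p.1 * (g : Z.grp)⁻¹) • m.f (g • p.2)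
      rw [this, hφ, smul_smul, inv_mul_cancel_right]),
    Continuous.quotient_lift
      (continuous_fst.smul (m.f.continuous.comp (continuous_snd (X := Z.grp)))) _⟩
  equivariant := by
    rintro (g : Z.grp) ⟨p⟩
    exact mul_smul g p.1 (m.f p.2)

/-- If two translates of the image of `W` meet, `h1` puts the quotient of the translating elements
in `H`, which gives injectivity. A continuous bijection from a compact to a Hausdorff space is a
homeomorphism. -/
lemma isIso_indDesc (hφ : ∀ g : H, m.φ g = g) (hm : Function.Injective m.f)
    (h1 : ∀ (g : Z.grp) w w', g • m.f w = m.f w' → g ∈ H)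
    (h2 : ∀ z, ∃ (g : Z.grp) (w : W), g • m.f w = z) : IsIso (indDesc H hH m hφ) := by
  refine isIso_of_isHomeomorph _ (Homeomorph.refl _).isHomeomorph
    (isHomeomorph_iff_continuous_bijective.mpr ⟨(indDesc H hH m hφ).f.continuous, ?_, fun z => ?_⟩)
  · rintro ⟨⟨g, w⟩⟩ ⟨⟨g', w'⟩⟩ e
    change g • m.f w = g' • m.f w' at e
    have e' : (g'⁻¹ * g) • m.f w = m.f w' := by rw [mul_smul, e, inv_smul_smul]
    refine Quotient.sound (s := indSetoid H W) ⟨⟨g'⁻¹ * g, h1 _ _ _ e'⟩, Prod.ext ?_ (hm ?_)⟩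
    · simp
    · refine e'.symm.trans (Eq.symm ?_)
      refine (m.equivariant (⟨g'⁻¹ * g, h1 _ _ _ e'⟩ : H) w).trans ?_
      rw [hφ]
  · obtain ⟨g, w, e⟩ := h2 z
    exact ⟨Quotient.mk _ (g, w), e⟩

end GSpace

namespace TwistedTheory

variable (h : TwistedTheory.{v, u, w} 𝓣)

lemma res_bijective_of_induced {Z : GSpace} [T2Space Z.space] (H : Subgroup Z.grp)
    (hH : IsClosed (H : Set Z.grp)) {W : Type} [TopologicalSpace W] [CompactSpace W]
    [MulAction H W] [ContinuousSMul H W] (m : GSpace.ofClosed H hH W ⟶ Z)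
    (hφ : ∀ g : H, m.φ g = g) (hm : Function.Injective m.f)
    (h1 : ∀ (g : Z.grp) w w', g • m.f w = m.f w' → g ∈ H)
    (h2 : ∀ z, ∃ (g : Z.grp) (w : W), g • m.f w = z)
    {Q : 𝓣.Tw (GSpace.ofClosed H hH W)} {P : 𝓣.Tw Z} (ψ : tri _ Q ⟶ tri _ P) (hψ : ψ.base = m)
    (n : ℤ) : Function.Bijective (h.res ψ n) := by
  have hiso := GSpace.isIso_indDesc H hH m hφ hm h1 h2
  have hfac : GSpace.toInd H hH W ≫ GSpace.indDesc H hH m hφ = ψ.base := by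
    rw [hψ]
    exact GSpace.hom_ext (ContinuousMonoidHom.ext fun g => (hφ g).symm)
      (ContinuousMap.ext fun w => one_smul _ _)
  obtain ⟨χ, hχ, rfl⟩ := exists_fac (lift (GSpace.indDesc H hH m hφ) P) ψ _ hfac
  obtain ⟨ξ, hξ, rfl⟩ := exists_fac (lift (GSpace.toInd H hH W) _) χ (𝟙 _)
    (by rw [hχ]; exact Category.id_comp _)
  have e : ⇑(h.res ((ξ ≫ lift (GSpace.toInd H hH W) _) ≫ lift (GSpace.indDesc H hH m hφ) P) n) =
      (h.res ξ n ∘ h.res (lift (GSpace.toInd H hH W) _) n) ∘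
        h.res (lift (GSpace.indDesc H hH m hφ) P) n :=
    funext fun x => (h.res_comp _ _ n x).trans (h.res_comp _ _ n _)
  rw [e]
  have b1 : Function.Bijective (h.res ξ n) :=
    h.res_bijective_of_base ξ (by rw [hξ]; infer_instance) n
  have b2 : Function.Bijective (h.res (lift (GSpace.indDesc H hH m hφ) P) n) :=
    h.res_bijective_of_base _ hiso n
  exact (b1.comp (h.induction Z.grp H hH W _ n)).comp b2

/-- The inclusion of a point, equivariant for its stabilizer. -/
def pointMap {Y : GSpace} (y : Y.space) (hH : IsClosed (MulAction.stabilizer Y.grp y : Set Y.grp)) :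
    GSpace.point (MulAction.stabilizer Y.grp y) hH ⟶ Y where
  φ := ⟨(MulAction.stabilizer Y.grp y).subtype, continuous_subtype_val⟩
  f := ⟨fun _ => y, continuous_const⟩
  equivariant g _ := (MulAction.mem_stabilizer_iff.mp g.2).symm

/-- A circle bundle over an orbit is induced from its fiber over `y` with the action of the
stabilizer. By the induction axiom, restriction to this fiber is bijective on both sides of `T`, and
over the point admissibility applies. -/
lemma T_bijective_of_transitive {Y : GSpace} [T2Space Y.space] (hadm : h.IsTAdmissible Y.grp)
    (y : Y.space) (hy : ∀ y', ∃ g : Y.grp, g • y = y') (D : TTriple 𝓣 Y) (n : ℤ) :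
    Function.Bijective (h.T D n) := by
  have hH : IsClosed (MulAction.stabilizer Y.grp y : Set Y.grp) :=
    isClosed_eq (f := fun g : Y.grp => g • y) (by fun_prop) continuous_const
  have aux : ∀ (E : CircleBundle Y) (P : 𝓣.Tw E.toGSpace) (n : ℤ),
      Function.Bijective (h.res (lift (E.pullbackMap (pointMap y hH)) P) n) := by
    intro E P n
    have : T2Space E.total := E.t2Space_total
    have : Nonempty (GSpace.point (MulAction.stabilizer Y.grp y) hH).space := ⟨PUnit.unit⟩
    have : Subsingleton (GSpace.point (MulAction.stabilizer Y.grp y) hH).space :=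
      inferInstanceAs (Subsingleton PUnit)
    have : CompactSpace (PullbackTotal (pointMap y hH) E) :=
      (E.pullback (pointMap y hH)).compactSpace_total_of_subsingleton
    refine @res_bijective_of_induced _ h E.toGSpace _ (MulAction.stabilizer Y.grp y) hH
      (PullbackTotal (pointMap y hH) E) _ _ (pullbackAction (pointMap y hH) E)
      (pullbackContAction (pointMap y hH) E) (E.pullbackMap (pointMap y hH)) (fun g => rfl)
      ?_ ?_ ?_ _ P _ rfl n
    · intro p q e
      exact Subtype.ext (Prod.ext rfl e)
    · intro (g : Y.grp) p q e
      have e' : E.proj (g • p.1.2) = E.proj q.1.2 := congrArg E.proj e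
      have h1 : y = E.proj p.1.2 := p.2
      have h2 : y = E.proj q.1.2 := q.2
      rw [E.proj_smul, ← h1, ← h2] at e'
      exact e'
    · intro v
      obtain ⟨g, hg⟩ := hy (E.proj v)
      refine ⟨g, ⟨(PUnit.unit, g⁻¹ • v), ?_⟩, smul_inv_smul g v⟩
      rw [E.proj_smul, ← hg, inv_smul_smul]
      rfl
  exact (h.T_bijective_iff (D.pullHom (pointMap y hH)) (aux _ _) (aux _ _) n).mp
    ((h.isIso_transform_iff _ n).mp (hadm _ hH _ n))

lemma goodOn_of_orbit {X : GSpace} [T2Space X.space] (hadm : h.IsTAdmissible X.grp)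
    (D : TTriple 𝓣 X) (A : SubMulAction X.grp X.space) (x : X.space) (hx : x ∈ A)
    (hA : ∀ y ∈ A, ∃ g : X.grp, g • x = y) : h.GoodOn D A := fun n =>
  h.T_bijective_of_transitive (Y := X.sub A) hadm ⟨x, hx⟩ (fun y => by
    obtain ⟨g, hg⟩ := hA y.1 y.2
    exact ⟨g, Subtype.ext hg⟩) _ n

end TwistedTheory

/-! ### The empty space -/

namespace TwistedTheory

variable (h : TwistedTheory.{v, u, w} 𝓣)

/-- Over the empty space, the projection from the product with the circle is an isomorphism.
Exactness then makes push-forward zero, but it is also surjective. -/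
lemma subsingleton_of_isEmpty (Z : GSpace) [IsEmpty Z.space] (P : 𝓣.Tw Z) (n : ℤ) :
    Subsingleton ((h.h n).obj (op (tri Z P))) := by
  have : IsEmpty (CircleBundle.product Z).total :=
    inferInstanceAs (IsEmpty (Z.space × Circle))
  have hiso : IsIso (CircleBundle.product Z).π :=
    GSpace.isIso_of_isHomeomorph _ (Homeomorph.refl _).isHomeomorph
      ⟨(CircleBundle.product Z).π.f.continuous, fun U _ => isOpen_discrete _,
        fun v => isEmptyElim v, fun z => isEmptyElim z⟩
  have hs := (h.res_bijective_of_base (lift (CircleBundle.product Z).π P) hiso (n + 1)).2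
  refine subsingleton_of_forall_eq 0 fun y => ?_
  obtain ⟨x, rfl⟩ := h.suspension_surjective Z P n y
  exact (h.suspension_exact Z P n x).mpr (hs x)

lemma T_bijective_of_isEmpty {X : GSpace} [IsEmpty X.space] (D : TTriple 𝓣 X) (n : ℤ) :
    Function.Bijective (h.T D n) := by
  have h1 : IsEmpty D.pair.E.total := ⟨fun v => isEmptyElim (D.pair.E.proj v)⟩
  have h2 : IsEmpty D.dual.E.total := ⟨fun v => isEmptyElim (D.dual.E.proj v)⟩
  have := h.subsingleton_of_isEmpty D.pair.E.toGSpace D.pair.P (n + 1)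
  have := h.subsingleton_of_isEmpty D.dual.E.toGSpace D.dual.P n
  exact ⟨Function.injective_of_subsingleton _, fun y => ⟨0, Subsingleton.elim _ _⟩⟩

lemma goodOn_bot {X : GSpace} (D : TTriple 𝓣 X) : h.GoodOn D ⊥ := by
  have : IsEmpty (X.sub ⊥).space := ⟨fun x => x.2⟩
  exact h.T_bijective_of_isEmpty _

end TwistedTheory

/-! ### Attaching one equivariant cell -/

lemma continuous_sum_prod {A B T Y : Type} [TopologicalSpace A] [TopologicalSpace B]
    [TopologicalSpace T] [TopologicalSpace Y] {f : A × T → Y} {g : B × T → Y}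
    (hf : Continuous f) (hg : Continuous g) : Continuous fun z : (A ⊕ B) × T =>
      Sum.elim (fun a => f (a, z.2)) (fun b => g (b, z.2)) z.1 := by
  have : (fun z : (A ⊕ B) × T => Sum.elim (fun a => f (a, z.2)) (fun b => g (b, z.2)) z.1) =
      Sum.elim f g ∘ Homeomorph.sumProdDistrib := by
    funext ⟨z, t⟩
    rcases z with a | b <;> rfl
  rw [this]
  exact (hf.sumElim hg).comp Homeomorph.sumProdDistrib.continuous

/-- The radial deformation of a disk without its center to its boundary. -/
lemma exists_radial {V : Type} [NormedAddCommGroup V] [NormedSpace ℝ V] {δ : ℝ} (hδ : 0 < δ)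
    (hδ1 : δ ≤ 1) : ∃ μ : C(Metric.closedBall (0 : V) 1 × I, Metric.closedBall (0 : V) 1),
      (∀ y, μ (y, 0) = y) ∧ (∀ y t, ‖y.1‖ = 1 → μ (y, t) = y) ∧
      (∀ y, δ < ‖y.1‖ → ‖(μ (y, 1)).1‖ = 1) ∧
      ∀ y t, δ < ‖y.1‖ → ∃ r : ℝ, 1 ≤ r ∧ (μ (y, t)).1 = r • y.1 := by
  -- Scaling by the inverse of `‖y‖` goes to the sphere; the `max` with `δ` keeps it continuous at
  -- the center. The factor moves linearly from `1` to this inverse.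
  let ρ : V → I → ℝ := fun y t => 1 - (t : ℝ) + t * (max ‖y‖ δ)⁻¹
  have hρ0 : ∀ y t, 0 ≤ ρ y t := fun y t =>
    add_nonneg (sub_nonneg.mpr t.2.2) (mul_nonneg t.2.1 (by positivity))
  have hρ1 : ∀ y t, ‖y‖ ≤ 1 → ρ y t * ‖y‖ ≤ 1 := fun y t hy => by
    have h1 : (max ‖y‖ δ)⁻¹ * ‖y‖ ≤ 1 := by
      rw [inv_mul_le_one₀ (lt_max_of_lt_right hδ)]
      exact le_max_left _ _
    change (1 - (t : ℝ) + t * (max ‖y‖ δ)⁻¹) * ‖y‖ ≤ 1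
    rw [add_mul, mul_assoc]
    exact (add_le_add (mul_le_of_le_one_right (sub_nonneg.mpr t.2.2) hy)
      (mul_le_of_le_one_right t.2.1 h1)).trans_eq (by ring)
  have hρ : Continuous fun q : V × I => ρ q.1 q.2 := by
    have : Continuous fun q : V × I => (max ‖q.1‖ δ)⁻¹ :=
      Continuous.inv₀ (by fun_prop) fun q => (lt_max_of_lt_right hδ).ne'
    fun_prop
  refine ⟨⟨fun q => ⟨ρ q.1.1 q.2 • q.1.1, ?_⟩, ?_⟩, fun y => Subtype.ext ?_,
    fun y t hy => Subtype.ext ?_, fun y hy => ?_, fun y t hy => ⟨ρ y.1 t, ?_, rfl⟩⟩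
  · rw [mem_closedBall_zero_iff, norm_smul, Real.norm_of_nonneg (hρ0 _ _)]
    exact hρ1 _ _ (mem_closedBall_zero_iff.mp q.1.2)
  · refine Continuous.subtype_mk (Continuous.smul ?_ (by fun_prop)) _
    exact hρ.comp (f := fun q : Metric.closedBall (0 : V) 1 × I => (q.1.1, q.2)) (by fun_prop)
  · change (1 - ((0 : I) : ℝ) + ((0 : I) : ℝ) * (max ‖y.1‖ δ)⁻¹) • y.1 = y.1
    simp
  · change (1 - (t : ℝ) + t * (max ‖y.1‖ δ)⁻¹) • y.1 = y.1
    rw [hy, max_eq_left hδ1, inv_one, mul_one, sub_add_cancel, one_smul]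
  · change ‖ρ y.1 1 • y.1‖ = 1
    rw [norm_smul, Real.norm_of_nonneg (hρ0 _ _)]
    change (1 - ((1 : I) : ℝ) + ((1 : I) : ℝ) * (max ‖y.1‖ δ)⁻¹) * ‖y.1‖ = 1
    rw [max_eq_left hy.le, Set.Icc.coe_one, sub_self, zero_add, one_mul,
      inv_mul_cancel₀ (hδ.trans hy).ne']
  · have h1 : 1 ≤ (max ‖y.1‖ δ)⁻¹ := by
      rw [max_eq_left hy.le]
      exact (one_le_inv₀ (hδ.trans hy)).mpr (mem_closedBall_zero_iff.mp y.2)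
    have := mul_le_mul_of_nonneg_left h1 t.2.1
    change 1 ≤ 1 - (t : ℝ) + t * (max ‖y.1‖ δ)⁻¹
    linarith

namespace GSpace

/-- A presentation of `X` as obtained from a closed invariant subspace `A` by attaching an
equivariant cell. -/
structure TopCell (X : GSpace) (A : SubMulAction X.grp X.space) where
  dim : ℕ
  stab : Subgroup X.grp
  char : C((X.grp ⧸ stab) × Metric.closedBall (0 : EuclideanSpace ℝ (Fin dim)) 1, X.space)
  char_smul : ∀ (g : X.grp) q y, char (g • q, y) = g • char (q, y)
  isClosed : IsClosed (A : Set X.space)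
  cover : ∀ x, x ∈ A ∨ ∃ p, char p = x
  boundary : ∀ p, ‖p.2.1‖ = 1 → char p ∈ A
  disjoint : ∀ p, ‖p.2.1‖ < 1 → char p ∉ A
  inj : ∀ p p', ‖p.2.1‖ < 1 → ‖p'.2.1‖ < 1 → char p = char p' → p = p'

namespace TopCell

variable {X : GSpace} {A : SubMulAction X.grp X.space} (c : X.TopCell A)

/-- The product of the orbit and the closed disk. -/
abbrev Cell : Type := (X.grp ⧸ c.stab) × Metric.closedBall (0 : EuclideanSpace ℝ (Fin c.dim)) 1

/-- The part of the cell over a subset of the disk. -/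
def image (S : Set (EuclideanSpace ℝ (Fin c.dim))) : SubMulAction X.grp X.space where
  carrier := {x | ∃ p, p.2.1 ∈ S ∧ c.char p = x}
  smul_mem' := by
    rintro g _ ⟨p, hp, rfl⟩
    exact ⟨(g • p.1, p.2), hp, c.char_smul g p.1 p.2⟩

lemma norm_le (p : c.Cell) : ‖p.2.1‖ ≤ 1 := mem_closedBall_zero_iff.mp p.2.2

lemma norm_eq_one {p} (hp : c.char p ∈ A) : ‖p.2.1‖ = 1 :=
  le_antisymm (c.norm_le p) (not_lt.mp fun h => c.disjoint p h hp)

/-- Interior points have distinct images, and a boundary point lands in `A`, which an interior point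
avoids. -/
lemma eq_of_norm_lt {p p'} (hp : ‖p.2.1‖ < 1) (e : c.char p = c.char p') : p = p' := by
  refine c.inj p p' hp (lt_of_le_of_ne (c.norm_le p') fun h => ?_) e
  exact c.disjoint p hp (e ▸ c.boundary p' h)

variable {S : Set (EuclideanSpace ℝ (Fin c.dim))}

lemma char_mem_image (hS : S ⊆ Metric.ball 0 1) {p} : c.char p ∈ c.image S ↔ p.2.1 ∈ S := by
  refine ⟨?_, fun h => ⟨p, h, rfl⟩⟩
  rintro ⟨p', hp', e⟩
  rwa [c.eq_of_norm_lt (mem_ball_zero_iff.mp (hS hp')) e] at hp'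

lemma notMem_image (hS : S ⊆ Metric.ball 0 1) {x} (hx : x ∈ A) : x ∉ c.image S := by
  rintro ⟨p, hp, rfl⟩
  exact c.disjoint p (mem_ball_zero_iff.mp (hS hp)) hx

variable [T2Space X.space]

lemma isClosed_image (hS : IsClosed S) : IsClosed (c.image S : Set X.space) := by
  have : (c.image S : Set X.space) = c.char '' {p | p.2.1 ∈ S} := rfl
  rw [this]
  exact ((hS.preimage (by fun_prop)).isCompact.image c.char.continuous).isClosed

/-- The complement is the union of the closed set `A` and the compact image of the rest of the
closed disk. -/
lemma isOpen_image (hS : IsOpen S) (hS' : S ⊆ Metric.ball 0 1) :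
    IsOpen (c.image S : Set X.space) := by
  have : (c.image S : Set X.space) = ((A : Set X.space) ∪ c.image Sᶜ)ᶜ := by
    ext x
    constructor
    · rintro ⟨p, hp, rfl⟩ (h | ⟨p', hp', e⟩)
      · exact c.notMem_image hS' h ⟨p, hp, rfl⟩
      · rw [← c.eq_of_norm_lt (mem_ball_zero_iff.mp (hS' hp)) e.symm] at hp'
        exact hp' hp
    · intro hx
      rcases c.cover x with h | ⟨p, rfl⟩
      · exact absurd (Or.inl h) hx
      · by_cases hp : p.2.1 ∈ S
        · exact ⟨p, hp, rfl⟩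
        · exact absurd (Or.inr ⟨p, hp, rfl⟩) hx
  rw [this]
  exact (c.isClosed.union (c.isClosed_image hS.isClosed_compl)).isOpen_compl

/-- Contraction of a convex part of the cell to an orbit. -/
lemma exists_deformation_of_convex (hS : Convex ℝ S) (hS' : S ⊆ Metric.ball 0 1)
    {x : EuclideanSpace ℝ (Fin c.dim)} (hx : x ∈ S) :
    Nonempty (X.Deformation (c.image S) (c.image {x})) := by
  have hx1 : x ∈ Metric.closedBall (0 : EuclideanSpace ℝ (Fin c.dim)) 1 :=
    Metric.ball_subset_closedBall (hS' hx)
  have hconv : ∀ T : Set (EuclideanSpace ℝ (Fin c.dim)), Convex ℝ T → x ∈ T → ∀ y ∈ T, ∀ t : I,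
      (1 - (t : ℝ)) • y + (t : ℝ) • x ∈ T := fun T hT hxT y hy t =>
    hT hy hxT (sub_nonneg.mpr t.2.2) t.2.1 (by ring)
  have hx' : ({x} : Set (EuclideanSpace ℝ (Fin c.dim))) ⊆ Metric.ball 0 1 :=
    Set.singleton_subset_iff.mpr (hS' hx)
  let μ : Metric.closedBall (0 : EuclideanSpace ℝ (Fin c.dim)) 1 → I →
      Metric.closedBall (0 : EuclideanSpace ℝ (Fin c.dim)) 1 := fun y t =>
    ⟨(1 - (t : ℝ)) • y.1 + (t : ℝ) • x, hconv _ (convex_closedBall _ _) hx1 y.1 y.2 t⟩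
  refine exists_deformation c.char ?_ ⟨fun z => c.char (z.1.1, μ z.1.2 z.2), ?_⟩ (fun z => ?_)
    (fun g z z' hz e t => ?_) (fun z t hz => ?_) (fun z hz => ?_) (fun z t hz hz' => ?_)
  · rintro _ ⟨p, -, rfl⟩
    exact ⟨p, rfl⟩
  · refine c.char.continuous.comp (Continuous.prodMk (by fun_prop) (Continuous.subtype_mk ?_ _))
    fun_prop
  · refine congrArg c.char (Prod.ext rfl (Subtype.ext ?_))
    simp [μ]
  · have hz1 := mem_ball_zero_iff.mp (hS' ((c.char_mem_image hS').mp hz))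
    have e' : (g • z.1, z.2) = z' := c.eq_of_norm_lt hz1 ((c.char_smul g z.1 z.2).trans e.symm)
    rw [← e']
    exact c.char_smul _ _ _
  · exact ⟨_, hconv S hS hx _ ((c.char_mem_image hS').mp hz) t, rfl⟩
  · exact ⟨_, by simp [μ], rfl⟩
  · have : z.2.1 = x := (c.char_mem_image hx').mp hz'
    refine ⟨_, ?_, rfl⟩
    change (1 - (t : ℝ)) • z.2.1 + (t : ℝ) • x = x
    rw [this, ← add_smul, sub_add_cancel, one_smul]

/-- The cube of points of the disk with small coordinates. -/
def cube : Set (EuclideanSpace ℝ (Fin c.dim)) := {y | ∀ i, |y i| ≤ 1 / (c.dim + 1)}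

omit [T2Space X.space] in
lemma cube_subset : c.cube ⊆ Metric.ball 0 1 := by
  intro y hy
  rw [mem_ball_zero_iff, ← sq_lt_one_iff₀ (norm_nonneg y), EuclideanSpace.norm_sq_eq]
  -- With `n = dim`, the squared norm is at most `n / (n + 1) ^ 2 < 1`, also for `n = 0`.
  have h1 : ∑ i, ‖y i‖ ^ 2 ≤ ∑ _i : Fin c.dim, (1 / ((c.dim : ℝ) + 1)) ^ 2 :=
    Finset.sum_le_sum fun i _ => pow_le_pow_left₀ (norm_nonneg _) (hy i) 2
  refine h1.trans_lt ?_
  rw [Finset.sum_const, Finset.card_univ, Fintype.card_fin, nsmul_eq_mul, div_pow, one_pow,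
    mul_one_div, div_lt_one (by positivity)]
  have : (0 : ℝ) ≤ c.dim := Nat.cast_nonneg _
  nlinarith

/-- The complement of the small cube in the cell. -/
def outside : SubMulAction X.grp X.space where
  carrier := (c.image c.cube : Set X.space)ᶜ
  smul_mem' g x hx h := hx (by
    have := (c.image c.cube).smul_mem g⁻¹ h
    rwa [inv_smul_smul] at this)

lemma isOpen_outside : IsOpen (c.outside : Set X.space) := by
  refine (c.isClosed_image ?_).isOpen_compl
  simp only [cube, Set.ofPred_forall]
  exact isClosed_iInter fun i => isClosed_le (by fun_prop) continuous_const

omit [T2Space X.space] in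
lemma char_mem_outside {p} : c.char p ∈ c.outside ↔ ∃ i, 1 / ((c.dim : ℝ) + 1) < |p.2.1 i| := by
  have : c.char p ∈ c.outside ↔ ¬ p.2.1 ∈ c.cube := not_congr (c.char_mem_image c.cube_subset)
  rw [this]
  simp [cube]

omit [T2Space X.space] in
lemma le_outside : A ≤ c.outside := fun _ hx => c.notMem_image c.cube_subset hx

/-- Radial deformation of the complement of the small cube onto `A`. -/
lemma exists_deformation_outside [CompactSpace X.space] :
    Nonempty (X.Deformation c.outside A) := by
  have : CompactSpace A := isCompact_iff_compactSpace.mp c.isClosed.isCompact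
  -- The constant of the cube: a point outside has a coordinate, hence a norm, larger than `δ`.
  let δ : ℝ := 1 / ((c.dim : ℝ) + 1)
  obtain ⟨μ, μ0, hμ1, μ1, hμ⟩ := exists_radial (V := EuclideanSpace ℝ (Fin c.dim)) (δ := δ)
    (by positivity) (div_le_one_of_le₀ (by simp) (by positivity))
  have hout : ∀ p, c.char p ∈ c.outside → δ < ‖p.2.1‖ := fun p hp => by
    obtain ⟨i, hi⟩ := c.char_mem_outside.mp hp
    exact hi.trans_le (PiLp.norm_apply_le p.2.1 i)
  -- A compact space mapping onto `X`; the deformation is constant on the first summand.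
  let P : C(A ⊕ c.Cell, X.space) :=
    ⟨Sum.elim Subtype.val c.char, continuous_subtype_val.sumElim c.char.continuous⟩
  let κ : C((A ⊕ c.Cell) × I, X.space) :=
    ⟨fun z => Sum.elim (fun a => a.1) (fun q => c.char (q.1, μ (q.2, z.2))) z.1,
      continuous_sum_prod (f := fun q : A × I => q.1.1)
        (g := fun q : c.Cell × I => c.char (q.1.1, μ (q.1.2, q.2))) (by fun_prop) (by fun_prop)⟩
  have hfix : ∀ z t, P z ∈ A → κ (z, t) = P z := by
    rintro (a | ⟨q, y⟩) t hz
    · rfl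
    · exact congrArg c.char (Prod.ext rfl (hμ1 y t (c.norm_eq_one (p := (q, y)) hz)))
  refine exists_deformation P ?_ κ (fun z => ?_) (fun g z z' hz e t => ?_)
    (fun z t hz => ?_) (fun z hz => ?_) (fun z t hz hz' => ?_)
  · intro x _
    rcases c.cover x with h | ⟨p, rfl⟩
    · exact ⟨Sum.inl ⟨x, h⟩, rfl⟩
    · exact ⟨Sum.inr p, rfl⟩
  · rcases z with a | ⟨q, y⟩
    · rfl
    · exact congrArg c.char (Prod.ext rfl (μ0 y))
  · change P z' = g • P z at e
    -- Over `A` nothing moves. Off `A` both points are interior to the cell, so one is literally the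
    -- translate of the other.
    by_cases hA : P z ∈ A
    · rw [hfix z t hA, hfix z' t (e ▸ A.smul_mem g hA), e]
    · have hA' : P z' ∉ A := fun h => hA (by
        have := A.smul_mem g⁻¹ h
        rwa [e, inv_smul_smul] at this)
      rcases z with a | ⟨q, y⟩
      · exact absurd a.2 hA
      rcases z' with a | ⟨q', y'⟩
      · exact absurd a.2 hA'
      have hy : ‖y.1‖ < 1 := lt_of_le_of_ne (c.norm_le (q, y)) fun h => hA (c.boundary (q, y) h)
      have e' : (g • q, y) = (q', y') :=
        c.eq_of_norm_lt hy ((c.char_smul g q y).trans e.symm)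
      obtain ⟨rfl, rfl⟩ := Prod.ext_iff.mp e'
      exact c.char_smul g q _
  · rcases z with a | ⟨q, y⟩
    · exact hz
    · obtain ⟨i, hi⟩ := (c.char_mem_outside (p := (q, y))).mp hz
      -- The flow scales by a factor of at least `1`, so a large coordinate stays large.
      obtain ⟨r, hr, e⟩ := hμ y t (hout (q, y) hz)
      refine (c.char_mem_outside (p := (q, μ (y, t)))).mpr ⟨i, hi.trans_le ?_⟩
      change |y.1 i| ≤ |(μ (y, t)).1 i|
      rw [e]
      change |y.1 i| ≤ |r * y.1 i|
      rw [abs_mul]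
      exact le_mul_of_one_le_left (abs_nonneg _) (hr.trans (le_abs_self r))
  · rcases z with a | ⟨q, y⟩
    · exact a.2
    · exact c.boundary _ (μ1 y (hout (q, y) hz))
  · exact (hfix z t hz').symm ▸ hz'

end TopCell

end GSpace

namespace TwistedTheory

open GSpace

variable (h : TwistedTheory.{v, u, w} 𝓣) {X : GSpace} [T2Space X.space]
  {A : SubMulAction X.grp X.space} (c : X.TopCell A) (D : TTriple 𝓣 X)

include c in
-- A nonempty convex set contracts to any of its points, over which the cell is a single orbit.
lemma goodOn_image_of_convex [CompactSpace X.space] (hadm : h.IsTAdmissible X.grp)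
    {S : Set (EuclideanSpace ℝ (Fin c.dim))}
    (hS : Convex ℝ S) (hS' : S ⊆ Metric.ball 0 1) : h.GoodOn D (c.image S) := by
  rcases S.eq_empty_or_nonempty with rfl | ⟨x, hx⟩
  · have : c.image ∅ = ⊥ := bot_unique fun x ⟨_, hp, _⟩ => hp.elim
    rw [this]
    exact h.goodOn_bot D
  · obtain ⟨d⟩ := c.exists_deformation_of_convex hS hS' hx
    have hle : c.image {x} ≤ c.image S := by
      rintro _ ⟨p, hp, rfl⟩
      exact ⟨p, (Set.mem_singleton_iff.mp hp).symm ▸ hx, rfl⟩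
    refine (h.goodOn_iff_of_deformation D hle d).mp (h.goodOn_of_orbit hadm D _
      (c.char (QuotientGroup.mk 1, ⟨x, Metric.ball_subset_closedBall (hS' hx)⟩))
      ⟨_, Set.mem_singleton x, rfl⟩ ?_)
    rintro _ ⟨⟨q, y⟩, hy, rfl⟩
    obtain ⟨g, rfl⟩ := QuotientGroup.mk_surjective q
    refine ⟨g, (c.char_smul _ _ _).symm.trans (congrArg c.char (Prod.ext ?_ (Subtype.ext hy.symm)))⟩
    exact congrArg QuotientGroup.mk (mul_one g)

include c in
-- Induction on the number of convex sets. The new one meets the union of the others in a union of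
-- fewer convex sets, but from another family, so the induction generalizes over `C`.
lemma goodOn_image_iUnion [CompactSpace X.space] (hadm : h.IsTAdmissible X.grp) {ι : Type}
    (s : Finset ι) (C : ι → Set (EuclideanSpace ℝ (Fin c.dim))) (h1 : ∀ i, Convex ℝ (C i))
    (h2 : ∀ i, IsOpen (C i)) (h3 : ∀ i, C i ⊆ Metric.ball 0 1) :
    h.GoodOn D (c.image (⋃ i ∈ s, C i)) := by
  classical
  induction s using Finset.induction_on generalizing C with
  | empty =>
    exact h.goodOn_image_of_convex c D hadm (by simpa using convex_empty) (by simp)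
  | insert a s ha ih =>
    have hsub : (⋃ i ∈ s, C i) ⊆ Metric.ball 0 1 := Set.iUnion₂_subset fun i _ => h3 i
    have e : c.image (⋃ i ∈ insert a s, C i) = c.image (C a) ⊔ c.image (⋃ i ∈ s, C i) := by
      rw [Finset.set_biUnion_insert]
      ext x
      constructor
      · rintro ⟨p, hp | hp, rfl⟩
        · exact Or.inl ⟨p, hp, rfl⟩
        · exact Or.inr ⟨p, hp, rfl⟩
      · rintro (⟨p, hp, rfl⟩ | ⟨p, hp, rfl⟩)
        · exact ⟨p, Or.inl hp, rfl⟩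
        · exact ⟨p, Or.inr hp, rfl⟩
    have e' : c.image (C a) ⊓ c.image (⋃ i ∈ s, C i) = c.image (⋃ i ∈ s, C a ∩ C i) := by
      rw [← Set.inter_iUnion₂]
      ext x
      constructor
      · rintro ⟨⟨p, hp, rfl⟩, hp'⟩
        exact ⟨p, ⟨hp, (c.char_mem_image hsub).mp hp'⟩, rfl⟩
      · rintro ⟨p, hp, rfl⟩
        exact ⟨⟨p, hp.1, rfl⟩, ⟨p, hp.2, rfl⟩⟩
    rw [e]
    refine h.goodOn_sup D _ _ (c.isOpen_image (h2 a) (h3 a))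
      (c.isOpen_image (isOpen_biUnion fun i _ => h2 i) hsub)
      (h.goodOn_image_of_convex c D hadm (h1 a) (h3 a)) (ih C h1 h2 h3) ?_
    rw [e']
    exact ih _ (fun i => (h1 a).inter (h1 i)) (fun i => (h2 a).inter (h2 i))
      fun i => Set.inter_subset_left.trans (h3 a)

include c in
/-- Attaching a cell. -/
lemma goodOn_top_of_topCell [CompactSpace X.space] (hadm : h.IsTAdmissible X.grp)
    (hA : h.GoodOn D A) : h.GoodOn D ⊤ := by
  obtain ⟨d⟩ := c.exists_deformation_outside
  have gU : h.GoodOn D c.outside := (h.goodOn_iff_of_deformation D c.le_outside d).mp hA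
  have gV := h.goodOn_image_of_convex c D hadm (convex_ball 0 1) subset_rfl
  -- Outside the cube some coordinate exceeds the bound in absolute value. This gives `2 * dim` open
  -- half spaces, so the overlap of the two open sets is a finite union of convex open pieces.
  let C : Fin c.dim ⊕ Fin c.dim → Set (EuclideanSpace ℝ (Fin c.dim)) := Sum.elim
    (fun i => {y | 1 / ((c.dim : ℝ) + 1) < y i}) (fun i => {y | 1 / ((c.dim : ℝ) + 1) < -y i})
  have hlin : ∀ i, IsLinearMap ℝ fun y : EuclideanSpace ℝ (Fin c.dim) => y i :=
    fun i => ⟨fun _ _ => rfl, fun _ _ => rfl⟩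
  have hlin' : ∀ i, IsLinearMap ℝ fun y : EuclideanSpace ℝ (Fin c.dim) => -y i :=
    fun i => ⟨fun _ _ => neg_add _ _, fun _ _ => (mul_neg _ _).symm⟩
  have gUV := h.goodOn_image_iUnion c D hadm Finset.univ (fun i => C i ∩ Metric.ball 0 1)
    (by
      rintro (i | i)
      · exact (convex_halfSpace_gt (hlin i) _).inter (convex_ball 0 1)
      · exact (convex_halfSpace_gt (hlin' i) _).inter (convex_ball 0 1))
    (by
      rintro (i | i)
      · exact (isOpen_lt continuous_const (by fun_prop)).inter Metric.isOpen_ball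
      · exact (isOpen_lt continuous_const (by fun_prop)).inter Metric.isOpen_ball)
    (fun i => Set.inter_subset_right)
  have e : c.outside ⊓ c.image (Metric.ball 0 1) =
      c.image (⋃ i ∈ Finset.univ, C i ∩ Metric.ball 0 1) := by
    ext x
    constructor
    · rintro ⟨hx, p, hp, rfl⟩
      obtain ⟨i, hi⟩ := c.char_mem_outside.mp hx
      refine ⟨p, ?_, rfl⟩
      rcases lt_abs.mp hi with hi | hi
      · exact Set.mem_iUnion₂.mpr ⟨Sum.inl i, Finset.mem_univ _, hi, hp⟩
      · exact Set.mem_iUnion₂.mpr ⟨Sum.inr i, Finset.mem_univ _, hi, hp⟩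
    · rintro ⟨p, hp, rfl⟩
      obtain ⟨i, -, hi, hp⟩ := Set.mem_iUnion₂.mp hp
      refine ⟨c.char_mem_outside.mpr ?_, p, hp, rfl⟩
      rcases i with i | i
      · exact ⟨i, lt_abs.mpr (Or.inl hi)⟩
      · exact ⟨i, lt_abs.mpr (Or.inr hi)⟩
  have e' : c.outside ⊔ c.image (Metric.ball 0 1) = ⊤ := by
    refine top_unique fun x _ => ?_
    by_cases hx : x ∈ c.outside
    · exact Or.inl hx
    · obtain ⟨p, hp, rfl⟩ := not_not.mp hx
      exact Or.inr ⟨p, c.cube_subset hp, rfl⟩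
  rw [← e']
  exact h.goodOn_sup D _ _ c.isOpen_outside (c.isOpen_image Metric.isOpen_ball subset_rfl) gU gV
    (e ▸ gUV)

end TwistedTheory

/-! ### Induction over the cells -/

namespace FiniteGCW

variable {G X : Type} [Group G] [TopologicalSpace G] [IsTopologicalGroup G] [CompactSpace G]
    [T2Space G] [TopologicalSpace X] [MulAction G X] [ContinuousSMul G X] (s : FiniteGCW G X)

/-- The union of a set of closed cells. -/
def cells (S : Finset s.ι) : SubMulAction G X where
  carrier := ⋃ j ∈ S, Set.range (s.char j)
  smul_mem' g x hx := by
    obtain ⟨j, hj, ⟨q, y⟩, rfl⟩ := Set.mem_iUnion₂.mp hx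
    exact Set.mem_iUnion₂.mpr ⟨j, hj, (g • q, y), s.char_smul j g q y⟩

omit [CompactSpace G] [T2Space G] [ContinuousSMul G X] [IsTopologicalGroup G] in
lemma char_mem_cells {S : Finset s.ι} {j : s.ι} (hj : j ∈ S) (p) : s.char j p ∈ s.cells S :=
  Set.mem_iUnion₂.mpr ⟨j, hj, p, rfl⟩

omit [IsTopologicalGroup G] [T2Space G] [ContinuousSMul G X] in
lemma isClosed_cells (S : Finset s.ι) : IsClosed (s.cells S : Set X) :=
  have := s.t2
  S.finite_toSet.isClosed_biUnion fun j _ => (isCompact_range (s.char j).continuous).isClosed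

omit [IsTopologicalGroup G] [CompactSpace G] [T2Space G] [ContinuousSMul G X] in
lemma cells_univ [Fintype s.ι] : s.cells Finset.univ = ⊤ :=
  top_unique fun x _ => by
    obtain ⟨⟨j, p⟩, ⟨-, rfl⟩, -⟩ := s.open_cells x
    exact s.char_mem_cells (Finset.mem_univ j) p

include s in
omit [IsTopologicalGroup G] [T2Space G] [ContinuousSMul G X] in
lemma compactSpace : CompactSpace X := by
  have := s.finite
  have := Fintype.ofFinite s.ι
  refine ⟨?_⟩
  have : (Set.univ : Set X) = ⋃ j, Set.range (s.char j) := by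
    refine (Set.eq_univ_of_forall fun x => ?_).symm
    obtain ⟨⟨j, p⟩, ⟨-, rfl⟩, -⟩ := s.open_cells x
    exact Set.mem_iUnion.mpr ⟨j, p, rfl⟩
  rw [this]
  exact isCompact_iUnion fun j => isCompact_range (s.char j).continuous

omit [IsTopologicalGroup G] [CompactSpace G] [T2Space G] [ContinuousSMul G X] in
lemma sigma_ext {i j : s.ι} {p p'} (hp : ‖p.2.1‖ < 1) (hp' : ‖p'.2.1‖ < 1)
    (e : s.char i p = s.char j p') :
    (⟨i, p⟩ : (i : s.ι) × ((G ⧸ s.stab i) ×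
      Metric.closedBall (0 : EuclideanSpace ℝ (Fin (s.dim i))) 1)) = ⟨j, p'⟩ :=
  (s.open_cells (s.char j p')).unique ⟨hp, e⟩ ⟨hp', rfl⟩

/-- The last cell, with respect to a dimension increasing enumeration, is attached to the union of
the preceding cells. -/
def topCell [DecidableEq s.ι] {S : Finset s.ι} {a : s.ι} (ha : a ∉ S)
    (hS : ∀ j ∈ S, s.dim j ≤ s.dim a)
    (hlow : ∀ j ∈ insert a S, ∀ k, s.dim k < s.dim j → k ∈ insert a S) :
    ((GSpace.of G X).sub (s.cells (insert a S))).TopCell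
      (GSpace.preimage ((GSpace.of G X).incl (s.cells (insert a S))) (s.cells S)) where
  dim := s.dim a
  stab := s.stab a
  char := ⟨fun p => ⟨s.char a p, s.char_mem_cells (Finset.mem_insert_self a S) p⟩, by fun_prop⟩
  char_smul g q y := Subtype.ext (s.char_smul a g q y)
  isClosed := (s.isClosed_cells S).preimage continuous_subtype_val
  cover := by
    rintro ⟨x, hx⟩
    obtain ⟨j, hj, p, rfl⟩ := Set.mem_iUnion₂.mp hx
    rcases Finset.mem_insert.mp hj with rfl | hj
    · exact Or.inr ⟨p, rfl⟩
    · exact Or.inl (s.char_mem_cells hj p)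
  boundary p hp := by
    obtain ⟨j, hj, q', y', -, e⟩ := s.boundary a p.1 p.2 hp
    -- The cells of dimension below that of `a` lie in `insert a S`, and `a` is not among them.
    have h1 : j ∈ S := Finset.mem_of_mem_insert_of_ne
      (hlow a (Finset.mem_insert_self a S) j hj) fun h => hj.ne (congrArg s.dim h)
    change s.char a p ∈ s.cells S
    exact e ▸ s.char_mem_cells h1 (q', y')
  disjoint p hp h := by
    obtain ⟨j, hj, p', e⟩ := Set.mem_iUnion₂.mp (show s.char a p ∈ s.cells S from h)
    -- A point of the closed cell `j` lies in the open cell `j` or in one of smaller dimension.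
    -- Neither can be the cell `a`: the first since `a ∉ S`, the second since no cell of `S` exceeds
    -- `a` in dimension.
    rcases (mem_closedBall_zero_iff.mp p'.2.2).lt_or_eq with h1 | h1
    · have : j = a := congrArg Sigma.fst (s.sigma_ext h1 hp e)
      exact ha (this ▸ hj)
    · obtain ⟨k, hk, q'', y'', h2, e'⟩ := s.boundary j p'.1 p'.2 h1
      have := congrArg Sigma.fst (s.sigma_ext (p := (q'', y'')) h2 hp (e'.trans e))
      exact (hk.trans_le (hS j hj)).ne (congrArg s.dim this)
  inj p p' hp hp' e :=
    eq_of_heq (Sigma.mk.inj (s.sigma_ext hp hp' (congrArg Subtype.val e))).2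

end FiniteGCW

namespace TwistedTheory

variable (h : TwistedTheory.{v, u, w} 𝓣)

lemma goodOn_cells {G X : Type} [Group G] [TopologicalSpace G] [IsTopologicalGroup G]
    [CompactSpace G] [T2Space G] [TopologicalSpace X] [MulAction G X] [ContinuousSMul G X]
    (hadm : h.IsTAdmissible G) (s : FiniteGCW G X) (D : TTriple 𝓣 (GSpace.of G X))
    (S : Finset s.ι) (hS : ∀ j ∈ S, ∀ k, s.dim k < s.dim j → k ∈ S) :
    h.GoodOn D (s.cells S) := by
  classical
  have := s.t2
  have := s.compactSpace
  -- Removing a cell of maximal dimension leaves a set that still contains every cell of dimension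
  -- smaller than that of one of its members.
  induction S using Finset.induction_on_max_value s.dim with
  | empty =>
    have : s.cells ∅ = ⊥ := bot_unique fun x hx => by
      obtain ⟨j, hj, -⟩ := Set.mem_iUnion₂.mp hx
      exact absurd hj (Finset.notMem_empty j)
    rw [this]
    exact h.goodOn_bot D
  | insert a S ha hmax ih =>
    have h1 := ih fun j hj k hk =>
      (Finset.mem_insert.mp (hS j (Finset.mem_insert_of_mem hj) k hk)).resolve_left fun e =>
        (hk.trans_le (hmax j hj)).ne (congrArg s.dim e)
    have hle : s.cells S ≤ s.cells (insert a S) := fun x hx => by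
      obtain ⟨j, hj, p, rfl⟩ := Set.mem_iUnion₂.mp hx
      exact s.char_mem_cells (Finset.mem_insert_of_mem hj) p
    have hc : CompactSpace (s.cells (insert a S)) :=
      isCompact_iff_compactSpace.mp (s.isClosed_cells _).isCompact
    -- The ambient space for the attachment is the closed subcomplex `s.cells (insert a S)`, not
    -- `X`.
    have h2 := h.goodOn_top_of_topCell
      (X := (GSpace.of G X).sub (s.cells (insert a S))) (s.topCell ha hmax hS)
      (D.pull ((GSpace.of G X).incl (s.cells (insert a S)))) hadm
      ((h.goodOn_sub D _ _ hle).mpr h1)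
    exact (h.goodOn_top _).mp h2

end TwistedTheory

end

end TDuality

theorem mainTheorem6 (𝓣 : TDuality.TwistModel) (h : TDuality.TwistedTheory 𝓣)
    (G : Type) [Group G] [TopologicalSpace G] [IsTopologicalGroup G] [CompactSpace G] [T2Space G]
    (hadm : h.IsTAdmissible G)
    (X : Type) [TopologicalSpace X] [MulAction G X] [ContinuousSMul G X]
    (hX : Nonempty (TDuality.FiniteGCW G X))
    (D : TDuality.TTriple 𝓣 (TDuality.GSpace.of G X)) (n : ℤ) :
    CategoryTheory.IsIso (h.transform D n) := by
  obtain ⟨s⟩ := hX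
  have := s.finite
  have := Fintype.ofFinite s.ι
  have h1 := h.goodOn_cells hadm s D Finset.univ fun _ _ k _ => Finset.mem_univ k
  rw [s.cells_univ] at h1
  exact (h.isIso_transform_iff D n).mpr ((h.goodOn_top D).mp h1 n)
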